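/- **Construction of a penalization from supersolutions.** Let $N\in\mathbb N$, $N\ge 1$, $\alpha\in(0,N)$, $p\ge 2$ and $V\in C(\mathbb R^N;[0,\infty))$. Let $\Lambda\subset\mathbb R^N$ be a bounded open set with $0\in\Lambda$ and $0<\inf_\Lambda V<\inf_{\partial\Lambda}V$. Let $I_\alpha(x)=\frac{\Gamma((N-\alpha)/2)}{\Gamma(\alpha/2)\pi^{N/2}2^\alpha|x|^{N-\alpha}}$ be the Riesz kernel, $C_\alpha=\frac1{2^\alpha}\Bigl(\frac{\Gamma((N-\alpha)/4)}{\Gamma((N+\alpha)/4)}\Bigr)^2$, and let $H^1_V(\mathbb R^N)$ be the completion of $C^\infty_c(\mathbb R^N)$ for the norm $\bigl(\int_{\mathbb R^N}|\nabla u|^2+V|u|^2\bigr)^{1/2}$ (a space of functions, since $\inf_\Lambda V>0$). * If $p=2$ and $\alpha\ge N-2$, assume that $\inf_{x\in\mathbb R^N}V(x)(1+|x|^{N-\alpha})>0$. * If either $p>2$ or $\alpha<N-2$, and if moreover either $N\le 2$ or $p\le 1+\frac{\max(\alpha,1+\alpha/2)}{N-2}$, assume that $\liminf_{|x|\to\infty}V(x)|x|^2>0$.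 Let $\nu>0$, $\lambda>0$ and $\delta\in(0,1)$. Then there are $\varepsilon_0>0$ and functions $\bar u_\varepsilon\in H^1_V(\mathbb R^N)$, $0<\varepsilon<\varepsilon_0$, such that $\bar u_\varepsilon>0$ in $\mathbb R^N$, $\bar u_\varepsilon=e^{-\lambda/\varepsilon}$ on $\overline\Lambda$ and $$-\varepsilon^2\Delta\bar u_\varepsilon+(1-\delta)V\bar u_\varepsilon\ \ge\ \Bigl(p\,\varepsilon^{-\alpha}I_\alpha*\bigl(\chi_{\mathbb R^N\setminus\Lambda}\bar u_\varepsilon^{p}\bigr)+\nu\,\varepsilon^{N-\alpha}I_\alpha\Bigr)\chi_{\mathbb R^N\setminus\Lambda}\,\bar u_\varepsilon^{p-1}\quad\text{in }\mathbb R^N$$ weakly, that is, tested against all nonnegative compactly supported functions of $H^1(\mathbb R^N)$. Moreover, the functions $H_\varepsilon=\chi_{\mathbb R^N\setminus\Lambda}\bar u_\varepsilon^{p-1}$, $0<\varepsilon<\varepsilon_0$, form a family of penalization potentials: each $H_\varepsilon$ is measurable, nonnegative and bounded and vanishes on $\Lambda$; $H_\varepsilon\to0$ uniformly on $\mathbb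 R^N$ as $\varepsilon\to0$; and * $(H_1)$ for every $\varepsilon\in(0,\varepsilon_0)$, the space $H^1_V(\mathbb R^N)$ is compactly embedded in $L^2\bigl(\mathbb R^N,(H_\varepsilon(x)^2|x|^\alpha+\chi_\Lambda(x))\,dx\bigr)$; * $(H_2)$ there is $\kappa>0$, independent of $\varepsilon$, with $C_\alpha p\kappa<1$ such that for all $\varepsilon\in(0,\varepsilon_0)$ and all $\varphi\in H^1_V(\mathbb R^N)$, $$\frac1{\varepsilon^\alpha}\int_{\mathbb R^N}|H_\varepsilon(x)\varphi(x)|^2|x|^\alpha\,dx\le\kappa\int_{\mathbb R^N}\varepsilon^2|\nabla\varphi|^2+V|\varphi|^2.$$ -/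

import Mathlib

open MeasureTheory Filter Topology Set
open scoped ENNReal ContDiff

namespace Choquard

noncomputable section

/-- The Euclidean space `ℝ^N`. -/
abbrev E (N : ℕ) : Type := EuclideanSpace ℝ (Fin N)

/-- Smooth compactly supported functions. -/
def IsTest {N : ℕ} (φ : E N → ℝ) : Prop :=
  ContDiff ℝ ∞ φ ∧ HasCompactSupport φ

/-- `g` is the weak (distributional) gradient of the locally integrable function `u`. -/
def IsWeakGradient {N : ℕ} (u : E N → ℝ) (g : E N → E N) : Prop :=
  LocallyIntegrable u volume ∧ LocallyIntegrable g volume ∧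
    ∀ φ : E N → ℝ, IsTest φ → ∀ v : E N,
      ∫ x, u x * fderiv ℝ φ x v = - ∫ x, inner ℝ (g x) v * φ x

/-- The squared norm `∫ ε² |∇u|² + V |u|²`, where `g` stands for `∇u` and `V ≥ 0`. -/
def energy {N : ℕ} (ε : ℝ) (V : E N → ℝ) (u : E N → ℝ) (g : E N → E N) : ℝ≥0∞ :=
  ∫⁻ x, ENNReal.ofReal (ε ^ 2 * ‖g x‖ ^ 2 + V x * (u x) ^ 2)

/-- `u` belongs to `H¹_V(ℝ^N)`, with weak gradient `g`: `u` is the limit of smooth compactly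
supported functions for the norm of `energy`. The space does not depend on `ε > 0`, and `ε = 1` is
used. When `V` is continuous and is bounded from below by a positive constant on a nonempty open
set, this realizes the completion of the test functions as a space of functions. -/
def MemH1V {N : ℕ} (V : E N → ℝ) (u : E N → ℝ) (g : E N → E N) : Prop :=
  IsWeakGradient u g ∧
    ∃ φ : ℕ → E N → ℝ, (∀ n, IsTest (φ n)) ∧
      Tendsto (fun n => energy 1 V (fun x => φ n x - u x) (fun x => gradient (φ n) x - g x))
        atTop (𝓝 0)

/-- The Riesz kernel `I_α`. -/
def rieszKernel {N : ℕ} (α : ℝ) (x : E N) : ℝ :=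
  Real.Gamma (((N : ℝ) - α) / 2) /
    (Real.Gamma (α / 2) * Real.pi ^ ((N : ℝ) / 2) * 2 ^ α * ‖x‖ ^ ((N : ℝ) - α))

/-- The convolution `I_α * f` of the Riesz kernel with a nonnegative function `f`. -/
def rieszPotential {N : ℕ} (α : ℝ) (f : E N → ℝ) (x : E N) : ℝ≥0∞ :=
  ∫⁻ y, ENNReal.ofReal (rieszKernel α (x - y)) * ENNReal.ofReal (f y)

/-- The optimal constant `C_α` of the weighted Hardy–Littlewood–Sobolev inequality
`∫ |I_{α/2} * φ|² ≤ C_α ∫ |φ(x)|² |x|^α dx`. -/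
def weightedHLSConstant (N : ℕ) (α : ℝ) : ℝ :=
  1 / 2 ^ α * (Real.Gamma (((N : ℝ) - α) / 4) / Real.Gamma (((N : ℝ) + α) / 4)) ^ 2

/-- The right-hand side
`(p ε^{-α} I_α * (χ_{ℝ^N ∖ Λ} u^p) + ν ε^{N-α} I_α) χ_{ℝ^N ∖ Λ} u^{p-1}`, for `u ≥ 0`. -/
def choquardRHS {N : ℕ} (α p ν ε : ℝ) (Λ : Set (E N)) (u : E N → ℝ) (x : E N) : ℝ≥0∞ :=
  (ENNReal.ofReal (p * ε ^ (-α)) * rieszPotential α (Λᶜ.indicator fun y => u y ^ p) x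
      + ENNReal.ofReal (ν * ε ^ ((N : ℝ) - α) * rieszKernel α x))
    * ENNReal.ofReal (Λᶜ.indicator (fun y => u y ^ (p - 1)) x)

/-- `-ε² Δu + (1-δ) V u ≥ f` weakly in `ℝ^N`, where `g` is the weak gradient of `u` and `f` takes
nonnegative values. The inequality is tested against all nonnegative compactly supported functions
`φ` of `H¹(ℝ^N)`, with weak gradient `ψ`. The inequality in `EReal` says in particular that `f φ`
has a finite integral. -/
def IsWeakSupersolution {N : ℕ} (ε δ : ℝ) (V : E N → ℝ) (u : E N → ℝ) (g : E N → E N)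
    (f : E N → ℝ≥0∞) : Prop :=
  ∀ (φ : E N → ℝ) (ψ : E N → E N), IsWeakGradient φ ψ → MemLp φ 2 volume → MemLp ψ 2 volume →
    HasCompactSupport φ → (∀ x, 0 ≤ φ x) →
      Integrable (fun x => ε ^ 2 * inner ℝ (g x) (ψ x) + (1 - δ) * V x * u x * φ x) volume ∧
      ((∫⁻ x, f x * ENNReal.ofReal (φ x) : ℝ≥0∞) : EReal) ≤
        ((∫ x, (ε ^ 2 * inner ℝ (g x) (ψ x) + (1 - δ) * V x * u x * φ x) : ℝ) : EReal)

/-- The measure `(H(x)² |x|^α + χ_Λ(x)) dx`. -/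
def penaltyMeasure {N : ℕ} (α : ℝ) (Λ : Set (E N)) (H : E N → ℝ) : Measure (E N) :=
  volume.withDensity fun x =>
    ENNReal.ofReal (H x ^ 2 * ‖x‖ ^ α + Λ.indicator (fun _ => (1 : ℝ)) x)

/-- Condition `(H₁)`: the inclusion of `H¹_V(ℝ^N)` into `L²((H(x)² |x|^α + χ_Λ(x)) dx)` is well
defined, bounded and compact. -/
def ConditionH1 {N : ℕ} (α : ℝ) (V : E N → ℝ) (Λ : Set (E N)) (H : E N → ℝ) : Prop :=
  (∃ C : ℝ, 0 ≤ C ∧ ∀ u g, MemH1V V u g →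
    MemLp u 2 (penaltyMeasure α Λ H) ∧
    (eLpNorm u 2 (penaltyMeasure α Λ H)) ^ 2 ≤ ENNReal.ofReal C * energy 1 V u g) ∧
  ∀ (u : ℕ → E N → ℝ) (g : ℕ → E N → E N), (∀ n, MemH1V V (u n) (g n)) →
    (∃ M : ℝ, ∀ n, energy 1 V (u n) (g n) ≤ ENNReal.ofReal M) →
    ∃ (σ : ℕ → ℕ) (w : E N → ℝ), StrictMono σ ∧ MemLp w 2 (penaltyMeasure α Λ H) ∧
      Tendsto (fun n => eLpNorm (fun x => u (σ n) x - w x) 2 (penaltyMeasure α Λ H))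
        atTop (𝓝 0)

/-- The inequality of condition `(H₂)` with the constant `κ`, for one value of `ε`. -/
def HardyBound {N : ℕ} (α κ ε : ℝ) (V : E N → ℝ) (H : E N → ℝ) : Prop :=
  ∀ φ g, MemH1V V φ g →
    ENNReal.ofReal (ε ^ (-α)) * ∫⁻ x, ENNReal.ofReal (|H x * φ x| ^ 2 * ‖x‖ ^ α)
      ≤ ENNReal.ofReal κ * energy ε V φ g

/-- `(H_ε)`, `0 < ε < ε₀`, is a family of penalization potentials for the set `Λ`, converging
uniformly to `0` as `ε → 0`. -/
structure IsPenalization {N : ℕ} (Λ : Set (E N)) (ε₀ : ℝ) (H : ℝ → E N → ℝ) : Prop where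
  aestronglyMeasurable : ∀ ε ∈ Ioo 0 ε₀, AEStronglyMeasurable (H ε) volume
  nonneg : ∀ ε ∈ Ioo 0 ε₀, ∀ x, 0 ≤ H ε x
  bounded : ∀ ε ∈ Ioo 0 ε₀, ∃ M, ∀ x, H ε x ≤ M
  eq_zero : ∀ ε ∈ Ioo 0 ε₀, ∀ x ∈ Λ, H ε x = 0
  tendsto_zero : TendstoUniformly H (fun _ => 0) (𝓝[>] 0)

/-- The penalization potential `χ_{ℝ^N ∖ Λ} u^{p-1}`. -/
def penalizationOf {N : ℕ} (p : ℝ) (Λ : Set (E N)) (u : E N → ℝ) : E N → ℝ :=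
  Λᶜ.indicator fun x => u x ^ (p - 1)

end

end Choquard

/-!
The functions `u_ε = e^{-λ/ε} U` are multiples of a single function `U`, which does not depend on
`ε` and solves a linear problem with some room to spare.

*Barrier.* A power profile `(a + |x|²)^{-b}`, glued to the constant one on `closure Λ`, gives a
smooth function `w > 0` with `2 q w ≤ (1 - δ) V w - κ Δw`, where `q = c (1 + |x|)^{-σ}`
(`exists_exponents`, `exists_isBarrier_of_powerProfile`). The inequality holds at infinity either
because the profile decays more slowly than the fundamental solution, or because `V` dominates the
Laplacian. Near `closure Λ` it holds because `V` is bounded from below there and `κ` is small. Used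
as a ground state, `w` yields Hardy's inequality `2 ∫ q φ² ≤ ∫ κ |∇φ|² + V φ²` on `H¹_V`
(`IsBarrier.hardy`).

*Supersolution.* No upper bound is assumed on `V`, so that `w` need not belong to `H¹_V`. Instead,
`U` is the solution of an obstacle problem for `-κ Δ + (1 - δ) V - q`, with an obstacle below `w`
equal to one on `closure Λ`. The map `φ ↦ (w ∇(φ / w), √m φ)`, with
`m = ((1 - δ) V - q) / κ - Δw / w > 0`, is isometric for the quadratic form of this operator, and the
problem becomes a projection onto a closed convex set of `L²`. Truncation at the level `w` multiplies
the first component by a factor of modulus at most one and reduces the second one. Hence `U ≤ w`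
(`IsBarrier.exists_obstacle_solution`, `IsBarrier.exists_supersolution`), and `U` is equal to one on
`closure Λ` and inherits the decay of `w`.

*Nonlinear inequality.* By the decay of Riesz potentials (`exists_rieszPotential_le`) the right-hand
side is at most a small multiple, depending on `ε`, of `e^{-λ/ε} (1 + |x|)^{-σ} U`
(`exists_choquardRHS_le`). For small `ε` the margin `ε² / κ * q`, or `V` itself when `p = 2` and
`α ≥ N - 2`, absorbs it (`eventually_rhsSize_le`, `isWeakSupersolution_of_le`). Mollification passes
from smooth test functions to those of `H¹` (`integral_nonneg_of_test`).

*Penalization.* The weight `H_ε² |x|^α` is exponentially small with respect to `q`, so that Hardy's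
inequality gives `(H₂)` (`IsBarrier.hardyBound`). It also decays faster than `q`, and `(H₁)` follows
from Rellich's theorem, tails being controlled by Hardy's inequality
(`exists_subseq_tendsto_local`, `IsBarrier.conditionH1`).
-/

namespace Choquard

variable {N : ℕ}

/-! ### Test functions, Laplacian and weak gradients -/

/-- The `i`-th vector of the standard basis of `ℝ^N`. -/
noncomputable abbrev stdVec (i : Fin N) : E N := EuclideanSpace.single i (1 : ℝ)

/-- The Laplacian `∑ ∂ᵢ∂ᵢ f`, computed with iterated directional derivatives. -/
noncomputable def lap (f : E N → ℝ) (x : E N) : ℝ :=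
  ∑ i, fderiv ℝ (fun y => fderiv ℝ f y (stdVec i)) x (stdVec i)

lemma inner_stdVec (x : E N) (i : Fin N) : inner ℝ x (stdVec i) = x i := by
  simp [stdVec, EuclideanSpace.inner_single_right]

lemma inner_eq_sum (x y : E N) : inner ℝ x y = ∑ i, x i * y i := by
  simp [PiLp.inner_apply, mul_comm]

lemma gradient_apply (f : E N → ℝ) (x : E N) (i : Fin N) :
    gradient f x i = fderiv ℝ f x (stdVec i) := by
  rw [← inner_stdVec, inner_gradient_left]

lemma contDiff_fderiv_apply {f : E N → ℝ} (hf : ContDiff ℝ ∞ f) (v : E N) :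
    ContDiff ℝ ∞ (fun x => fderiv ℝ f x v) :=
  (hf.fderiv_right (m := ∞) (by simp)).clm_apply contDiff_const

lemma continuous_gradient {f : E N → ℝ} (hf : ContDiff ℝ ∞ f) : Continuous (gradient f) :=
  (InnerProductSpace.toDual ℝ (E N)).symm.continuous.comp (hf.continuous_fderiv (by simp))

lemma continuous_lap {f : E N → ℝ} (hf : ContDiff ℝ ∞ f) : Continuous (lap f) :=
  continuous_finsetSum _ fun i _ =>
    (contDiff_fderiv_apply (contDiff_fderiv_apply hf (stdVec i)) (stdVec i)).continuous

lemma norm_gradient (f : E N → ℝ) (x : E N) : ‖gradient f x‖ = ‖fderiv ℝ f x‖ := by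
  rw [gradient, LinearIsometryEquiv.norm_map]

namespace IsTest

variable {φ ψ f : E N → ℝ}

lemma continuous (h : IsTest φ) : Continuous φ := h.1.continuous

lemma differentiable (h : IsTest φ) : Differentiable ℝ φ := h.1.differentiable (by simp)

lemma mul_left (h : IsTest φ) (hf : ContDiff ℝ ∞ f) : IsTest (fun x => f x * φ x) :=
  ⟨hf.mul h.1, h.2.mul_left⟩

lemma sub (h : IsTest φ) (h' : IsTest ψ) : IsTest (fun x => φ x - ψ x) :=
  ⟨h.1.sub h'.1, h.2.sub h'.2⟩

lemma add (h : IsTest φ) (h' : IsTest ψ) : IsTest (fun x => φ x + ψ x) :=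
  ⟨h.1.add h'.1, h.2.add h'.2⟩

lemma const_mul (h : IsTest φ) (c : ℝ) : IsTest (fun x => c * φ x) :=
  h.mul_left contDiff_const

lemma fderiv_apply (h : IsTest φ) (v : E N) : IsTest (fun x => fderiv ℝ φ x v) :=
  ⟨contDiff_fderiv_apply h.1 v, h.2.fderiv_apply ℝ v⟩

lemma continuous_gradient (h : IsTest φ) : Continuous (gradient φ) :=
  Choquard.continuous_gradient h.1

lemma hasCompactSupport_gradient (h : IsTest φ) : HasCompactSupport (gradient φ) :=
  (h.2.fderiv ℝ).comp_left (g := (InnerProductSpace.toDual ℝ (E N)).symm) (by simp)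

lemma memLp (h : IsTest φ) (p : ℝ≥0∞) : MemLp φ p volume :=
  h.continuous.memLp_of_hasCompactSupport h.2

lemma memLp_gradient (h : IsTest φ) (p : ℝ≥0∞) : MemLp (gradient φ) p volume :=
  h.continuous_gradient.memLp_of_hasCompactSupport h.hasCompactSupport_gradient

end IsTest

lemma gradient_fun_sub {f g : E N → ℝ} {x : E N} (hf : DifferentiableAt ℝ f x)
    (hg : DifferentiableAt ℝ g x) :
    gradient (fun y => f y - g y) x = gradient f x - gradient g x := by
  simp [gradient, fderiv_fun_sub hf hg]

lemma gradient_fun_add {f g : E N → ℝ} {x : E N} (hf : DifferentiableAt ℝ f x)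
    (hg : DifferentiableAt ℝ g x) :
    gradient (fun y => f y + g y) x = gradient f x + gradient g x := by
  simp [gradient, fderiv_fun_add hf hg]

lemma gradient_fun_const_mul {f : E N → ℝ} {x : E N} (hf : DifferentiableAt ℝ f x) (c : ℝ) :
    gradient (fun y => c * f y) x = c • gradient f x := by
  simp [gradient, fderiv_const_mul hf]

lemma gradient_fun_mul {f g : E N → ℝ} {x : E N} (hf : DifferentiableAt ℝ f x)
    (hg : DifferentiableAt ℝ g x) :
    gradient (fun y => f y * g y) x = f x • gradient g x + g x • gradient f x := by
  simp [gradient, fderiv_fun_mul hf hg]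

lemma locallyIntegrable_coord {g : E N → E N} (hg : LocallyIntegrable g volume) (i : Fin N) :
    LocallyIntegrable (fun x => g x i) volume := by
  intro x
  obtain ⟨s, hs, h⟩ := hg x
  exact ⟨s, hs, (EuclideanSpace.proj (𝕜 := ℝ) i : E N →L[ℝ] ℝ).integrable_comp h⟩

lemma integrable_mul_of_locallyIntegrable {u f : E N → ℝ} (hu : LocallyIntegrable u volume)
    (hf : Continuous f) (hf' : HasCompactSupport f) : Integrable (fun x => u x * f x) volume := by
  simpa [mul_comm] using hu.integrable_smul_left_of_hasCompactSupport hf hf'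

lemma integrable_inner_of_locallyIntegrable {g F : E N → E N} (hg : LocallyIntegrable g volume)
    (hF : Continuous F) (hF' : HasCompactSupport F) :
    Integrable (fun x => inner ℝ (g x) (F x)) volume := by
  simp only [inner_eq_sum]
  refine integrable_finsetSum _ fun i _ =>
    integrable_mul_of_locallyIntegrable (locallyIntegrable_coord hg i) ?_ ?_
  · exact (EuclideanSpace.proj (𝕜 := ℝ) i : E N →L[ℝ] ℝ).continuous.comp hF
  · exact hF'.comp_left (g := fun y : E N => y i) (by simp)

/-- The weak gradient tested against smooth compactly supported vector fields. -/
lemma IsWeakGradient.integral_div {u : E N → ℝ} {g : E N → E N} (h : IsWeakGradient u g)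
    {ζ : Fin N → E N → ℝ} (hζ : ∀ i, IsTest (ζ i)) :
    ∫ x, u x * ∑ i, fderiv ℝ (ζ i) x (stdVec i) = - ∫ x, ∑ i, g x i * ζ i x := by
  have h1 : ∀ i, Integrable (fun x => u x * fderiv ℝ (ζ i) x (stdVec i)) volume := fun i =>
    integrable_mul_of_locallyIntegrable h.1 ((hζ i).fderiv_apply _).continuous
      ((hζ i).fderiv_apply _).2
  have h2 : ∀ i, Integrable (fun x => g x i * ζ i x) volume := fun i =>
    integrable_mul_of_locallyIntegrable (locallyIntegrable_coord h.2.1 i) (hζ i).continuous (hζ i).2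
  simp only [Finset.mul_sum]
  rw [integral_finsetSum _ fun i _ => h1 i, integral_finsetSum _ fun i _ => h2 i,
    ← Finset.sum_neg_distrib]
  refine Finset.sum_congr rfl fun i _ => ?_
  rw [h.2.2 _ (hζ i) (stdVec i)]
  simp only [inner_stdVec]

lemma isWeakGradient_of_contDiff {f : E N → ℝ} (hf : ContDiff ℝ ∞ f) :
    IsWeakGradient f (gradient f) := by
  refine ⟨hf.continuous.locallyIntegrable, (continuous_gradient hf).locallyIntegrable, ?_⟩
  intro φ hφ v
  simp only [inner_gradient_left]
  have hf1 := (contDiff_fderiv_apply hf v).continuous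
  refine integral_mul_fderiv_eq_neg_fderiv_mul_of_integrable ?_ ?_ ?_ ?_ ?_
  · exact integrable_mul_of_locallyIntegrable hf1.locallyIntegrable hφ.continuous hφ.2
  · exact integrable_mul_of_locallyIntegrable hf.continuous.locallyIntegrable
      (hφ.fderiv_apply v).continuous (hφ.fderiv_apply v).2
  · exact integrable_mul_of_locallyIntegrable hf.continuous.locallyIntegrable hφ.continuous hφ.2
  · exact fun x _ => hf.differentiable (by simp) x
  · exact fun x _ => hφ.differentiable x

/-- The logarithmic gradient `∇w / w`. -/
noncomputable def logGrad (w : E N → ℝ) (x : E N) : E N := (w x)⁻¹ • gradient w x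

lemma continuous_logGrad {w : E N → ℝ} (hw : ContDiff ℝ ∞ w) (hw0 : ∀ x, 0 < w x) :
    Continuous (logGrad w) :=
  (hw.continuous.inv₀ fun x => (hw0 x).ne').smul (continuous_gradient hw)

/-- The ground state identity: for `w > 0`, the field `∇u - u ∇w / w` turns the Dirichlet form
into the form with potential `Δw / w`. -/
lemma IsWeakGradient.ground_state {w : E N → ℝ} (hw : ContDiff ℝ ∞ w) (hw0 : ∀ x, 0 < w x)
    {u : E N → ℝ} {g : E N → E N} (h : IsWeakGradient u g) {η : E N → ℝ} (hη : IsTest η) :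
    ∫ x, inner ℝ (g x - u x • logGrad w x) (gradient η x - η x • logGrad w x)
      = ∫ x, (inner ℝ (g x) (gradient η x) + lap w x / w x * u x * η x) := by
  set ζ : Fin N → E N → ℝ := fun i x => ((w x)⁻¹ * fderiv ℝ w x (stdVec i)) * η x with hζdef
  have hinv : ContDiff ℝ ∞ (fun x => (w x)⁻¹) := hw.inv fun x => (hw0 x).ne'
  have hζ : ∀ i, IsTest (ζ i) := fun i =>
    hη.mul_left (hinv.mul (contDiff_fderiv_apply hw _))
  have hdiv := h.integral_div hζ
  have hbc := continuous_logGrad hw hw0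
  have hb : ∀ x i, logGrad w x i = (w x)⁻¹ * fderiv ℝ w x (stdVec i) := by
    intro x i; simp [logGrad, gradient_apply]
  have hder : ∀ x i, fderiv ℝ (ζ i) x (stdVec i) = logGrad w x i * gradient η x i
      + η x * ((w x)⁻¹ * fderiv ℝ (fun y => fderiv ℝ w y (stdVec i)) x (stdVec i)
        - logGrad w x i * logGrad w x i) := by
    intro x i
    have d1 : DifferentiableAt ℝ (fun x => (w x)⁻¹) x := hinv.differentiable (by simp) x
    have d2 : DifferentiableAt ℝ (fun x => fderiv ℝ w x (stdVec i)) x :=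
      (contDiff_fderiv_apply hw _).differentiable (by simp) x
    have d0 : DifferentiableAt ℝ w x := hw.differentiable (by simp) x
    have e1 : fderiv ℝ (fun x => (w x)⁻¹) x = -((w x) ^ 2)⁻¹ • fderiv ℝ w x :=
      ((hasDerivAt_inv (hw0 x).ne').comp_hasFDerivAt x d0.hasFDerivAt).fderiv
    rw [hζdef]
    simp only
    rw [fderiv_fun_mul (d1.fun_mul d2) (hη.differentiable x), fderiv_fun_mul d1 d2, e1]
    simp only [hb, gradient_apply, add_apply, smul_apply,
      smul_eq_mul]
    have := (hw0 x).ne'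
    field_simp
    ring
  have hsum : ∀ x, ∑ i, fderiv ℝ (ζ i) x (stdVec i) = inner ℝ (logGrad w x) (gradient η x)
      + η x * (lap w x / w x - inner ℝ (logGrad w x) (logGrad w x)) := by
    intro x
    simp only [hder, Finset.sum_add_distrib, ← Finset.mul_sum, Finset.sum_sub_distrib, inner_eq_sum,
      lap, div_eq_inv_mul]
  have hsum2 : ∀ x, ∑ i, g x i * ζ i x = inner ℝ (g x) (η x • logGrad w x) := by
    intro x
    simp only [inner_eq_sum, hζdef, PiLp.smul_apply, smul_eq_mul, hb]
    exact Finset.sum_congr rfl fun i _ => by ring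
  simp only [hsum, hsum2] at hdiv
  have hlw : Continuous fun x => lap w x / w x :=
    (continuous_lap hw).div hw.continuous fun x => (hw0 x).ne'
  have i1 : Integrable (fun x => u x * (inner ℝ (logGrad w x) (gradient η x)
      + η x * (lap w x / w x - inner ℝ (logGrad w x) (logGrad w x)))) volume := by
    refine integrable_mul_of_locallyIntegrable h.1 ?_ ?_
    · exact (hbc.inner hη.continuous_gradient).add
        (hη.continuous.mul (hlw.sub (hbc.inner hbc)))
    · refine HasCompactSupport.add ?_ hη.2.mul_right
      refine hη.hasCompactSupport_gradient.mono fun x hx h0 => hx ?_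
      simp only [h0, inner_zero_right]
  have i2 : Integrable (fun x => inner ℝ (g x) (η x • logGrad w x)) volume :=
    integrable_inner_of_locallyIntegrable h.2.1 (hη.continuous.smul hbc) hη.2.smul_right
  have i3 : Integrable (fun x => inner ℝ (g x) (gradient η x)) volume :=
    integrable_inner_of_locallyIntegrable h.2.1 hη.continuous_gradient hη.hasCompactSupport_gradient
  have i4 : Integrable (fun x => lap w x / w x * u x * η x) volume := by
    refine (integrable_mul_of_locallyIntegrable h.1 (hlw.mul hη.continuous)
      hη.2.mul_left).congr (.of_forall fun x => by simp only [Pi.mul_apply]; ring)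
  have key : ∀ x, inner ℝ (g x - u x • logGrad w x) (gradient η x - η x • logGrad w x)
      = (inner ℝ (g x) (gradient η x) + lap w x / w x * u x * η x)
        - (u x * (inner ℝ (logGrad w x) (gradient η x)
          + η x * (lap w x / w x - inner ℝ (logGrad w x) (logGrad w x)))
          + inner ℝ (g x) (η x • logGrad w x)) := by
    intro x
    simp only [inner_sub_left, inner_sub_right, real_inner_smul_left, real_inner_smul_right]
    ring
  simp only [key]
  rw [integral_sub (i3.fun_add i4) (i1.fun_add i2), integral_add i1 i2, hdiv, neg_add_cancel,
    sub_zero]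


/-! ### Mollification -/

/-- The convolution `ρ * f` of a scalar kernel `ρ` with a vector valued function `f`. -/
noncomputable def mollify {F : Type*} [NormedAddCommGroup F] [NormedSpace ℝ F]
    (ρ : E N → ℝ) (f : E N → F) (x : E N) : F := ∫ t, ρ t • f (x - t)

lemma mollify_eq_convolution {F : Type*} [NormedAddCommGroup F] [NormedSpace ℝ F]
    (ρ : E N → ℝ) (f : E N → F) :
    mollify ρ f = convolution ρ f (ContinuousLinearMap.lsmul ℝ ℝ) volume := rfl

lemma mollify_eq_swap {F : Type*} [NormedAddCommGroup F] [NormedSpace ℝ F]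
    (ρ : E N → ℝ) (f : E N → F) (x : E N) : mollify ρ f x = ∫ y, ρ (x - y) • f y := by
  rw [mollify_eq_convolution, convolution_eq_swap]
  rfl

lemma IsTest.comp_sub_left {ρ : E N → ℝ} (hρ : IsTest ρ) (x : E N) :
    IsTest (fun y => ρ (x - y)) :=
  ⟨hρ.1.comp (contDiff_const.sub contDiff_id),
    hρ.2.comp_homeomorph (Homeomorph.subLeft x)⟩

lemma contDiff_mollify {ρ u : E N → ℝ} (hρ : IsTest ρ) (hu : LocallyIntegrable u volume) :
    ContDiff ℝ ∞ (mollify ρ u) :=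
  hρ.2.contDiff_convolution_left (ContinuousLinearMap.lsmul ℝ ℝ) hρ.1 hu

lemma isTest_mollify {ρ u : E N → ℝ} (hρ : IsTest ρ) (hu : LocallyIntegrable u volume)
    (hu' : HasCompactSupport u) : IsTest (mollify ρ u) :=
  ⟨contDiff_mollify hρ hu, hρ.2.convolution (ContinuousLinearMap.lsmul ℝ ℝ) hu'⟩

lemma integrable_comp_sub_smul {F : Type*} [NormedAddCommGroup F] [NormedSpace ℝ F]
    {ρ : E N → ℝ} (hρ : IsTest ρ) {f : E N → F} (hf : LocallyIntegrable f volume) (x : E N) :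
    Integrable (fun y => ρ (x - y) • f y) volume :=
  hf.integrable_smul_left_of_hasCompactSupport (hρ.comp_sub_left x).continuous
    (hρ.comp_sub_left x).2

/-- Mollification commutes with the weak gradient. -/
lemma IsWeakGradient.gradient_mollify {ρ u : E N → ℝ} {g : E N → E N} (h : IsWeakGradient u g)
    (hρ : IsTest ρ) (x : E N) : gradient (mollify ρ u) x = mollify ρ g x := by
  refine ext_inner_right ℝ fun v => ?_
  have hd := hρ.2.hasFDerivAt_convolution_left (ContinuousLinearMap.lsmul ℝ ℝ)
    (hρ.1.of_le (by simp)) h.1 x (𝕜 := ℝ)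
  rw [inner_gradient_left, mollify_eq_convolution, hd.fderiv, convolution_eq_swap]
  have hint : Integrable (fun t => ((ContinuousLinearMap.precompL (E N)
      (ContinuousLinearMap.lsmul ℝ ℝ)) (fderiv ℝ ρ (x - t))) (u t)) volume := by
    have := (hρ.2.fderiv ℝ).convolutionExists_left
      ((ContinuousLinearMap.precompL (E N) (ContinuousLinearMap.lsmul ℝ ℝ)))
      (hρ.1.continuous_fderiv (by simp)) h.1 x (𝕜 := ℝ) (μ := volume)
    exact this.integrable_swap
  rw [ContinuousLinearMap.integral_apply hint]
  have h1 := h.2.2 _ (hρ.comp_sub_left x) v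
  have h2 : ∀ y, fderiv ℝ (fun y => ρ (x - y)) y v = - fderiv ℝ ρ (x - y) v := by
    intro y
    have : HasFDerivAt (fun y => ρ (x - y)) ((fderiv ℝ ρ (x - y)).comp
        (-ContinuousLinearMap.id ℝ (E N))) y :=
      (hρ.differentiable (x - y)).hasFDerivAt.comp y ((hasFDerivAt_id y).const_sub x)
    rw [this.fderiv]; simp
  simp only [h2, mul_neg, integral_neg, neg_inj] at h1
  have h3 : inner ℝ (mollify ρ g x) v = ∫ y, inner ℝ (g y) v * ρ (x - y) := by
    rw [mollify_eq_swap, real_inner_comm, ← integral_inner (integrable_comp_sub_smul hρ h.2.1 x)]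
    refine integral_congr_ae (.of_forall fun y => ?_)
    simp only [inner_smul_right]
    rw [real_inner_comm, mul_comm]
  rw [h3, ← h1]
  refine integral_congr_ae (.of_forall fun y => ?_)
  simp [ContinuousLinearMap.precompL_apply, mul_comm]

/-- A sequence of bumps, with supports shrinking to the origin. -/
noncomputable def bumpSeq (N : ℕ) (j : ℕ) : ContDiffBump (0 : E N) where
  rIn := 1 / ((j : ℝ) + 1)
  rOut := 2 / ((j : ℝ) + 1)
  rIn_pos := by positivity
  rIn_lt_rOut := by gcongr; norm_num

/-- The standard mollifiers: smooth, nonnegative, of integral one and supported in the ball of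
radius `2 / (j + 1)`. -/
noncomputable def mollifier (N : ℕ) (j : ℕ) : E N → ℝ := (bumpSeq N j).normed volume

lemma isTest_mollifier (j : ℕ) : IsTest (mollifier N j) :=
  ⟨(bumpSeq N j).contDiff_normed, (bumpSeq N j).hasCompactSupport_normed⟩

lemma mollifier_nonneg (j : ℕ) (x : E N) : 0 ≤ mollifier N j x := (bumpSeq N j).nonneg_normed x

lemma integral_mollifier (j : ℕ) : ∫ x, mollifier N j x = 1 := (bumpSeq N j).integral_normed

lemma mollifier_eq_zero {j : ℕ} {x : E N} (hx : 2 / ((j : ℝ) + 1) ≤ ‖x‖) :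
    mollifier N j x = 0 := by
  by_contra h
  have : x ∈ Function.support ((bumpSeq N j).normed volume) := h
  rw [(bumpSeq N j).support_normed_eq, Metric.mem_ball, dist_zero_right] at this
  exact absurd this (not_lt.2 hx)

lemma tendsto_two_div : Tendsto (fun j : ℕ => 2 / ((j : ℝ) + 1)) atTop (𝓝 0) := by
  have := (tendsto_one_div_add_atTop_nhds_zero_nat (𝕜 := ℝ)).const_mul 2
  simpa [div_eq_mul_inv] using this

lemma ae_tendsto_mollify {u : E N → ℝ} (hu : LocallyIntegrable u volume) :
    ∀ᵐ x, Tendsto (fun j => mollify (mollifier N j) u x) atTop (𝓝 (u x)) :=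
  ContDiffBump.ae_convolution_tendsto_right_of_locallyIntegrable (φ := bumpSeq N) (K := 2)
    tendsto_two_div (.of_forall fun j => by
      change 2 / ((j : ℝ) + 1) ≤ 2 * (1 / ((j : ℝ) + 1)); rw [mul_one_div]) hu

/-- A function with vanishing weak gradient is constant almost everywhere. -/
lemma IsWeakGradient.ae_const {u : E N → ℝ} (h : IsWeakGradient u 0) :
    ∃ c : ℝ, ∀ᵐ x, u x = c := by
  have hconst : ∀ j x, mollify (mollifier N j) u x = mollify (mollifier N j) u 0 := by
    intro j x
    have hs := contDiff_mollify (isTest_mollifier j) h.1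
    refine is_const_of_fderiv_eq_zero (𝕜 := ℝ) (hs.differentiable (by simp)) (fun y => ?_) x 0
    have := h.gradient_mollify (isTest_mollifier j) y
    rw [← norm_eq_zero, ← norm_gradient, this]
    simp [mollify]
  have hae := ae_tendsto_mollify h.1
  obtain ⟨x₀, hx₀⟩ := hae.exists
  refine ⟨u x₀, ?_⟩
  filter_upwards [hae] with x hx
  refine tendsto_nhds_unique hx (hx₀.congr fun j => ?_)
  rw [hconst j x₀, hconst j x]

lemma IsWeakGradient.sub {u u' : E N → ℝ} {g g' : E N → E N} (h : IsWeakGradient u g)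
    (h' : IsWeakGradient u' g') : IsWeakGradient (fun x => u x - u' x) (fun x => g x - g' x) := by
  refine ⟨h.1.sub h'.1, h.2.1.sub h'.2.1, fun φ hφ v => ?_⟩
  have e1 := h.2.2 φ hφ v
  have e2 := h'.2.2 φ hφ v
  have hF : Continuous (fun x => φ x • v) := hφ.continuous.smul continuous_const
  have hF' : HasCompactSupport (fun x => φ x • v) := hφ.2.smul_right
  have i1 := integrable_inner_of_locallyIntegrable h.2.1 hF hF'
  have i2 := integrable_inner_of_locallyIntegrable h'.2.1 hF hF'
  simp only [inner_smul_right, mul_comm (φ _)] at i1 i2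
  have hd := hφ.fderiv_apply v
  simp only [sub_mul, inner_sub_left]
  rw [integral_sub i1 i2, integral_sub (integrable_mul_of_locallyIntegrable h.1 hd.1.continuous hd.2)
    (integrable_mul_of_locallyIntegrable h'.1 hd.1.continuous hd.2), e1, e2]
  ring

lemma IsWeakGradient.congr {u u' : E N → ℝ} {g g' : E N → E N} (h : IsWeakGradient u g)
    (hu : u =ᵐ[volume] u') (hg : g =ᵐ[volume] g') : IsWeakGradient u' g' := by
  refine ⟨h.1.congr hu, h.2.1.congr hg, fun φ hφ v => ?_⟩
  rw [← integral_congr_ae (hu.mono fun x hx => by simp only [hx] :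
      (fun x => u x * fderiv ℝ φ x v) =ᵐ[volume] fun x => u' x * fderiv ℝ φ x v),
    ← integral_congr_ae (hg.mono fun x hx => by simp only [hx] :
      (fun x => inner ℝ (g x) v * φ x) =ᵐ[volume] fun x => inner ℝ (g' x) v * φ x)]
  exact h.2.2 φ hφ v

/-! ### Weighted `L²` norms -/

/-- Lebesgue measure weighted by the nonnegative part of `ϖ`. -/
noncomputable abbrev wm (ϖ : E N → ℝ) : Measure (E N) :=
  volume.withDensity fun x => ENNReal.ofReal (ϖ x)

lemma ae_wm_of_ae {ϖ : E N → ℝ} {p : E N → Prop} (h : ∀ᵐ x, p x) : ∀ᵐ x ∂(wm ϖ), p x :=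
  (withDensity_absolutelyContinuous _ _).ae_le h

lemma lintegral_wm {ϖ : E N → ℝ} (hϖ : Measurable ϖ) (f : E N → ℝ≥0∞) :
    ∫⁻ x, f x ∂(wm ϖ) = ∫⁻ x, ENNReal.ofReal (ϖ x) * f x :=
  lintegral_withDensity_eq_lintegral_mul_non_measurable _ hϖ.ennreal_ofReal
    (.of_forall fun _ => ENNReal.ofReal_lt_top) f

lemma eLpNorm_two_sq {α F : Type*} [MeasurableSpace α] [NormedAddCommGroup F] (μ : Measure α)
    (f : α → F) : eLpNorm f 2 μ ^ 2 = ∫⁻ x, ‖f x‖ₑ ^ 2 ∂μ := by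
  have := eLpNorm_nnreal_pow_eq_lintegral (μ := μ) (f := f) (p := 2) (by norm_num)
  simpa using this

lemma eLpNorm_wm_sq {F : Type*} [NormedAddCommGroup F] {ϖ : E N → ℝ} (hϖ : Measurable ϖ)
    (f : E N → F) : eLpNorm f 2 (wm ϖ) ^ 2 = ∫⁻ x, ENNReal.ofReal (ϖ x) * ‖f x‖ₑ ^ 2 := by
  rw [eLpNorm_two_sq, lintegral_wm hϖ]

lemma enorm_sq_eq_ofReal {F : Type*} [NormedAddCommGroup F] (a : F) :
    ‖a‖ₑ ^ 2 = ENNReal.ofReal (‖a‖ ^ 2) := by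
  rw [← ofReal_norm, ENNReal.ofReal_pow (norm_nonneg _)]

lemma energy_eq {ε : ℝ} {V : E N → ℝ} (hV : Continuous V) (hV0 : ∀ x, 0 ≤ V x) {u : E N → ℝ}
    {g : E N → E N} (hu : AEStronglyMeasurable u volume) :
    energy ε V u g
      = ENNReal.ofReal (ε ^ 2) * eLpNorm g 2 volume ^ 2 + eLpNorm u 2 (wm V) ^ 2 := by
  rw [eLpNorm_wm_sq hV.measurable, eLpNorm_two_sq, ← lintegral_const_mul' _ _ (by simp),
    ← lintegral_add_right']
  · refine lintegral_congr fun x => ?_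
    rw [ENNReal.ofReal_add (by positivity) (mul_nonneg (hV0 x) (sq_nonneg _)), enorm_sq_eq_ofReal,
      enorm_sq_eq_ofReal, ENNReal.ofReal_mul (sq_nonneg _), ENNReal.ofReal_mul (hV0 x),
      Real.norm_eq_abs, sq_abs]
  · exact (hV.measurable.ennreal_ofReal.aemeasurable).mul (hu.enorm.pow_const 2)

lemma lintegral_mul_le_of_sq {α : Type*} [MeasurableSpace α]
    {μ : Measure α} {f g : α → ℝ≥0∞} (hf : AEMeasurable f μ) (hg : AEMeasurable g μ) :
    ∫⁻ x, f x * g x ∂μ ≤ (∫⁻ x, f x ^ 2 ∂μ) ^ (1 / 2 : ℝ) * (∫⁻ x, g x ^ 2 ∂μ) ^ (1 / 2 : ℝ) := by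
  have := ENNReal.lintegral_mul_le_Lp_mul_Lq μ Real.HolderConjugate.two_two hf hg
  simpa using this

lemma wm_one : wm (fun _ : E N => (1 : ℝ)) = volume := by
  simp [wm]

/-- A smooth cutoff function, equal to one on a compact set and supported in a given
neighbourhood of it. -/
lemma exists_isTest_cutoff {K U : Set (E N)} (hK : IsCompact K) (hU : IsOpen U) (hKU : K ⊆ U) :
    ∃ χ : E N → ℝ, IsTest χ ∧ (∀ x, 0 ≤ χ x) ∧ (∀ x, χ x ≤ 1) ∧ (∀ x ∈ K, χ x = 1) ∧
      tsupport χ ⊆ U := by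
  obtain ⟨L, hL, hKL, hLU⟩ := exists_compact_between hK hU hKU
  obtain ⟨f, hf, hr, h0, h1⟩ := exists_contMDiff_zero_iff_one_iff_of_isClosed
    (modelWithCornersSelf ℝ (E N)) (n := ⊤) (s := (interior L)ᶜ) (t := K)
    isOpen_interior.isClosed_compl hK.isClosed
    (disjoint_left.2 fun x hx hx' => hx (hKL hx'))
  have hsupp : Function.support f ⊆ L := fun x hx => by
    by_contra hxL
    exact hx ((h0 x).1 fun h => hxL (interior_subset h))
  have hts : tsupport f ⊆ L := closure_minimal hsupp hL.isClosed
  exact ⟨f, ⟨hf.contDiff, hL.of_isClosed_subset (isClosed_tsupport f) hts⟩,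
    fun x => (hr ⟨x, rfl⟩).1, fun x => (hr ⟨x, rfl⟩).2, fun x hx => (h1 x).1 hx, hts.trans hLU⟩


/-! ### Limits in weighted `L²` spaces -/

lemma lintegral_mul_le_eLpNorm_wm {F : Type*} [NormedAddCommGroup F] {ϖ : E N → ℝ}
    (hϖ : Continuous ϖ) (hϖ0 : ∀ x, 0 < ϖ x) {v : E N → F} (hv : AEStronglyMeasurable v volume)
    {f : E N → ℝ} (hf : Continuous f) :
    ∫⁻ x, ‖v x‖ₑ * ‖f x‖ₑ ≤ eLpNorm v 2 (wm ϖ) *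
      (∫⁻ x, ‖(ϖ x)⁻¹ * f x ^ 2‖ₑ) ^ (1 / 2 : ℝ) := by
  have hac : wm ϖ ≪ volume := withDensity_absolutelyContinuous _ _
  have h1 : ∫⁻ x, ‖v x‖ₑ * ‖f x‖ₑ = ∫⁻ x, ‖v x‖ₑ * ‖(ϖ x)⁻¹ * f x‖ₑ ∂(wm ϖ) := by
    rw [lintegral_wm hϖ.measurable]
    refine lintegral_congr fun x => ?_
    have : ‖f x‖ₑ = ENNReal.ofReal (ϖ x) * ‖(ϖ x)⁻¹ * f x‖ₑ := by
      rw [← Real.enorm_of_nonneg (hϖ0 x).le, ← enorm_mul, mul_inv_cancel_left₀ (hϖ0 x).ne']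
    rw [this]; ring
  have hc : Continuous fun x => (ϖ x)⁻¹ * f x := (hϖ.inv₀ fun x => (hϖ0 x).ne').mul hf
  rw [h1]
  refine (lintegral_mul_le_of_sq (hv.mono_ac hac).enorm
    hc.aestronglyMeasurable.enorm).trans (le_of_eq ?_)
  congr 1
  · rw [← eLpNorm_two_sq, ← ENNReal.rpow_natCast, ← ENNReal.rpow_mul]; norm_num
  · congr 1
    rw [lintegral_wm hϖ.measurable]
    refine lintegral_congr fun x => ?_
    rw [← Real.enorm_of_nonneg (hϖ0 x).le, ← enorm_pow, ← enorm_mul]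
    congr 1
    have := (hϖ0 x).ne'
    field_simp

lemma lintegral_inv_mul_sq_lt_top {ϖ : E N → ℝ}
    (hϖ : Continuous ϖ) (hϖ0 : ∀ x, 0 < ϖ x) {f : E N → ℝ} (hf : Continuous f)
    (hf' : HasCompactSupport f) : (∫⁻ x, ‖(ϖ x)⁻¹ * f x ^ 2‖ₑ) ^ (1 / 2 : ℝ) < ⊤ := by
  refine ENNReal.rpow_lt_top_of_nonneg (by norm_num) (ne_of_lt ?_)
  have : Integrable (fun x => (ϖ x)⁻¹ * f x ^ 2) volume := by
    refine Continuous.integrable_of_hasCompactSupport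
      ((hϖ.inv₀ fun x => (hϖ0 x).ne').mul (hf.pow 2)) ?_
    exact HasCompactSupport.mul_left (hf'.comp_left (g := fun t : ℝ => t ^ 2) (by simp))
  exact this.2

/-- Convergence in a weighted `L²` space implies local integrability of the limit. -/
lemma locallyIntegrable_of_eLpNorm_wm_sub_lt {F : Type*} [NormedAddCommGroup F] {ϖ : E N → ℝ}
    (hϖ : Continuous ϖ) (hϖ0 : ∀ x, 0 < ϖ x) {u v : E N → F} (hv : LocallyIntegrable v volume)
    (hu : AEStronglyMeasurable u volume)
    (h : eLpNorm (fun x => v x - u x) 2 (wm ϖ) < ⊤) : LocallyIntegrable u volume := by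
  rw [locallyIntegrable_iff] at hv ⊢
  intro K hK
  obtain ⟨χ, hχ, -, -, hχ1, -⟩ := exists_isTest_cutoff hK isOpen_univ (subset_univ K)
  have hm : AEStronglyMeasurable (fun x => v x - u x) volume :=
    ((locallyIntegrable_iff.2 hv).aestronglyMeasurable).sub hu
  have hd : IntegrableOn (fun x => v x - u x) K volume := by
    refine ⟨hm.restrict, ?_⟩
    have := (lintegral_mul_le_eLpNorm_wm hϖ hϖ0 hm hχ.continuous).trans_lt
      (ENNReal.mul_lt_top h (lintegral_inv_mul_sq_lt_top hϖ hϖ0 hχ.continuous hχ.2))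
    refine lt_of_le_of_lt ?_ this
    refine le_trans (le_of_eq ?_) (setLIntegral_le_lintegral K _)
    refine setLIntegral_congr_fun hK.measurableSet fun x hx => ?_
    simp [hχ1 x hx]
  refine ((hv K hK).sub hd).congr (.of_forall fun x => ?_)
  simp

lemma tendsto_integral_mul_of_eLpNorm_wm {ϖ : E N → ℝ}
    (hϖ : Continuous ϖ) (hϖ0 : ∀ x, 0 < ϖ x) {u : E N → ℝ} {φ : ℕ → E N → ℝ}
    (hφ : ∀ n, LocallyIntegrable (φ n) volume) (hu : LocallyIntegrable u volume)
    (h : Tendsto (fun n => eLpNorm (fun x => φ n x - u x) 2 (wm ϖ)) atTop (𝓝 0))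
    {f : E N → ℝ} (hf : Continuous f) (hf' : HasCompactSupport f) :
    Tendsto (fun n => ∫ x, φ n x * f x) atTop (𝓝 (∫ x, u x * f x)) := by
  refine tendsto_integral_of_L1 _ (integrable_mul_of_locallyIntegrable hu hf hf').1
    (.of_forall fun n => integrable_mul_of_locallyIntegrable (hφ n) hf hf') ?_
  have hC := lintegral_inv_mul_sq_lt_top hϖ hϖ0 hf hf'
  refine tendsto_of_tendsto_of_tendsto_of_le_of_le tendsto_const_nhds
    (by simpa only [zero_mul] using ENNReal.Tendsto.mul_const h (.inr hC.ne)) (fun _ => zero_le) fun n => ?_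
  refine le_trans (le_of_eq (lintegral_congr fun x => ?_)) (lintegral_mul_le_eLpNorm_wm hϖ hϖ0
    ((hφ n).aestronglyMeasurable.sub hu.aestronglyMeasurable) hf)
  rw [← sub_mul, enorm_mul]
  rfl

/-- Weak gradients are stable under `L²` convergence of the gradients and weighted `L²` convergence
of the functions. -/
lemma isWeakGradient_of_tendsto {ϖ : E N → ℝ} (hϖ : Continuous ϖ) (hϖ0 : ∀ x, 0 < ϖ x)
    {u : E N → ℝ} {g : E N → E N} (hu : AEStronglyMeasurable u volume)
    (hg : AEStronglyMeasurable g volume) {φ : ℕ → E N → ℝ} {ψ : ℕ → E N → E N}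
    (hφ : ∀ n, IsWeakGradient (φ n) (ψ n))
    (h : Tendsto (fun n => eLpNorm (fun x => φ n x - u x) 2 (wm ϖ)) atTop (𝓝 0))
    (h' : Tendsto (fun n => eLpNorm (fun x => ψ n x - g x) 2 volume) atTop (𝓝 0)) :
    IsWeakGradient u g := by
  rw [← wm_one] at h'
  have hlu : LocallyIntegrable u volume := by
    obtain ⟨n, hn⟩ := (h.eventually_lt_const ENNReal.zero_lt_top).exists
    exact locallyIntegrable_of_eLpNorm_wm_sub_lt hϖ hϖ0 (hφ n).1 hu hn
  have hlg : LocallyIntegrable g volume := by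
    obtain ⟨n, hn⟩ := (h'.eventually_lt_const ENNReal.zero_lt_top).exists
    exact locallyIntegrable_of_eLpNorm_wm_sub_lt continuous_const (fun _ => one_pos) (hφ n).2.1 hg hn
  refine ⟨hlu, hlg, fun η hη v => ?_⟩
  have hd := hη.fderiv_apply v
  have t1 := tendsto_integral_mul_of_eLpNorm_wm hϖ hϖ0 (fun n => (hφ n).1) hlu h
    hd.continuous hd.2
  have hloc : ∀ f : E N → E N, LocallyIntegrable f volume →
      LocallyIntegrable (fun x => inner ℝ (f x) v) volume := by
    intro f hf x
    obtain ⟨s, hs, h⟩ := hf x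
    exact ⟨s, hs, h.inner_const v⟩
  have t2 := tendsto_integral_mul_of_eLpNorm_wm (ϖ := fun _ => 1) continuous_const (fun _ => one_pos)
    (φ := fun n x => inner ℝ (ψ n x) v) (fun n => hloc _ (hφ n).2.1) (hloc _ hlg) ?_
    hη.continuous hη.2
  · refine tendsto_nhds_unique t1 (t2.neg.congr fun n => ?_)
    rw [(hφ n).2.2 η hη v]
  · refine tendsto_of_tendsto_of_tendsto_of_le_of_le tendsto_const_nhds
      (by simpa only [mul_zero] using
        ENNReal.Tendsto.const_mul h' (.inr (ENNReal.ofReal_ne_top (r := ‖v‖))))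
      (fun _ => zero_le) fun n => ?_
    refine eLpNorm_le_mul_eLpNorm_of_ae_le_mul (.of_forall fun x => ?_) 2
    rw [← inner_sub_left, mul_comm]
    exact norm_inner_le_norm _ _

/-- Completeness of `L²`, for sequences of functions. -/
lemma exists_tendsto_eLpNorm {α F : Type*} [MeasurableSpace α] [NormedAddCommGroup F]
    [CompleteSpace F] {μ : Measure α} {f : ℕ → α → F} (hf : ∀ n, MemLp (f n) 2 μ)
    (hc : ∀ ε : ℝ≥0∞, 0 < ε → ∃ M, ∀ m ≥ M, ∀ n ≥ M,
      eLpNorm (fun x => f m x - f n x) 2 μ < ε) :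
    ∃ u, MemLp u 2 μ ∧ Tendsto (fun n => eLpNorm (fun x => f n x - u x) 2 μ) atTop (𝓝 0) := by
  have hcs : CauchySeq fun n => (hf n).toLp (f n) := by
    rw [EMetric.cauchySeq_iff]
    intro ε hε
    obtain ⟨M, hM⟩ := hc ε hε
    refine ⟨M, fun m hm n hn => ?_⟩
    rw [Lp.edist_toLp_toLp]
    exact hM m hm n hn
  obtain ⟨u, hu⟩ := cauchySeq_tendsto_of_complete hcs
  refine ⟨u, Lp.memLp u, ?_⟩
  rw [Lp.tendsto_Lp_iff_tendsto_eLpNorm'] at hu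
  refine hu.congr fun n => eLpNorm_congr_ae ?_
  filter_upwards [(hf n).coeFn_toLp] with x hx
  simp [hx]

lemma tendsto_eLpNorm_of_tendsto_sub {α F : Type*} [MeasurableSpace α] [NormedAddCommGroup F]
    {μ : Measure α} {f : ℕ → α → F} {u : α → F} (hf : ∀ n, AEStronglyMeasurable (f n) μ)
    (hu : AEStronglyMeasurable u μ)
    (h : Tendsto (fun n => eLpNorm (fun x => f n x - u x) 2 μ) atTop (𝓝 0)) :
    Tendsto (fun n => eLpNorm (f n) 2 μ) atTop (𝓝 (eLpNorm u 2 μ)) := by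
  have l1 : Tendsto (fun n => eLpNorm u 2 μ - eLpNorm (fun x => f n x - u x) 2 μ) atTop
      (𝓝 (eLpNorm u 2 μ)) := by
    simpa using ENNReal.Tendsto.sub tendsto_const_nhds h (.inr ENNReal.zero_ne_top)
  have l2 : Tendsto (fun n => eLpNorm u 2 μ + eLpNorm (fun x => f n x - u x) 2 μ) atTop
      (𝓝 (eLpNorm u 2 μ)) := by
    simpa using tendsto_const_nhds.add h
  refine tendsto_of_tendsto_of_tendsto_of_le_of_le l1 l2 (fun n => ?_) fun n => ?_
  · rw [tsub_le_iff_right]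
    have := eLpNorm_sub_le (hf n) ((hf n).sub hu) (by norm_num : (1 : ℝ≥0∞) ≤ 2)
    simpa [Pi.sub_def] using this
  · have := eLpNorm_add_le hu ((hf n).sub hu) (by norm_num : (1 : ℝ≥0∞) ≤ 2)
    simpa [Pi.sub_def, Pi.add_def] using this


/-! ### Barriers and Hardy's inequality -/

/-- `w` is a smooth positive strict supersolution of `-κ Δ + d V`, with the margin `2 q`. It serves
both as an upper barrier and as a ground state in Hardy's inequality. One half of the margin makes
the form `∫ κ |∇φ|² + (d V - q) φ²` coercive, and the other half is left to absorb a right-hand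
side. -/
structure IsBarrier (V : E N → ℝ) (d κ : ℝ) (q w : E N → ℝ) : Prop where
  V_cont : Continuous V
  V_nonneg : ∀ x, 0 ≤ V x
  V_pos : ∃ x, 0 < V x
  d_pos : 0 < d
  d_le : d ≤ 1
  κ_pos : 0 < κ
  q_cont : Continuous q
  q_pos : ∀ x, 0 < q x
  smooth : ContDiff ℝ ∞ w
  pos : ∀ x, 0 < w x
  super : ∀ x, 2 * q x * w x ≤ d * V x * w x - κ * lap w x

namespace IsTest

variable {φ ψ f : E N → ℝ}

lemma integrable_mul_sq (h : IsTest φ) (hf : Continuous f) :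
    Integrable (fun x => f x * φ x ^ 2) volume :=
  (hf.mul (h.continuous.pow 2)).integrable_of_hasCompactSupport
    (h.2.mono fun x hx h0 => hx (by simp [h0]))

lemma integrable_norm_gradient_sq (h : IsTest φ) :
    Integrable (fun x => ‖gradient φ x‖ ^ 2) volume :=
  (h.continuous_gradient.norm.pow 2).integrable_of_hasCompactSupport
    (h.hasCompactSupport_gradient.mono fun x hx h0 => hx (by simp [norm_eq_zero.2 h0]))

lemma energy_eq_ofReal (h : IsTest φ) {V : E N → ℝ} (hV : Continuous V) (hV0 : ∀ x, 0 ≤ V x)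
    (ε : ℝ) :
    energy ε V φ (gradient φ) = ENNReal.ofReal (∫ x, (ε ^ 2 * ‖gradient φ x‖ ^ 2 + V x * φ x ^ 2)) := by
  rw [ofReal_integral_eq_lintegral_ofReal]
  · rfl
  · exact (h.integrable_norm_gradient_sq.const_mul _).fun_add (h.integrable_mul_sq hV)
  · exact .of_forall fun x => add_nonneg (by positivity) (mul_nonneg (hV0 x) (sq_nonneg _))

lemma eLpNorm_wm_sq_eq_ofReal (h : IsTest φ) {q : E N → ℝ} (hq : Continuous q)
    (hq0 : ∀ x, 0 ≤ q x) : eLpNorm φ 2 (wm q) ^ 2 = ENNReal.ofReal (∫ x, q x * φ x ^ 2) := by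
  rw [ofReal_integral_eq_lintegral_ofReal (h.integrable_mul_sq hq)
    (.of_forall fun x => mul_nonneg (hq0 x) (sq_nonneg _)), eLpNorm_wm_sq hq.measurable]
  refine lintegral_congr fun x => ?_
  rw [enorm_sq_eq_ofReal, ENNReal.ofReal_mul (hq0 x), Real.norm_eq_abs, sq_abs]

end IsTest

namespace IsBarrier

variable {V q w : E N → ℝ} {d κ : ℝ}

/-- The transformed field `∇u - u ∇w / w = w ∇(u / w)` has the energy of the Dirichlet form with
potential `Δw / w`. -/
lemma integral_norm_sq (C : IsBarrier V d κ q w) {φ : E N → ℝ} (hφ : IsTest φ) :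
    ∫ x, ‖gradient φ x - φ x • logGrad w x‖ ^ 2
      = ∫ x, (‖gradient φ x‖ ^ 2 + lap w x / w x * φ x ^ 2) := by
  have := (isWeakGradient_of_contDiff hφ.1).ground_state C.smooth C.pos hφ
  simp only [real_inner_self_eq_norm_sq, mul_assoc, ← pow_two] at this
  exact this

/-- Hardy's inequality for test functions. -/
lemma hardy_test (C : IsBarrier V d κ q w) {φ : E N → ℝ} (hφ : IsTest φ) :
    2 * ∫ x, q x * φ x ^ 2 ≤ ∫ x, (κ * ‖gradient φ x‖ ^ 2 + d * V x * φ x ^ 2) := by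
  have h0 : 0 ≤ ∫ x, (‖gradient φ x‖ ^ 2 + lap w x / w x * φ x ^ 2) := by
    rw [← C.integral_norm_sq hφ]
    exact integral_nonneg fun x => by positivity
  have hlw : Continuous fun x => lap w x / w x :=
    (continuous_lap C.smooth).div C.smooth.continuous fun x => (C.pos x).ne'
  have i0 := hφ.integrable_norm_gradient_sq.fun_add (hφ.integrable_mul_sq hlw)
  rw [← integral_const_mul]
  calc ∫ x, 2 * (q x * φ x ^ 2)
      ≤ ∫ x, (2 * (q x * φ x ^ 2)
          + κ * (‖gradient φ x‖ ^ 2 + lap w x / w x * φ x ^ 2)) := by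
        rw [integral_add ((hφ.integrable_mul_sq C.q_cont).const_mul _) (i0.const_mul _),
          integral_const_mul κ]
        nlinarith [C.κ_pos]
    _ ≤ ∫ x, (κ * ‖gradient φ x‖ ^ 2 + d * V x * φ x ^ 2) := by
        refine integral_mono (((hφ.integrable_mul_sq C.q_cont).const_mul _).add (i0.const_mul _))
          ((hφ.integrable_norm_gradient_sq.const_mul _).add
            (hφ.integrable_mul_sq (continuous_const.mul C.V_cont))) fun x => ?_
        have h1 : 2 * q x + κ * (lap w x / w x) ≤ d * V x := by
          have := C.super x
          have hw := C.pos x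
          rw [← sub_nonneg]
          have e : d * V x - (2 * q x + κ * (lap w x / w x))
              = (d * V x * w x - κ * lap w x - 2 * q x * w x) / w x := by
            field_simp
            ring
          rw [e]
          exact div_nonneg (by linarith) hw.le
        nlinarith [mul_le_mul_of_nonneg_right h1 (sq_nonneg (φ x))]

lemma two_mul_eLpNorm_le_energy_test (C : IsBarrier V d κ q w) {φ : E N → ℝ} (hφ : IsTest φ) :
    2 * eLpNorm φ 2 (wm q) ^ 2 ≤ energy (√κ) V φ (gradient φ) := by
  have e2 : ∀ a : ℝ, 2 * ENNReal.ofReal a = ENNReal.ofReal (2 * a) := fun a => by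
    rw [ENNReal.ofReal_mul (by norm_num)]; simp
  rw [hφ.energy_eq_ofReal C.V_cont C.V_nonneg,
    hφ.eLpNorm_wm_sq_eq_ofReal C.q_cont fun x => (C.q_pos x).le, Real.sq_sqrt C.κ_pos.le, e2]
  refine ENNReal.ofReal_le_ofReal ((C.hardy_test hφ).trans ?_)
  refine integral_mono ((hφ.integrable_norm_gradient_sq.const_mul _).fun_add
      (hφ.integrable_mul_sq (continuous_const.mul C.V_cont)))
    ((hφ.integrable_norm_gradient_sq.const_mul _).fun_add (hφ.integrable_mul_sq C.V_cont))
    fun x => ?_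
  have := mul_le_mul_of_nonneg_right C.d_le (mul_nonneg (C.V_nonneg x) (sq_nonneg (φ x)))
  simp only
  nlinarith

end IsBarrier

lemma tendsto_pow_two_zero_iff {ι : Type*} {l : Filter ι} {f : ι → ℝ≥0∞} :
    Tendsto (fun n => f n ^ 2) l (𝓝 0) ↔ Tendsto f l (𝓝 0) := by
  constructor
  · intro h
    have := (ENNReal.continuous_rpow_const (y := (1 / 2 : ℝ))).tendsto 0 |>.comp h
    simp only [Function.comp_def, ← ENNReal.rpow_natCast, ← ENNReal.rpow_mul] at this
    simpa using this
  · intro h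
    simpa using ENNReal.Tendsto.pow (n := 2) h

lemma tendsto_energy_zero_iff {ι : Type*} {l : Filter ι} {ε : ℝ} (hε : 0 < ε) {V : E N → ℝ}
    (hV : Continuous V) (hV0 : ∀ x, 0 ≤ V x) {u : ι → E N → ℝ} {g : ι → E N → E N}
    (hu : ∀ n, AEStronglyMeasurable (u n) volume) :
    Tendsto (fun n => energy ε V (u n) (g n)) l (𝓝 0) ↔
      Tendsto (fun n => eLpNorm (g n) 2 volume) l (𝓝 0) ∧
        Tendsto (fun n => eLpNorm (u n) 2 (wm V)) l (𝓝 0) := by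
  have hc : ENNReal.ofReal (ε ^ 2) ≠ 0 := by simp [hε.ne']
  simp only [energy_eq hV hV0 (hu _)]
  rw [← tendsto_pow_two_zero_iff (f := fun n => eLpNorm (g n) 2 volume),
    ← tendsto_pow_two_zero_iff (f := fun n => eLpNorm (u n) 2 (wm V))]
  constructor
  · intro h
    constructor
    · have := ENNReal.Tendsto.const_mul (a := (ENNReal.ofReal (ε ^ 2))⁻¹)
        (tendsto_of_tendsto_of_tendsto_of_le_of_le tendsto_const_nhds h (fun _ => zero_le)
          fun n => le_self_add) (.inr (by simp [hε.ne']))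
      simpa [← mul_assoc, ENNReal.inv_mul_cancel hc] using this
    · exact tendsto_of_tendsto_of_tendsto_of_le_of_le tendsto_const_nhds h (fun _ => zero_le)
          fun n => le_add_self
  · rintro ⟨h1, h2⟩
    simpa using (ENNReal.Tendsto.const_mul (a := ENNReal.ofReal (ε ^ 2)) h1
      (.inr ENNReal.ofReal_ne_top)).add h2

namespace IsBarrier

variable {V q w : E N → ℝ} {d κ : ℝ}

lemma eLpNorm_wm_le (C : IsBarrier V d κ q w) {φ : E N → ℝ} (hφ : IsTest φ) :
    eLpNorm φ 2 (wm q) ≤ ENNReal.ofReal (√κ) * eLpNorm (gradient φ) 2 volume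
      + eLpNorm φ 2 (wm V) := by
  have h := C.two_mul_eLpNorm_le_energy_test hφ
  rw [energy_eq C.V_cont C.V_nonneg hφ.continuous.aestronglyMeasurable,
    ENNReal.ofReal_pow (Real.sqrt_nonneg _), ← mul_pow] at h
  refine le_of_not_gt fun hlt => ?_
  have h2 : (ENNReal.ofReal (√κ) * eLpNorm (gradient φ) 2 volume) ^ 2 + eLpNorm φ 2 (wm V) ^ 2
      ≤ (ENNReal.ofReal (√κ) * eLpNorm (gradient φ) 2 volume + eLpNorm φ 2 (wm V)) ^ 2 := by
    rw [add_sq']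
    exact le_self_add
  have h3 := ENNReal.pow_lt_pow_left two_ne_zero hlt
  have h4 : eLpNorm φ 2 (wm q) ^ 2 ≤ 2 * eLpNorm φ 2 (wm q) ^ 2 :=
    le_mul_of_one_le_left zero_le (by norm_num)
  exact absurd (h4.trans (h.trans h2)) (not_le.2 h3)

/-- Approximation in the norm of `H¹_V` implies approximation in `L²(q dx)`. By Hardy's inequality
for test functions the approximating sequence is a Cauchy sequence in `L²(q dx)`; the point is that
its limit is `u`, also where `V` vanishes. -/
lemma tendsto_wm (C : IsBarrier V d κ q w) {u : E N → ℝ} {g : E N → E N}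
    (hu : IsWeakGradient u g) {φ : ℕ → E N → ℝ} (hφ : ∀ n, IsTest (φ n))
    (h : Tendsto (fun n => energy 1 V (fun x => φ n x - u x) (fun x => gradient (φ n) x - g x))
      atTop (𝓝 0)) :
    Tendsto (fun n => eLpNorm (fun x => φ n x - u x) 2 (wm q)) atTop (𝓝 0) := by
  have hum := hu.1.aestronglyMeasurable
  have hgm := hu.2.1.aestronglyMeasurable
  have hφm : ∀ n, AEStronglyMeasurable (φ n) volume := fun n =>
    (hφ n).continuous.aestronglyMeasurable
  have hac : ∀ ϖ : E N → ℝ, wm ϖ ≪ volume := fun _ => withDensity_absolutelyContinuous _ _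
  obtain ⟨hA, hB⟩ := (tendsto_energy_zero_iff (u := fun n x => φ n x - u x) one_pos C.V_cont
    C.V_nonneg fun n => (hφm n).sub hum).1 h
  set δ : ℕ → ℝ≥0∞ := fun n => ENNReal.ofReal (√κ) * eLpNorm (fun x => gradient (φ n) x - g x) 2
    volume + eLpNorm (fun x => φ n x - u x) 2 (wm V) with hδdef
  have hδ : Tendsto δ atTop (𝓝 0) := by
    simpa only [mul_zero, add_zero] using (ENNReal.Tendsto.const_mul (a := ENNReal.ofReal (√κ)) hA
      (.inr ENNReal.ofReal_ne_top)).add hB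
  have hle : ∀ m n, eLpNorm (fun x => φ m x - φ n x) 2 (wm q) ≤ δ m + δ n := by
    intro m n
    refine (C.eLpNorm_wm_le ((hφ m).sub (hφ n))).trans ?_
    have e1 : eLpNorm (gradient fun x => φ m x - φ n x) 2 volume
        ≤ eLpNorm (fun x => gradient (φ m) x - g x) 2 volume
          + eLpNorm (fun x => gradient (φ n) x - g x) 2 volume := by
      have := eLpNorm_sub_le (((hφ m).continuous_gradient.aestronglyMeasurable).sub hgm)
        (((hφ n).continuous_gradient.aestronglyMeasurable).sub hgm)
        (by norm_num : (1 : ℝ≥0∞) ≤ 2) (μ := volume)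
      refine le_trans (le_of_eq (congrArg (eLpNorm · 2 volume) ?_)) this
      ext1 x
      rw [gradient_fun_sub ((hφ m).differentiable x) ((hφ n).differentiable x)]
      simp
    have e2 : eLpNorm (fun x => φ m x - φ n x) 2 (wm V)
        ≤ eLpNorm (fun x => φ m x - u x) 2 (wm V) + eLpNorm (fun x => φ n x - u x) 2 (wm V) := by
      have := eLpNorm_sub_le (((hφm m).sub hum).mono_ac (hac V))
        (((hφm n).sub hum).mono_ac (hac V)) (by norm_num : (1 : ℝ≥0∞) ≤ 2)
      refine le_trans (le_of_eq (congrArg (eLpNorm · 2 (wm V)) ?_)) this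
      ext1 x
      simp
    calc _ ≤ ENNReal.ofReal (√κ) * (eLpNorm (fun x => gradient (φ m) x - g x) 2 volume
          + eLpNorm (fun x => gradient (φ n) x - g x) 2 volume) +
          (eLpNorm (fun x => φ m x - u x) 2 (wm V) + eLpNorm (fun x => φ n x - u x) 2 (wm V)) := by
          gcongr
      _ = δ m + δ n := by rw [hδdef]; ring
  have hmem : ∀ n, MemLp (φ n) 2 (wm q) := by
    intro n
    refine ⟨(hφm n).mono_ac (hac q), ?_⟩
    have := (hφ n).eLpNorm_wm_sq_eq_ofReal C.q_cont fun x => (C.q_pos x).le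
    by_contra hcon
    rw [not_lt, top_le_iff] at hcon
    simp [hcon] at this
  obtain ⟨u', hu', hlim⟩ := exists_tendsto_eLpNorm hmem (by
    intro ε hε
    have := hδ.eventually_lt_const (ENNReal.half_pos hε.ne')
    obtain ⟨M, hM⟩ := eventually_atTop.1 this
    refine ⟨M, fun m hm n hn => (hle m n).trans_lt ?_⟩
    calc δ m + δ n < ε / 2 + ε / 2 := ENNReal.add_lt_add (hM m hm) (hM n hn)
      _ = ε := ENNReal.add_halves ε)
  have hu'm : AEStronglyMeasurable u' volume := hu'.1.mono_ac
    (withDensity_absolutelyContinuous' (C.q_cont.measurable.ennreal_ofReal.aemeasurable)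
      (.of_forall fun x => by simp [C.q_pos x]))
  have hwg : IsWeakGradient u' g := isWeakGradient_of_tendsto C.q_cont C.q_pos hu'm hgm
    (fun n => isWeakGradient_of_contDiff (hφ n).1) hlim hA
  -- The two limits have the same gradient, and they agree where `V` is positive.
  have hsub := hu.sub hwg
  simp only [sub_self] at hsub
  obtain ⟨c, hc⟩ := IsWeakGradient.ae_const hsub
  set ϖ : E N → ℝ := fun x => min (V x) (q x) with hϖdef
  have hzero : eLpNorm (fun x => u x - u' x) 2 (wm ϖ) = 0 := by
    have hm1 : wm ϖ ≤ wm V := withDensity_mono (.of_forall fun x =>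
      ENNReal.ofReal_le_ofReal (min_le_left _ _))
    have hm2 : wm ϖ ≤ wm q := withDensity_mono (.of_forall fun x =>
      ENNReal.ofReal_le_ofReal (min_le_right _ _))
    have hb : ∀ n, eLpNorm (fun x => u x - u' x) 2 (wm ϖ)
        ≤ eLpNorm (fun x => φ n x - u' x) 2 (wm q) + eLpNorm (fun x => φ n x - u x) 2 (wm V) := by
      intro n
      have := eLpNorm_sub_le (((hφm n).sub hu'm).mono_ac (hac ϖ))
        (((hφm n).sub hum).mono_ac (hac ϖ)) (by norm_num : (1 : ℝ≥0∞) ≤ 2)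
      refine le_trans (le_of_eq (congrArg (eLpNorm · 2 (wm ϖ)) ?_)) (this.trans ?_)
      · ext1 x; simp
      · exact add_le_add (eLpNorm_mono_measure _ hm2) (eLpNorm_mono_measure _ hm1)
    have ht := hlim.add hB
    rw [add_zero] at ht
    exact le_antisymm (ge_of_tendsto' ht hb) zero_le
  have hc0 : c = 0 := by
    by_contra hc0
    have h1 : eLpNorm (fun _ : E N => c) 2 (wm ϖ) = 0 := by
      rw [← hzero]
      refine eLpNorm_congr_ae ?_
      filter_upwards [ae_wm_of_ae hc] with x hx
      rw [hx]
    rw [eLpNorm_eq_zero_iff aestronglyMeasurable_const (by norm_num)] at h1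
    have hϖc : Continuous ϖ := C.V_cont.min C.q_cont
    have h2 : ∀ᵐ x, ¬ (0 < ϖ x) := by
      have h1' := (ae_withDensity_iff hϖc.measurable.ennreal_ofReal).1 h1
      filter_upwards [h1'] with x hx hpos
      exact hc0 (hx (by simp [hpos]))
    obtain ⟨x₀, hx₀⟩ := C.V_pos
    have hopen : IsOpen {x | 0 < ϖ x} := isOpen_lt continuous_const hϖc
    have := hopen.measure_pos volume ⟨x₀, lt_min hx₀ (C.q_pos x₀)⟩
    rw [ae_iff] at h2
    simp only [not_not] at h2
    exact this.ne' h2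
  have hae : u =ᵐ[wm q] u' := ae_wm_of_ae (hc.mono fun x hx => by
    rw [hc0] at hx; exact sub_eq_zero.1 hx)
  refine hlim.congr fun n => eLpNorm_congr_ae ?_
  filter_upwards [hae] with x hx
  rw [hx]

/-- Hardy's inequality in `H¹_V`. -/
lemma hardy (C : IsBarrier V d κ q w) {u : E N → ℝ} {g : E N → E N} (h : MemH1V V u g) :
    2 * eLpNorm u 2 (wm q) ^ 2 ≤ energy (√κ) V u g := by
  obtain ⟨hu, φ, hφ, hE⟩ := h
  have hum := hu.1.aestronglyMeasurable
  have hgm := hu.2.1.aestronglyMeasurable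
  have hφm : ∀ n, AEStronglyMeasurable (φ n) volume := fun n =>
    (hφ n).continuous.aestronglyMeasurable
  have hac : ∀ ϖ : E N → ℝ, wm ϖ ≪ volume := fun _ => withDensity_absolutelyContinuous _ _
  have hq := C.tendsto_wm hu hφ hE
  obtain ⟨hA, hB⟩ := (tendsto_energy_zero_iff (u := fun n x => φ n x - u x) one_pos C.V_cont
    C.V_nonneg fun n => (hφm n).sub hum).1 hE
  have t1 := tendsto_eLpNorm_of_tendsto_sub (fun n => (hφm n).mono_ac (hac q))
    (hum.mono_ac (hac q)) hq
  have t2 := tendsto_eLpNorm_of_tendsto_sub (fun n => (hφm n).mono_ac (hac V))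
    (hum.mono_ac (hac V)) hB
  have t3 := tendsto_eLpNorm_of_tendsto_sub
    (fun n => (hφ n).continuous_gradient.aestronglyMeasurable) hgm hA
  rw [energy_eq C.V_cont C.V_nonneg hum]
  refine le_of_tendsto_of_tendsto' (ENNReal.Tendsto.const_mul (ENNReal.Tendsto.pow t1)
    (.inr (by norm_num))) ((ENNReal.Tendsto.const_mul (ENNReal.Tendsto.pow t3)
    (.inr (by simp))).add (ENNReal.Tendsto.pow t2)) fun n => ?_
  have := C.two_mul_eLpNorm_le_energy_test (hφ n)
  rwa [energy_eq C.V_cont C.V_nonneg (hφm n)] at this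

end IsBarrier


/-! ### A smooth truncation -/

/-- A smooth nondecreasing contraction of the line, equal to the identity on `(-∞, 1]` and strictly
below the identity, but not below `1`, on `(1, ∞)`. -/
noncomputable def softMin (s : ℝ) : ℝ := s - (s - 1) * expNegInvGlue (s - 1)

lemma contDiff_softMin : ContDiff ℝ ∞ softMin :=
  contDiff_id.sub ((contDiff_id.sub contDiff_const).mul
    (expNegInvGlue.contDiff.comp (contDiff_id.sub contDiff_const)))

lemma softMin_of_le {s : ℝ} (hs : s ≤ 1) : softMin s = s := by
  simp [softMin, expNegInvGlue.zero_of_nonpos (sub_nonpos.2 hs)]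

lemma softMin_lt {s : ℝ} (hs : 1 < s) : softMin s < s :=
  sub_lt_self _ (mul_pos (sub_pos.2 hs) (expNegInvGlue.pos_of_pos (sub_pos.2 hs)))

lemma softMin_le (s : ℝ) : softMin s ≤ s := by
  rcases le_or_gt s 1 with h | h
  exacts [(softMin_of_le h).le, (softMin_lt h).le]

lemma expNegInvGlue_le_one (t : ℝ) : expNegInvGlue t ≤ 1 := by
  unfold expNegInvGlue
  split_ifs with h
  · exact zero_le_one
  · exact Real.exp_le_one_iff.2 (neg_nonpos.2 (inv_nonneg.2 (not_le.1 h).le))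

lemma one_le_softMin {s : ℝ} (hs : 1 ≤ s) : 1 ≤ softMin s := by
  have := mul_le_mul_of_nonneg_left (expNegInvGlue_le_one (s - 1)) (sub_nonneg.2 hs)
  unfold softMin
  linarith

lemma abs_softMin_le (s : ℝ) : |softMin s| ≤ |s| := by
  rcases le_or_gt s 1 with h | h
  · rw [softMin_of_le h]
  · rw [abs_of_nonneg (zero_le_one.trans (one_le_softMin h.le)), abs_of_pos (by linarith)]
    exact softMin_le s

lemma abs_deriv_softMin_le (s : ℝ) : |deriv softMin s| ≤ 1 := by
  have key : ∀ s ≠ 1, |deriv softMin s| ≤ 1 := by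
    intro s hs
    rcases lt_or_gt_of_ne hs with h | h
    · have : softMin =ᶠ[𝓝 s] id := by
        filter_upwards [Iio_mem_nhds h] with t ht
        exact softMin_of_le (le_of_lt ht)
      rw [this.deriv_eq]; simp
    · have hr : 0 < s - 1 := sub_pos.2 h
      have he : softMin =ᶠ[𝓝 s] fun t => t - (t - 1) * Real.exp (-(t - 1)⁻¹) := by
        filter_upwards [Ioi_mem_nhds h] with t ht
        have ht' : ¬ (t - 1 ≤ 0) := by simpa using ht
        simp [softMin, expNegInvGlue, ht']
      have h1 : HasDerivAt (fun t : ℝ => t - 1) 1 s := (hasDerivAt_id s).sub_const 1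
      have h2 := (h1.fun_inv hr.ne').fun_neg.exp
      have h3 := (hasDerivAt_id s).fun_sub (h1.fun_mul h2)
      rw [he.deriv_eq]
      have h4 := h3.deriv
      simp only [id] at h4
      rw [h4]
      set r := s - 1 with hrdef
      have e : 1 - (1 * Real.exp (-r⁻¹) + r * (Real.exp (-r⁻¹) * -(-1 / r ^ 2)))
          = 1 - (1 + r⁻¹) * Real.exp (-r⁻¹) := by
        field_simp
      rw [e]
      have hpos : 0 < r⁻¹ := inv_pos.2 hr
      have hb : (1 + r⁻¹) * Real.exp (-r⁻¹) ≤ 1 := by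
        rw [Real.exp_neg, ← div_eq_mul_inv, div_le_one (Real.exp_pos _), add_comm]
        exact Real.add_one_le_exp _
      have hb' : 0 ≤ (1 + r⁻¹) * Real.exp (-r⁻¹) := by positivity
      rw [abs_le]
      constructor <;> linarith
  rcases eq_or_ne s 1 with rfl | h
  · have hc : Continuous fun t => |deriv softMin t| :=
      (contDiff_softMin.continuous_deriv (by simp)).abs
    refine le_of_tendsto (hc.continuousAt.tendsto.mono_left nhdsWithin_le_nhds :
      Tendsto _ (𝓝[≠] (1 : ℝ)) _) ?_
    filter_upwards [self_mem_nhdsWithin] with t ht using key t ht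
  · exact key s h

lemma abs_softMin_sub_le (s t : ℝ) : |softMin s - softMin t| ≤ |s - t| := by
  have := lipschitzWith_of_nnnorm_deriv_le (C := 1)
    (contDiff_softMin.differentiable (by simp)) (fun x => by
      rw [← NNReal.coe_le_coe]; simpa using abs_deriv_softMin_le x)
  simpa [Real.dist_eq] using this.dist_le_mul s t

/-! ### The isometric lift of the quadratic form -/

/-- The value space `ℝ^N × ℝ`, with its Hilbert structure. -/
abbrev GradVal (N : ℕ) : Type := WithLp 2 (E N × ℝ)

/-- The Hilbert space `L²(ℝ^N; ℝ^N × ℝ)`. -/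
abbrev LiftSpace (N : ℕ) : Type := Lp (GradVal N) 2 (volume : Measure (E N))

/-- The zeroth order coefficient of the quadratic form in the variable `u / w`. -/
noncomputable def massCoeff (V : E N → ℝ) (d κ : ℝ) (q w : E N → ℝ) (x : E N) : ℝ :=
  (d * V x - q x) / κ - lap w x / w x

/-- The isometric lift `φ ↦ (w ∇(φ / w), √m φ)` of the quadratic form
`∫ |∇φ|² + (d V - q) / κ φ²` into `L²`, where `m` is `massCoeff`. The field `w ∇(φ / w)` is written
as `∇φ - φ ∇w / w`. -/
noncomputable def lift (V : E N → ℝ) (d κ : ℝ) (q w φ : E N → ℝ) (x : E N) : GradVal N :=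
  WithLp.toLp 2 (gradient φ x - φ x • logGrad w x, √(massCoeff V d κ q w x) * φ x)

/-- `f` is almost everywhere the lift of a test function. -/
def IsLift (V : E N → ℝ) (d κ : ℝ) (q w : E N → ℝ) (f : LiftSpace N) : Prop :=
  ∃ φ, IsTest φ ∧ f =ᵐ[volume] lift V d κ q w φ

lemma norm_gradVal_sq (a : GradVal N) : ‖a‖ ^ 2 = ‖a.fst‖ ^ 2 + a.snd ^ 2 := by
  rw [WithLp.prod_norm_sq_eq_of_L2, Real.norm_eq_abs a.snd, sq_abs]

lemma norm_fst_le (a : GradVal N) : ‖a.fst‖ ≤ ‖a‖ :=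
  (abs_le_of_sq_le_sq' (by rw [norm_gradVal_sq]; nlinarith [sq_nonneg a.snd]) (norm_nonneg _)).2

lemma abs_snd_le (a : GradVal N) : |a.snd| ≤ ‖a‖ :=
  abs_le_of_sq_le_sq (by rw [norm_gradVal_sq]; nlinarith [sq_nonneg ‖a.fst‖]) (norm_nonneg _)

lemma exists_seq_tendsto_ae_of_tendsto {α F : Type*} [MeasurableSpace α] [NormedAddCommGroup F]
    {μ : Measure α} {f : ℕ → Lp F 2 μ} {g : Lp F 2 μ} (h : Tendsto f atTop (𝓝 g)) :
    ∃ ns : ℕ → ℕ, StrictMono ns ∧ ∀ᵐ x ∂μ, Tendsto (fun i => f (ns i) x) atTop (𝓝 (g x)) :=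
  (tendstoInMeasure_of_tendsto_Lp h).exists_seq_tendsto_ae

lemma isClosed_le_snd (c : E N → ℝ) :
    IsClosed {f : LiftSpace N | ∀ᵐ x, c x ≤ (f x).snd} := by
  refine IsSeqClosed.isClosed fun f g hf hg => ?_
  obtain ⟨ns, -, hns⟩ := exists_seq_tendsto_ae_of_tendsto hg
  filter_upwards [hns, ae_all_iff.2 hf] with x hx hfx
  exact ge_of_tendsto' (((WithLp.sndL 2 ℝ (E N) ℝ).continuous.tendsto _).comp hx) fun i => hfx (ns i)

namespace IsBarrier

variable {V q w : E N → ℝ} {d κ : ℝ}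

lemma continuous_massCoeff (C : IsBarrier V d κ q w) : Continuous (massCoeff V d κ q w) :=
  (((continuous_const.mul C.V_cont).sub C.q_cont).div_const κ).sub
    ((continuous_lap C.smooth).div C.smooth.continuous fun x => (C.pos x).ne')

lemma massCoeff_pos (C : IsBarrier V d κ q w) (x : E N) : 0 < massCoeff V d κ q w x := by
  have h := C.super x
  have hw := C.pos x
  have hκ := C.κ_pos
  have e : massCoeff V d κ q w x
      = (q x * w x + (d * V x * w x - κ * lap w x - 2 * q x * w x)) / (κ * w x) := by
    unfold massCoeff
    field_simp
    ring
  rw [e]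
  exact div_pos (add_pos_of_pos_of_nonneg (mul_pos (C.q_pos x) hw) (by linarith)) (mul_pos hκ hw)

lemma continuous_lift (C : IsBarrier V d κ q w) {φ : E N → ℝ} (hφ : IsTest φ) :
    Continuous (lift V d κ q w φ) :=
  (WithLp.prod_continuous_toLp 2 (E N) ℝ).comp
    ((hφ.continuous_gradient.sub (hφ.continuous.smul (continuous_logGrad C.smooth C.pos))).prodMk
      (C.continuous_massCoeff.sqrt.mul hφ.continuous))

lemma memLp_lift (C : IsBarrier V d κ q w) {φ : E N → ℝ} (hφ : IsTest φ) :
    MemLp (lift V d κ q w φ) 2 volume := by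
  refine (C.continuous_lift hφ).memLp_of_hasCompactSupport ?_
  refine HasCompactSupport.intro (hφ.2.isCompact.union hφ.hasCompactSupport_gradient.isCompact)
    fun x hx => ?_
  rw [mem_union, not_or] at hx
  simp [lift, image_eq_zero_of_notMem_tsupport hx.1, image_eq_zero_of_notMem_tsupport hx.2]

/-- The lift of a test function, as an element of `L²`. -/
noncomputable def liftLp (C : IsBarrier V d κ q w) {φ : E N → ℝ} (hφ : IsTest φ) : LiftSpace N :=
  (C.memLp_lift hφ).toLp _

lemma coeFn_liftLp (C : IsBarrier V d κ q w) {φ : E N → ℝ} (hφ : IsTest φ) :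
    C.liftLp hφ =ᵐ[volume] lift V d κ q w φ := (C.memLp_lift hφ).coeFn_toLp

lemma lift_add {φ ψ : E N → ℝ} (hφ : IsTest φ) (hψ : IsTest ψ) (x : E N) :
    lift V d κ q w (fun y => φ y + ψ y) x = lift V d κ q w φ x + lift V d κ q w ψ x := by
  rw [lift, gradient_fun_add (hφ.differentiable x) (hψ.differentiable x)]
  refine (congrArg (WithLp.toLp 2) (Prod.ext ?_ ?_)).trans (WithLp.toLp_add 2 (_, _) (_, _))
  · simp only [Prod.mk_add_mk, add_smul]; abel
  · simp only [Prod.mk_add_mk]; ring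

lemma lift_const_mul {φ : E N → ℝ} (hφ : IsTest φ) (c : ℝ) (x : E N) :
    lift V d κ q w (fun y => c * φ y) x = c • lift V d κ q w φ x := by
  rw [lift, gradient_fun_const_mul (hφ.differentiable x)]
  refine (congrArg (WithLp.toLp 2) (Prod.ext ?_ ?_)).trans (WithLp.toLp_smul 2 c (_, _))
  · simp only [Prod.smul_mk, smul_sub, mul_smul]
  · simp only [Prod.smul_mk, smul_eq_mul]; ring

/-- The closure of the lifts of test functions. -/
noncomputable def liftClosure (_ : IsBarrier V d κ q w) : Submodule ℝ (LiftSpace N) :=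
  Submodule.topologicalClosure
    { carrier := {f | IsLift V d κ q w f}
      add_mem' := by
        rintro f g ⟨φ, hφ, hf⟩ ⟨ψ, hψ, hg⟩
        refine ⟨_, hφ.add hψ, ?_⟩
        filter_upwards [hf, hg, Lp.coeFn_add f g] with x h1 h2 h3
        rw [h3, Pi.add_apply, h1, h2, lift_add hφ hψ]
      zero_mem' := by
        refine ⟨fun _ => 0, ⟨contDiff_const, HasCompactSupport.zero⟩, ?_⟩
        filter_upwards [Lp.coeFn_zero (GradVal N) 2 (volume : Measure (E N))] with x hx
        rw [hx]
        simp only [lift, gradient_fun_const, zero_smul, sub_zero, mul_zero]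
        rfl
      smul_mem' := by
        rintro c f ⟨φ, hφ, hf⟩
        refine ⟨_, hφ.const_mul c, ?_⟩
        filter_upwards [hf, Lp.coeFn_smul c f] with x h1 h2
        rw [h2, Pi.smul_apply, h1, lift_const_mul hφ] }

lemma liftLp_mem (C : IsBarrier V d κ q w) {φ : E N → ℝ} (hφ : IsTest φ) :
    C.liftLp hφ ∈ C.liftClosure :=
  Submodule.le_topologicalClosure _ ⟨φ, hφ, C.coeFn_liftLp hφ⟩

/-- Elements of the closure are limits, in `L²` and almost everywhere, of lifts of test functions. -/
lemma exists_seq_of_mem_liftClosure (C : IsBarrier V d κ q w) {f : LiftSpace N}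
    (hf : f ∈ C.liftClosure) : ∃ φ : ℕ → E N → ℝ, ∃ hφ : ∀ n, IsTest (φ n),
      Tendsto (fun n => C.liftLp (hφ n)) atTop (𝓝 f) ∧
      ∀ᵐ x, Tendsto (fun n => lift V d κ q w (φ n) x) atTop (𝓝 (f x)) := by
  have hf' := mem_closure_iff_seq_limit.1 hf
  obtain ⟨s, hs, hlim⟩ := hf'
  choose φ hφ hsφ using hs
  have hs' : ∀ n, s n = C.liftLp (hφ n) := fun n =>
    Lp.ext ((hsφ n).trans (C.coeFn_liftLp (hφ n)).symm)
  obtain ⟨ns, hmono, hns⟩ := exists_seq_tendsto_ae_of_tendsto hlim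
  refine ⟨fun n => φ (ns n), fun n => hφ (ns n), ?_, ?_⟩
  · simpa [Function.comp_def, hs'] using hlim.comp hmono.tendsto_atTop
  · filter_upwards [hns, ae_all_iff.2 hsφ] with x hx hx'
    exact hx.congr fun i => hx' (ns i)

end IsBarrier


/-! ### From the closure of the lifts to `H¹_V` -/

namespace IsBarrier

variable {V q w : E N → ℝ} {d κ : ℝ}

lemma norm_lift_sq (C : IsBarrier V d κ q w) (φ : E N → ℝ) (x : E N) :
    ‖lift V d κ q w φ x‖ ^ 2
      = ‖gradient φ x - φ x • logGrad w x‖ ^ 2 + massCoeff V d κ q w x * φ x ^ 2 := by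
  rw [norm_gradVal_sq]
  change _ + (√(massCoeff V d κ q w x) * φ x) ^ 2 = _
  rw [mul_pow, Real.sq_sqrt (C.massCoeff_pos x).le]
  rfl

/-- The lift is isometric for the quadratic form of the equation divided by `κ`. -/
lemma integral_norm_lift_sq (C : IsBarrier V d κ q w) {φ : E N → ℝ} (hφ : IsTest φ) :
    ∫ x, ‖lift V d κ q w φ x‖ ^ 2
      = ∫ x, (‖gradient φ x‖ ^ 2 + (d * V x - q x) / κ * φ x ^ 2) := by
  have hlw : Continuous fun x => lap w x / w x :=
    (continuous_lap C.smooth).div C.smooth.continuous fun x => (C.pos x).ne'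
  have i1 : Integrable (fun x => ‖gradient φ x - φ x • logGrad w x‖ ^ 2) volume := by
    refine ((hφ.continuous_gradient.sub (hφ.continuous.smul
      (continuous_logGrad C.smooth C.pos))).norm.pow 2).integrable_of_hasCompactSupport ?_
    refine HasCompactSupport.intro (hφ.2.isCompact.union hφ.hasCompactSupport_gradient.isCompact)
      fun x hx => ?_
    rw [mem_union, not_or] at hx
    simp [image_eq_zero_of_notMem_tsupport hx.1, image_eq_zero_of_notMem_tsupport hx.2]
  have i2 := hφ.integrable_mul_sq C.continuous_massCoeff
  have i3 := hφ.integrable_norm_gradient_sq.fun_add (hφ.integrable_mul_sq hlw)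
  simp only [C.norm_lift_sq]
  rw [integral_add i1 i2, C.integral_norm_sq hφ, ← integral_add i3 i2]
  refine integral_congr_ae (.of_forall fun x => ?_)
  simp only [massCoeff]
  ring

/-- Coercivity: by Hardy's inequality the term `q φ²` costs at most half of the form. -/
lemma energy_le_lift (C : IsBarrier V d κ q w) {φ : E N → ℝ} (hφ : IsTest φ) :
    energy 1 V φ (gradient φ)
      ≤ ENNReal.ofReal (2 * κ / min κ d) * eLpNorm (lift V d κ q w φ) 2 volume ^ 2 := by
  have hκ := C.κ_pos
  have hmin : 0 < min κ d := lt_min C.κ_pos C.d_pos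
  have hm := C.memLp_lift hφ
  have e1 : eLpNorm (lift V d κ q w φ) 2 volume ^ 2
      = ENNReal.ofReal (∫ x, ‖lift V d κ q w φ x‖ ^ 2) := by
    rw [eLpNorm_two_sq, ofReal_integral_eq_lintegral_ofReal
      ((memLp_two_iff_integrable_sq_norm hm.1).1 hm) (.of_forall fun x => by positivity)]
    simp only [enorm_sq_eq_ofReal]
  rw [e1, hφ.energy_eq_ofReal C.V_cont C.V_nonneg, ← ENNReal.ofReal_mul (by positivity)]
  refine ENNReal.ofReal_le_ofReal ?_
  rw [C.integral_norm_lift_sq hφ, mul_comm, mul_div_assoc', le_div_iff₀ hmin]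
  have hh := C.hardy_test hφ
  have ig := hφ.integrable_norm_gradient_sq
  have iV := hφ.integrable_mul_sq C.V_cont
  have iq := hφ.integrable_mul_sq C.q_cont
  have s1 : ∫ x, (κ * ‖gradient φ x‖ ^ 2 + d * V x * φ x ^ 2)
      = κ * (∫ x, ‖gradient φ x‖ ^ 2) + d * (∫ x, V x * φ x ^ 2) := by
    simp only [mul_assoc]
    rw [integral_add (ig.const_mul _) (iV.const_mul _), integral_const_mul, integral_const_mul]
  have s2 : ∫ x, (1 ^ 2 * ‖gradient φ x‖ ^ 2 + V x * φ x ^ 2)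
      = (∫ x, ‖gradient φ x‖ ^ 2) + ∫ x, V x * φ x ^ 2 := by
    simp only [one_pow, one_mul]
    rw [integral_add ig iV]
  have s3 : ∫ x, (‖gradient φ x‖ ^ 2 + (d * V x - q x) / κ * φ x ^ 2)
      = (∫ x, ‖gradient φ x‖ ^ 2) + (d / κ * (∫ x, V x * φ x ^ 2)
        - κ⁻¹ * (∫ x, q x * φ x ^ 2)) := by
    have i1 : Integrable (fun x => d / κ * (V x * φ x ^ 2) - κ⁻¹ * (q x * φ x ^ 2)) volume :=
      (iV.const_mul _).sub (iq.const_mul _)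
    rw [← integral_const_mul, ← integral_const_mul, ← integral_sub (iV.const_mul _)
      (iq.const_mul _), ← integral_add ig i1]
    refine integral_congr_ae (.of_forall fun x => ?_)
    simp only
    field_simp
  rw [s1] at hh
  rw [s2, s3]
  have p1 : 0 ≤ ∫ x, ‖gradient φ x‖ ^ 2 := integral_nonneg fun x => by positivity
  have p2 : 0 ≤ ∫ x, V x * φ x ^ 2 :=
    integral_nonneg fun x => mul_nonneg (C.V_nonneg x) (sq_nonneg _)
  generalize (∫ x, ‖gradient φ x‖ ^ 2) = a at *
  generalize (∫ x, V x * φ x ^ 2) = b at *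
  generalize (∫ x, q x * φ x ^ 2) = e at *
  have e3 : 2 * κ * (a + (d / κ * b - κ⁻¹ * e)) = 2 * (κ * a) + 2 * (d * b) - 2 * e := by
    field_simp
    ring
  rw [mul_comm _ (2 * κ), e3]
  nlinarith [mul_le_mul_of_nonneg_right (min_le_left κ d) p1,
    mul_le_mul_of_nonneg_right (min_le_right κ d) p2]

/-- The function represented by an element of the closure of the lifts: the second component of the
lift, divided by `√m`. -/
noncomputable def fn (_ : IsBarrier V d κ q w) (f : LiftSpace N) (x : E N) : ℝ :=
  (f x).snd / √(massCoeff V d κ q w x)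

/-- The weak gradient of the function represented by an element of the closure of the lifts. -/
noncomputable def grad (C : IsBarrier V d κ q w) (f : LiftSpace N) (x : E N) : E N :=
  (f x).fst + C.fn f x • logGrad w x

lemma sqrt_massCoeff_pos (C : IsBarrier V d κ q w) (x : E N) :
    0 < √(massCoeff V d κ q w x) := Real.sqrt_pos.2 (C.massCoeff_pos x)

lemma snd_eq (C : IsBarrier V d κ q w) (f : LiftSpace N) (x : E N) :
    (f x).snd = √(massCoeff V d κ q w x) * C.fn f x := by
  rw [fn, mul_div_cancel₀ _ (C.sqrt_massCoeff_pos x).ne']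

lemma aestronglyMeasurable_fn (C : IsBarrier V d κ q w) (f : LiftSpace N) :
    AEStronglyMeasurable (C.fn f) volume := by
  have h1 : AEStronglyMeasurable (fun x => (f x).snd) volume :=
    (WithLp.sndL 2 ℝ (E N) ℝ).continuous.comp_aestronglyMeasurable (Lp.aestronglyMeasurable f)
  have h2 : Continuous fun x => (√(massCoeff V d κ q w x))⁻¹ :=
    C.continuous_massCoeff.sqrt.inv₀ fun x => (C.sqrt_massCoeff_pos x).ne'
  exact h1.mul h2.aestronglyMeasurable

lemma aestronglyMeasurable_grad (C : IsBarrier V d κ q w) (f : LiftSpace N) :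
    AEStronglyMeasurable (C.grad f) volume :=
  ((WithLp.fstL 2 ℝ (E N) ℝ).continuous.comp_aestronglyMeasurable
    (Lp.aestronglyMeasurable f)).add ((C.aestronglyMeasurable_fn f).smul
      (continuous_logGrad C.smooth C.pos).aestronglyMeasurable)

/-- The closure of the lifts of test functions is made of lifts of elements of `H¹_V`. -/
lemma memH1V_of_mem (C : IsBarrier V d κ q w) {f : LiftSpace N} (hf : f ∈ C.liftClosure) :
    MemH1V V (C.fn f) (C.grad f) := by
  obtain ⟨φ, hφ, hlim, hae⟩ := C.exists_seq_of_mem_liftClosure hf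
  have hum := C.aestronglyMeasurable_fn f
  have hgm := C.aestronglyMeasurable_grad f
  have hφm : ∀ n, AEStronglyMeasurable (φ n) volume := fun n =>
    (hφ n).continuous.aestronglyMeasurable
  have haeφ : ∀ᵐ x, Tendsto (fun n => φ n x) atTop (𝓝 (C.fn f x)) := by
    filter_upwards [hae] with x hx
    have h1 := (((WithLp.sndL 2 ℝ (E N) ℝ).continuous.tendsto _).comp hx).div_const
      (√(massCoeff V d κ q w x))
    refine h1.congr fun n => ?_
    change √(massCoeff V d κ q w x) * φ n x / √(massCoeff V d κ q w x) = φ n x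
    rw [mul_div_cancel_left₀ _ (C.sqrt_massCoeff_pos x).ne']
  have haeg : ∀ᵐ x, Tendsto (fun n => gradient (φ n) x) atTop (𝓝 (C.grad f x)) := by
    filter_upwards [hae, haeφ] with x hx hx'
    have h1 := (((WithLp.fstL 2 ℝ (E N) ℝ).continuous.tendsto _).comp hx).add
      (hx'.smul_const (logGrad w x))
    refine h1.congr fun n => ?_
    change gradient (φ n) x - φ n x • logGrad w x + φ n x • logGrad w x = _
    rw [sub_add_cancel]
  set c : ℝ≥0∞ := ENNReal.ofReal (2 * κ / min κ d)
  have hlimE : Tendsto (fun n => ‖C.liftLp (hφ n) - f‖ₑ) atTop (𝓝 0) :=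
    tendsto_iff_enorm_sub_tendsto_zero.1 hlim
  have hE : ∀ n, energy 1 V (fun x => φ n x - C.fn f x) (fun x => gradient (φ n) x - C.grad f x)
      ≤ c * ‖C.liftLp (hφ n) - f‖ₑ ^ 2 := by
    intro n
    have hpair : ∀ k, energy 1 V (fun x => φ n x - φ k x)
        (fun x => gradient (φ n) x - gradient (φ k) x)
        ≤ c * ‖C.liftLp (hφ n) - C.liftLp (hφ k)‖ₑ ^ 2 := by
      intro k
      have hsub := (hφ n).sub (hφ k)
      have h1 := C.energy_le_lift hsub
      have h2 : ‖C.liftLp (hφ n) - C.liftLp (hφ k)‖ₑ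
          = eLpNorm (lift V d κ q w (fun x => φ n x - φ k x)) 2 volume := by
        rw [Lp.enorm_def]
        refine eLpNorm_congr_ae ?_
        filter_upwards [Lp.coeFn_sub (C.liftLp (hφ n)) (C.liftLp (hφ k)), C.coeFn_liftLp (hφ n),
          C.coeFn_liftLp (hφ k)] with x e1 e2 e3
        rw [e1, Pi.sub_apply, e2, e3]
        have e4 := lift_add (V := V) (d := d) (κ := κ) (q := q) (w := w) (hφ n)
          ((hφ k).const_mul (-1)) x
        rw [lift_const_mul (hφ k)] at e4
        simp only [neg_one_mul, neg_one_smul, ← sub_eq_add_neg] at e4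
        exact e4.symm
      rw [h2]
      refine le_trans (le_of_eq ?_) h1
      congr 1
      ext1 x
      rw [gradient_fun_sub ((hφ n).differentiable x) ((hφ k).differentiable x)]
    have hF : energy 1 V (fun x => φ n x - C.fn f x) (fun x => gradient (φ n) x - C.grad f x)
        ≤ liminf (fun k => energy 1 V (fun x => φ n x - φ k x)
          (fun x => gradient (φ n) x - gradient (φ k) x)) atTop := by
      refine le_trans (le_of_eq ?_) (lintegral_liminf_le fun k => ?_)
      · refine lintegral_congr_ae ?_
        filter_upwards [haeφ, haeg] with x h1 h2
        refine (Tendsto.liminf_eq (ENNReal.tendsto_ofReal ?_)).symm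
        exact (((tendsto_const_nhds.sub h2).norm.pow 2).const_mul _).add
          (((tendsto_const_nhds.sub h1).pow 2).const_mul _)
      · have := (hφ n).continuous_gradient.sub (hφ k).continuous_gradient
        have h3 := (hφ n).continuous.sub (hφ k).continuous
        exact (((this.norm.pow 2).const_mul _).add (C.V_cont.mul (h3.pow 2))).measurable.ennreal_ofReal
    refine hF.trans ?_
    have ht : Tendsto (fun k => c * ‖C.liftLp (hφ n) - C.liftLp (hφ k)‖ₑ ^ 2) atTop
        (𝓝 (c * ‖C.liftLp (hφ n) - f‖ₑ ^ 2)) :=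
      ENNReal.Tendsto.const_mul (ENNReal.Tendsto.pow
        ((continuous_enorm.tendsto _).comp (tendsto_const_nhds.sub hlim)))
        (.inr ENNReal.ofReal_ne_top)
    rw [← ht.liminf_eq]
    exact liminf_le_liminf (.of_forall hpair)
  have hEt : Tendsto (fun n => energy 1 V (fun x => φ n x - C.fn f x)
      (fun x => gradient (φ n) x - C.grad f x)) atTop (𝓝 0) := by
    refine tendsto_of_tendsto_of_tendsto_of_le_of_le tendsto_const_nhds ?_ (fun _ => zero_le) hE
    have := ENNReal.Tendsto.const_mul (a := c) (ENNReal.Tendsto.pow (n := 2) hlimE)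
      (.inr ENNReal.ofReal_ne_top)
    simpa using this
  refine ⟨?_, φ, hφ, hEt⟩
  have hA := ((tendsto_energy_zero_iff (u := fun n x => φ n x - C.fn f x) one_pos C.V_cont
    C.V_nonneg fun n => (hφm n).sub hum).1 hEt).1
  refine isWeakGradient_of_tendsto C.continuous_massCoeff C.massCoeff_pos hum hgm
    (fun n => isWeakGradient_of_contDiff (hφ n).1) ?_ hA
  refine tendsto_of_tendsto_of_tendsto_of_le_of_le tendsto_const_nhds hlimE (fun _ => zero_le)
    fun n => ?_
  rw [← ENNReal.pow_le_pow_left_iff two_ne_zero, eLpNorm_wm_sq C.continuous_massCoeff.measurable,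
    Lp.enorm_def, eLpNorm_two_sq]
  refine lintegral_mono_ae ?_
  filter_upwards [Lp.coeFn_sub (C.liftLp (hφ n)) f, C.coeFn_liftLp (hφ n)] with x e1 e2
  rw [e1, Pi.sub_apply, e2, enorm_sq_eq_ofReal, enorm_sq_eq_ofReal,
    ← ENNReal.ofReal_mul (C.massCoeff_pos x).le]
  refine ENNReal.ofReal_le_ofReal ?_
  rw [norm_gradVal_sq]
  have e3 : (lift V d κ q w (φ n) x - f x).snd
      = √(massCoeff V d κ q w x) * (φ n x - C.fn f x) := by
    change √(massCoeff V d κ q w x) * φ n x - (f x).snd = _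
    rw [C.snd_eq]; ring
  rw [e3, mul_pow, Real.sq_sqrt (C.massCoeff_pos x).le, Real.norm_eq_abs, sq_abs]
  exact le_add_of_nonneg_left (by positivity)

end IsBarrier


/-! ### The obstacle problem -/

lemma inner_real_eq_mul (a b : ℝ) : inner ℝ a b = a * b := by
  simp [mul_comm]

namespace IsBarrier

variable {V q w : E N → ℝ} {d κ : ℝ}

/-- The smooth truncation of `φ` at the level `w` is a test function, since the truncation is the
identity below the level. -/
lemma isTest_truncate (C : IsBarrier V d κ q w) {φ : E N → ℝ} (hφ : IsTest φ) :
    IsTest (fun x => w x * softMin (φ x / w x)) := by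
  refine ⟨C.smooth.mul (contDiff_softMin.comp (hφ.1.div C.smooth fun x => (C.pos x).ne')), ?_⟩
  refine hφ.2.mono fun x hx h0 => hx ?_
  simp [h0, softMin_of_le zero_le_one]

/-- The truncation at the level `w` acts as a pointwise contraction on lifts. -/
lemma lift_truncate (C : IsBarrier V d κ q w) {φ : E N → ℝ} (hφ : IsTest φ) (x : E N) :
    lift V d κ q w (fun x => w x * softMin (φ x / w x)) x
      = WithLp.toLp 2 (deriv softMin (φ x / w x) • (lift V d κ q w φ x).fst,
          √(massCoeff V d κ q w x) * (w x * softMin (φ x / w x))) := by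
  have hw := (C.pos x).ne'
  have dw : DifferentiableAt ℝ w x := C.smooth.differentiable (by simp) x
  have dφ := hφ.differentiable x
  have dinv : HasFDerivAt (fun y => (w y)⁻¹) ((-((w x) ^ 2)⁻¹) • fderiv ℝ w x) x :=
    (hasDerivAt_inv hw).comp_hasFDerivAt x dw.hasFDerivAt
  have dh : HasFDerivAt (fun y => φ y / w y)
      (φ x • ((-((w x) ^ 2)⁻¹) • fderiv ℝ w x) + (w x)⁻¹ • fderiv ℝ φ x) x := by
    simpa only [div_eq_mul_inv] using dφ.hasFDerivAt.fun_mul dinv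
  have ds : HasFDerivAt (fun y => softMin (φ y / w y)) (deriv softMin (φ x / w x) •
      (φ x • ((-((w x) ^ 2)⁻¹) • fderiv ℝ w x) + (w x)⁻¹ • fderiv ℝ φ x)) x :=
    ((contDiff_softMin.differentiable (by simp) _).hasDerivAt).comp_hasFDerivAt x dh
  have dt := dw.hasFDerivAt.fun_mul ds
  refine congrArg (WithLp.toLp 2) (Prod.ext ?_ rfl)
  simp only [lift]
  rw [gradient, dt.fderiv]
  simp only [map_add, map_smul]
  change _ = deriv softMin (φ x / w x) • (gradient φ x - φ x • logGrad w x)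
  simp only [logGrad, gradient]
  set a := (InnerProductSpace.toDual ℝ (E N)).symm (fderiv ℝ w x)
  set b := (InnerProductSpace.toDual ℝ (E N)).symm (fderiv ℝ φ x)
  match_scalars <;> field_simp
  ring

/-- The closure of the lifts is stable under truncation at the level `w`. The truncation is not
linear; its continuity comes from the pointwise contraction and from dominated convergence. -/
lemma truncate_mem (C : IsBarrier V d κ q w) {f : LiftSpace N} (hf : f ∈ C.liftClosure) :
    ∃ f' ∈ C.liftClosure, ∀ᵐ x, f' x =
      WithLp.toLp 2 (deriv softMin (C.fn f x / w x) • (f x).fst,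
          √(massCoeff V d κ q w x) * (w x * softMin (C.fn f x / w x))) := by
  obtain ⟨φ, hφ, hlim, hae⟩ := C.exists_seq_of_mem_liftClosure hf
  have hs'c : Continuous (deriv softMin) := contDiff_softMin.continuous_deriv (by simp)
  set h : E N → ℝ := fun x => C.fn f x / w x with hh
  set g : E N → GradVal N := fun x => WithLp.toLp 2 (deriv softMin (h x) • (f x).fst,
          √(massCoeff V d κ q w x) * (w x * softMin (h x))) with hg
  have hwinv : Continuous fun x => (w x)⁻¹ := C.smooth.continuous.inv₀ fun x => (C.pos x).ne'
  have hhm : AEStronglyMeasurable h volume :=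
    (C.aestronglyMeasurable_fn f).mul hwinv.aestronglyMeasurable
  have hgm : AEStronglyMeasurable g volume := by
    refine (WithLp.prod_continuous_toLp 2 (E N) ℝ).comp_aestronglyMeasurable
      (AEStronglyMeasurable.prodMk ?_ ?_)
    · exact (hs'c.comp_aestronglyMeasurable hhm).smul
        ((WithLp.fstL 2 ℝ (E N) ℝ).continuous.comp_aestronglyMeasurable (Lp.aestronglyMeasurable f))
    · exact C.continuous_massCoeff.sqrt.aestronglyMeasurable.mul
        (C.smooth.continuous.aestronglyMeasurable.mul
          (contDiff_softMin.continuous.comp_aestronglyMeasurable hhm))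
  have hwh : ∀ x, w x * h x = C.fn f x := fun x => by
    rw [hh]; simp only; rw [mul_div_cancel₀ _ (C.pos x).ne']
  have hgle : ∀ x, ‖g x‖ ≤ ‖f x‖ := by
    intro x
    refine (abs_le_of_sq_le_sq' ?_ (norm_nonneg _)).2
    rw [norm_gradVal_sq, norm_gradVal_sq, C.snd_eq, ← hwh x]
    change ‖deriv softMin (h x) • (f x).fst‖ ^ 2
      + (√(massCoeff V d κ q w x) * (w x * softMin (h x))) ^ 2 ≤ _
    rw [norm_smul, Real.norm_eq_abs, mul_pow, mul_pow, mul_pow, mul_pow, mul_pow]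
    have h1 : |deriv softMin (h x)| ^ 2 ≤ 1 := pow_le_one₀ (abs_nonneg _) (abs_deriv_softMin_le _)
    have h2 : softMin (h x) ^ 2 ≤ h x ^ 2 := sq_le_sq.2 (abs_softMin_le _)
    gcongr
    exact mul_le_of_le_one_left (by positivity) h1
  have hgL : MemLp g 2 volume := (Lp.memLp f).mono hgm (.of_forall hgle)
  refine ⟨hgL.toLp g, ?_, hgL.coeFn_toLp⟩
  have hcl : IsClosed (C.liftClosure : Set (LiftSpace N)) :=
    Submodule.isClosed_topologicalClosure _
  refine hcl.mem_of_tendsto (f := fun n => C.liftLp (C.isTest_truncate (hφ n))) (b := atTop) ?_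
    (.of_forall fun n => C.liftLp_mem _)
  rw [tendsto_iff_enorm_sub_tendsto_zero]
  set D : ℕ → E N → ℝ := fun n x =>
    |deriv softMin (φ n x / w x) - deriv softMin (h x)| * ‖f x‖ with hD
  have hDm : ∀ n, AEStronglyMeasurable (D n) volume := by
    intro n
    have h1 : AEStronglyMeasurable (fun x => deriv softMin (φ n x / w x)) volume :=
      (hs'c.comp ((hφ n).continuous.mul hwinv)).aestronglyMeasurable
    exact ((h1.sub (hs'c.comp_aestronglyMeasurable hhm)).norm).mul (Lp.aestronglyMeasurable f).norm
  have hbound : ∀ n, ‖C.liftLp (C.isTest_truncate (hφ n)) - hgL.toLp g‖ₑ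
      ≤ 2 * ‖C.liftLp (hφ n) - f‖ₑ + eLpNorm (D n) 2 volume := by
    intro n
    rw [Lp.enorm_def, Lp.enorm_def]
    have e1 : eLpNorm (fun x => 2 * ‖(C.liftLp (hφ n) - f) x‖) 2 volume
        = 2 * eLpNorm (C.liftLp (hφ n) - f) 2 volume := by
      have := eLpNorm_const_smul (2 : ℝ) (fun x => ‖(C.liftLp (hφ n) - f) x‖) 2 (volume : Measure (E N))
      simp only [eLpNorm_norm] at this
      rw [show ‖(2 : ℝ)‖ₑ = 2 by rw [Real.enorm_of_nonneg (by norm_num)]; simp] at this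
      rw [← this]
      rfl
    rw [← e1]
    refine le_trans ?_ (eLpNorm_add_le
      ((Lp.aestronglyMeasurable (C.liftLp (hφ n) - f)).norm.const_mul 2) (hDm n) (by norm_num))
    refine eLpNorm_mono_ae_real ?_
    filter_upwards [Lp.coeFn_sub (C.liftLp (C.isTest_truncate (hφ n))) (hgL.toLp g),
      Lp.coeFn_sub (C.liftLp (hφ n)) f, C.coeFn_liftLp (hφ n), hgL.coeFn_toLp,
      C.coeFn_liftLp (C.isTest_truncate (hφ n))] with x e1 e2 e3 e4 e5
    rw [e1, Pi.sub_apply, e4, e5, C.lift_truncate (hφ n) x]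
    simp only [Pi.add_apply]
    rw [e2, Pi.sub_apply, e3]
    set a := lift V d κ q w (φ n) x with ha
    have hw := C.pos x
    set v : GradVal N := WithLp.toLp 2 (deriv softMin (φ n x / w x) • a.fst,
      √(massCoeff V d κ q w x) * (w x * softMin (φ n x / w x))) - g x with hv
    have hv1 : v.fst = deriv softMin (φ n x / w x) • (a - f x).fst
        + (deriv softMin (φ n x / w x) - deriv softMin (h x)) • (f x).fst := by
      change deriv softMin (φ n x / w x) • a.fst - deriv softMin (h x) • (f x).fst
        = deriv softMin (φ n x / w x) • (a.fst - (f x).fst) + _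
      rw [smul_sub, sub_smul]; abel
    have hv2 : v.snd = √(massCoeff V d κ q w x) * (w x * (softMin (φ n x / w x) - softMin (h x))) := by
      change √(massCoeff V d κ q w x) * (w x * softMin (φ n x / w x))
        - √(massCoeff V d κ q w x) * (w x * softMin (h x)) = _
      ring
    have hn1 : ‖v.fst‖ ≤ ‖a - f x‖ + D n x := by
      rw [hv1]
      refine (norm_add_le _ _).trans (add_le_add ?_ ?_)
      · rw [norm_smul, Real.norm_eq_abs]
        exact (mul_le_of_le_one_left (norm_nonneg _) (abs_deriv_softMin_le _)).trans
          (norm_fst_le _)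
      · rw [norm_smul, Real.norm_eq_abs, hD]
        exact mul_le_mul_of_nonneg_left (norm_fst_le _) (abs_nonneg _)
    have hn2 : |v.snd| ≤ ‖a - f x‖ := by
      refine le_trans (le_of_le_of_eq
        (b := |√(massCoeff V d κ q w x) * (w x * (φ n x / w x - h x))|) ?_ ?_)
        (abs_snd_le (a - f x))
      · rw [hv2, abs_mul, abs_mul, abs_mul, abs_mul]
        exact mul_le_mul_of_nonneg_left (mul_le_mul_of_nonneg_left (abs_softMin_sub_le _ _)
          (abs_nonneg _)) (abs_nonneg _)
      · congr 1
        change _ = √(massCoeff V d κ q w x) * φ n x - (f x).snd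
        rw [C.snd_eq, ← hwh x]
        field_simp
    have hn3 : ‖v‖ ≤ ‖v.fst‖ + |v.snd| := by
      refine (abs_le_of_sq_le_sq' ?_ (by positivity)).2
      rw [norm_gradVal_sq, add_sq, sq_abs]
      nlinarith [mul_nonneg (norm_nonneg v.fst) (abs_nonneg v.snd)]
    linarith
  have hlimE : Tendsto (fun n => ‖C.liftLp (hφ n) - f‖ₑ) atTop (𝓝 0) :=
    tendsto_iff_enorm_sub_tendsto_zero.1 hlim
  have hDlim : Tendsto (fun n => eLpNorm (D n) 2 volume) atTop (𝓝 0) := by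
    have hsq : Tendsto (fun n => eLpNorm (D n) 2 volume ^ 2) atTop (𝓝 0) := by
      simp only [eLpNorm_two_sq]
      have h0 : ∫⁻ x : E N, (0 : ℝ≥0∞) = 0 := by simp
      rw [← h0]
      refine tendsto_lintegral_of_dominated_convergence' (fun x => (2 * ‖f x‖ₑ) ^ 2)
        (fun n => (hDm n).enorm.pow_const 2) (fun n => .of_forall fun x => ?_) ?_ ?_
      · rw [hD]
        simp only
        rw [enorm_mul, enorm_norm]
        gcongr
        rw [Real.enorm_eq_ofReal (abs_nonneg _)]
        refine le_trans (ENNReal.ofReal_le_ofReal (q := 2) ?_) (by simp)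
        exact (abs_sub _ _).trans (by
          have h1 := abs_deriv_softMin_le (φ n x / w x)
          have h2 := abs_deriv_softMin_le (h x)
          linarith)
      · simp only [mul_pow]
        rw [lintegral_const_mul' _ _ (by simp), ← eLpNorm_two_sq]
        exact ENNReal.mul_ne_top (by simp) (by simpa using (Lp.memLp f).2.ne)
      · filter_upwards [hae] with x hx
        have h1 : Tendsto (fun n => φ n x / w x) atTop (𝓝 (h x)) := by
          have := (((WithLp.sndL 2 ℝ (E N) ℝ).continuous.tendsto _).comp hx).div_const
            (√(massCoeff V d κ q w x))
          refine ((this.div_const (w x)).congr fun n => ?_)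
          change √(massCoeff V d κ q w x) * φ n x / √(massCoeff V d κ q w x) / w x = _
          rw [mul_div_cancel_left₀ _ (C.sqrt_massCoeff_pos x).ne']
        have h2 := (((hs'c.tendsto _).comp h1).sub_const (deriv softMin (h x))).abs.mul_const ‖f x‖
        rw [sub_self, abs_zero, zero_mul] at h2
        have h3 := ENNReal.Tendsto.pow (n := 2) ((continuous_enorm.tendsto _).comp h2)
        simpa only [Function.comp_def, enorm_zero, ne_eq, OfNat.ofNat_ne_zero, not_false_eq_true,
          zero_pow] using h3
    have := (ENNReal.continuous_rpow_const (y := (1 / 2 : ℝ))).tendsto 0 |>.comp hsq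
    simp only [Function.comp_def, ← ENNReal.rpow_natCast, ← ENNReal.rpow_mul] at this
    simpa using this
  refine tendsto_of_tendsto_of_tendsto_of_le_of_le tendsto_const_nhds ?_ (fun _ => zero_le) hbound
  simpa using (ENNReal.Tendsto.const_mul (a := 2) hlimE (.inr (by simp))).add hDlim

/-- The inner product with the lift of a test function is the weak form of the equation. -/
lemma inner_liftLp (C : IsBarrier V d κ q w) {f : LiftSpace N} (hf : f ∈ C.liftClosure)
    {η : E N → ℝ} (hη : IsTest η) :
    κ * inner ℝ f (C.liftLp hη)
      = ∫ x, (κ * inner ℝ (C.grad f x) (gradient η x) + (d * V x - q x) * C.fn f x * η x) := by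
  have hwg := (C.memH1V_of_mem hf).1
  have hg := hwg.ground_state C.smooth C.pos hη
  have hc1 : Continuous fun x => gradient η x - η x • logGrad w x :=
    hη.continuous_gradient.sub (hη.continuous.smul (continuous_logGrad C.smooth C.pos))
  have i2 : Integrable (fun x => C.fn f x * (massCoeff V d κ q w x * η x)) volume :=
    integrable_mul_of_locallyIntegrable hwg.1 (C.continuous_massCoeff.mul hη.continuous)
      hη.2.mul_left
  have hlw : Continuous fun x => lap w x / w x :=
    (continuous_lap C.smooth).div C.smooth.continuous fun x => (C.pos x).ne'
  have i3 : Integrable (fun x => inner ℝ (C.grad f x) (gradient η x)) volume :=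
    integrable_inner_of_locallyIntegrable hwg.2.1 hη.continuous_gradient
      hη.hasCompactSupport_gradient
  have i4 : Integrable (fun x => C.fn f x * (lap w x / w x * η x)) volume :=
    integrable_mul_of_locallyIntegrable hwg.1 (hlw.mul hη.continuous) hη.2.mul_left
  have i5 : Integrable (fun x => inner ℝ (C.grad f x) (gradient η x)
      + lap w x / w x * C.fn f x * η x) volume :=
    (i3.fun_add i4).congr (.of_forall fun x => by simp only; ring)
  have e0 : ∀ᵐ x, inner ℝ (f x) (C.liftLp hη x)
      = inner ℝ (C.grad f x - C.fn f x • logGrad w x) (gradient η x - η x • logGrad w x)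
        + C.fn f x * (massCoeff V d κ q w x * η x) := by
    filter_upwards [C.coeFn_liftLp hη] with x hx
    rw [hx, WithLp.prod_inner_apply]
    congr 1
    · rw [grad, add_sub_cancel_right]; rfl
    · change inner ℝ (f x).snd (√(massCoeff V d κ q w x) * η x) = _
      rw [C.snd_eq]
      rw [inner_real_eq_mul]
      have := Real.mul_self_sqrt (C.massCoeff_pos x).le
      linear_combination (C.fn f x * η x) * this
  have i1 : Integrable (fun x => inner ℝ (C.grad f x - C.fn f x • logGrad w x)
      (gradient η x - η x • logGrad w x)) volume := by
    have := (L2.integrable_inner (𝕜 := ℝ) f (C.liftLp hη)).congr e0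
    exact (this.sub i2).congr (.of_forall fun x => by simp)
  rw [L2.inner_def, integral_congr_ae e0, integral_add i1 i2, hg, ← integral_add i5 i2,
    ← integral_const_mul]
  refine integral_congr_ae (.of_forall fun x => ?_)
  simp only [massCoeff]
  have := C.κ_pos.ne'
  field_simp
  ring

/-- The obstacle problem. Among the functions of `H¹_V` lying above all the obstacles `o k`, the one
of least energy is a supersolution of the equation and lies below the barrier `w`. -/
theorem exists_obstacle_solution (C : IsBarrier V d κ q w) {o : ℕ → E N → ℝ}
    (ho : ∀ k, IsTest (o k)) (ho0 : ∀ k x, 0 ≤ o k x) (how : ∀ k x, o k x ≤ w x)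
    (hsum : Summable fun k => ‖C.liftLp (ho k)‖) :
    ∃ u g, MemH1V V u g ∧ (∀ᵐ x, ∀ k, o k x ≤ u x) ∧ (∀ᵐ x, u x ≤ w x) ∧
      ∀ η, IsTest η → (∀ x, 0 ≤ η x) →
        0 ≤ ∫ x, (κ * inner ℝ (g x) (gradient η x) + (d * V x - q x) * u x * η x) := by
  set K : Set (LiftSpace N) := (C.liftClosure : Set (LiftSpace N)) ∩
    ⋂ k, {f | ∀ᵐ x, √(massCoeff V d κ q w x) * o k x ≤ (f x).snd} with hK
  have hScl : IsClosed (C.liftClosure : Set (LiftSpace N)) :=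
    Submodule.isClosed_topologicalClosure _
  have hKcl : IsClosed K := hScl.inter (isClosed_iInter fun k => isClosed_le_snd _)
  have hKconv : Convex ℝ K := by
    refine C.liftClosure.convex.inter (convex_iInter fun k => ?_)
    intro f hf g hg a b ha hb hab
    filter_upwards [hf, hg, Lp.coeFn_add (a • f) (b • g), Lp.coeFn_smul a f,
      Lp.coeFn_smul b g] with x h1 h2 h3 h4 h5
    rw [h3, Pi.add_apply, h4, h5]
    change _ ≤ a * (f x).snd + b * (g x).snd
    have e : √(massCoeff V d κ q w x) * o k x
        = a * (√(massCoeff V d κ q w x) * o k x) + b * (√(massCoeff V d κ q w x) * o k x) := by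
      rw [← add_mul, hab, one_mul]
    rw [e]
    exact add_le_add (mul_le_mul_of_nonneg_left h1 ha) (mul_le_mul_of_nonneg_left h2 hb)
  -- The sum of all the obstacles is an admissible function.
  have hKne : K.Nonempty := by
    have hs := hsum.of_norm
    refine ⟨∑' k, C.liftLp (ho k), ?_, mem_iInter.2 fun k => ?_⟩
    · exact hScl.mem_of_tendsto hs.hasSum.tendsto_sum_nat
        (.of_forall fun n => Submodule.sum_mem _ fun k _ => C.liftLp_mem _)
    · refine (isClosed_le_snd _).mem_of_tendsto hs.hasSum.tendsto_sum_nat ?_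
      filter_upwards [eventually_gt_atTop k] with n hn
      have h1 : ∀ᵐ x, (∑ j ∈ Finset.range n, C.liftLp (ho j)) x
          = ∑ j ∈ Finset.range n, C.liftLp (ho j) x := by
        filter_upwards [Lp.coeFn_finsetSum (Finset.range n) (fun j => C.liftLp (ho j))] with x hx
        rw [hx, Finset.sum_apply]
      filter_upwards [h1, ae_all_iff.2 fun j => C.coeFn_liftLp (ho j)] with x e1 e2
      rw [e1]
      have e3 : (∑ j ∈ Finset.range n, C.liftLp (ho j) x).snd
          = ∑ j ∈ Finset.range n, √(massCoeff V d κ q w x) * o j x := by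
        rw [← WithLp.sndL_apply (p := 2) (𝕜 := ℝ), map_sum]
        exact Finset.sum_congr rfl fun j _ => by rw [e2 j]; rfl
      rw [e3]
      exact Finset.single_le_sum (f := fun j => √(massCoeff V d κ q w x) * o j x)
        (fun j _ => mul_nonneg (Real.sqrt_nonneg _) (ho0 j x)) (Finset.mem_range.2 hn)
  -- The solution is the element of least norm of the closed convex set `K`.
  obtain ⟨f, hfK, hmin⟩ := exists_norm_eq_iInf_of_complete_convex hKne hKcl.isComplete hKconv 0
  rw [norm_eq_iInf_iff_real_inner_le_zero hKconv hfK] at hmin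
  have hvar : ∀ g ∈ K, 0 ≤ inner ℝ f (g - f) := by
    intro g hg
    have := hmin g hg
    rw [zero_sub, inner_neg_left] at this
    linarith
  have hfS : f ∈ C.liftClosure := hfK.1
  have hfo : ∀ᵐ x, ∀ k, o k x ≤ C.fn f x := by
    have := ae_all_iff.2 fun k => mem_iInter.1 hfK.2 k
    filter_upwards [this] with x hx k
    have h1 := hx k
    rw [C.snd_eq] at h1
    exact le_of_mul_le_mul_left h1 (C.sqrt_massCoeff_pos x)
  refine ⟨C.fn f, C.grad f, C.memH1V_of_mem hfS, hfo, ?_, fun η hη hη0 => ?_⟩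
  · -- The truncation `f'` is admissible, so that `⟪f, f' - f⟫ ≥ 0`, whereas the integrand of this
    -- inner product is nonpositive, and negative where `u > w`.
    obtain ⟨f', hf'S, hf'⟩ := C.truncate_mem hfS
    have hf'K : f' ∈ K := by
      refine ⟨hf'S, mem_iInter.2 fun k => ?_⟩
      filter_upwards [hf', hfo] with x hx hxo
      rw [hx]
      change _ ≤ √(massCoeff V d κ q w x) * (w x * softMin (C.fn f x / w x))
      refine mul_le_mul_of_nonneg_left ?_ (Real.sqrt_nonneg _)
      have hw := C.pos x
      rcases le_or_gt (C.fn f x / w x) 1 with h | h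
      · rw [softMin_of_le h, mul_div_cancel₀ _ hw.ne']
        exact hxo k
      · exact (how k x).trans (le_mul_of_one_le_right hw.le (one_le_softMin h.le))
    have h1 := hvar f' hf'K
    have hle : ∀ᵐ x, inner ℝ (f x) (f' x) ≤ ‖f x‖ ^ 2 ∧
        (w x < C.fn f x → inner ℝ (f x) (f' x) < ‖f x‖ ^ 2) := by
      filter_upwards [hf'] with x hx
      rw [hx, WithLp.prod_inner_apply, norm_gradVal_sq]
      have hw := C.pos x
      have hs := C.sqrt_massCoeff_pos x
      have a1 : inner ℝ (f x).fst (deriv softMin (C.fn f x / w x) • (f x).fst)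
          ≤ ‖(f x).fst‖ ^ 2 := by
        rw [real_inner_smul_right, real_inner_self_eq_norm_sq]
        exact mul_le_of_le_one_left (sq_nonneg _) ((abs_le.1 (abs_deriv_softMin_le _)).2)
      have a2 : inner ℝ (f x).snd (√(massCoeff V d κ q w x) * (w x * softMin (C.fn f x / w x)))
          = √(massCoeff V d κ q w x) ^ 2 * (w x ^ 2 *
            (softMin (C.fn f x / w x) * (C.fn f x / w x))) := by
        rw [C.snd_eq]
        rw [inner_real_eq_mul]
        field_simp
      have a3 : (f x).snd ^ 2 = √(massCoeff V d κ q w x) ^ 2 * (w x ^ 2 *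
            (C.fn f x / w x) ^ 2) := by
        rw [C.snd_eq]
        field_simp
      set s := C.fn f x / w x with hsdef
      have a4 : softMin s * s ≤ s ^ 2 := by
        have := (abs_mul (softMin s) s).le.trans
          (mul_le_mul_of_nonneg_right (abs_softMin_le s) (abs_nonneg s))
        rw [abs_mul_abs_self] at this
        nlinarith [le_abs_self (softMin s * s)]
      have a5 : inner ℝ (f x).snd (√(massCoeff V d κ q w x) * (w x * softMin s))
          ≤ (f x).snd ^ 2 := by
        rw [a2, a3]; gcongr
      refine ⟨add_le_add a1 a5, fun hlt => add_lt_add_of_le_of_lt a1 ?_⟩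
      have hs1 : 1 < s := (one_lt_div hw).2 hlt
      change inner ℝ (f x).snd (√(massCoeff V d κ q w x) * (w x * softMin s)) < (f x).snd ^ 2
      rw [a2, a3, pow_two s]
      have := softMin_lt hs1
      gcongr
    have h2 : inner ℝ f (f' - f) = - ∫ x, (‖f x‖ ^ 2 - inner ℝ (f x) (f' x)) := by
      rw [inner_sub_right, L2.inner_def, L2.inner_def,
        ← integral_sub (L2.integrable_inner f f') (L2.integrable_inner f f), ← integral_neg]
      refine integral_congr_ae (.of_forall fun x => ?_)
      simp only [real_inner_self_eq_norm_sq]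
      ring
    have hint : Integrable (fun x => ‖f x‖ ^ 2 - inner ℝ (f x) (f' x)) volume := by
      refine ((L2.integrable_inner (𝕜 := ℝ) f f).sub (L2.integrable_inner (𝕜 := ℝ) f f')).congr
        (.of_forall fun x => ?_)
      simp only [Pi.sub_apply, real_inner_self_eq_norm_sq]
    have hnn : 0 ≤ᵐ[volume] fun x => ‖f x‖ ^ 2 - inner ℝ (f x) (f' x) :=
      hle.mono fun x hx => sub_nonneg.2 hx.1
    have hz : ∫ x, (‖f x‖ ^ 2 - inner ℝ (f x) (f' x)) = 0 :=
      le_antisymm (by linarith) (integral_nonneg_of_ae hnn)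
    rw [integral_eq_zero_iff_of_nonneg_ae hnn hint] at hz
    filter_upwards [hz, hle] with x e1 e2
    by_contra hcon
    have := e2.2 (not_le.1 hcon)
    simp only [Pi.zero_apply] at e1
    linarith
  · -- Adding a nonnegative function preserves the constraints, and gives the weak inequality.
    have h1 : f + C.liftLp hη ∈ K := by
      refine ⟨add_mem hfS (C.liftLp_mem hη), mem_iInter.2 fun k => ?_⟩
      filter_upwards [mem_iInter.1 hfK.2 k, Lp.coeFn_add f (C.liftLp hη), C.coeFn_liftLp hη]
        with x e1 e2 e3
      rw [e2, Pi.add_apply, e3]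
      change _ ≤ (f x).snd + √(massCoeff V d κ q w x) * η x
      exact e1.trans (le_add_of_nonneg_right (mul_nonneg (Real.sqrt_nonneg _) (hη0 x)))
    have h2 := hvar _ h1
    rw [add_sub_cancel_left] at h2
    rw [← C.inner_liftLp hfS hη]
    exact mul_nonneg C.κ_pos.le h2

end IsBarrier


/-! ### The linear supersolution -/

namespace IsBarrier

variable {V q w : E N → ℝ} {d κ : ℝ}

lemma norm_liftLp_const_mul (C : IsBarrier V d κ q w) {φ : E N → ℝ} (hφ : IsTest φ) {c : ℝ}
    (hc : 0 ≤ c) : ‖C.liftLp (hφ.const_mul c)‖ = c * ‖C.liftLp hφ‖ := by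
  have : C.liftLp (hφ.const_mul c) = c • C.liftLp hφ := by
    refine Lp.ext ?_
    filter_upwards [C.coeFn_liftLp (hφ.const_mul c), Lp.coeFn_smul c (C.liftLp hφ),
      C.coeFn_liftLp hφ] with x h1 h2 h3
    rw [h1, h2, Pi.smul_apply, h3, lift_const_mul hφ]
  rw [this, norm_smul, Real.norm_of_nonneg hc]

/-- There is a positive supersolution in `H¹_V` which lies between a given cutoff function and the
barrier `w`. The barrier need not belong to `H¹_V` itself, as `V` may grow arbitrarily fast. -/
theorem exists_supersolution (C : IsBarrier V d κ q w) {χ : E N → ℝ} (hχ : IsTest χ)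
    (hχ0 : ∀ x, 0 ≤ χ x) (hχw : ∀ x, χ x ≤ w x) :
    ∃ u g, MemH1V V u g ∧ (∀ x, 0 < u x) ∧ (∀ x, χ x ≤ u x) ∧ (∀ x, u x ≤ w x) ∧
      ∀ η, IsTest η → (∀ x, 0 ≤ η x) →
        0 ≤ ∫ x, (κ * inner ℝ (g x) (gradient η x) + (d * V x - q x) * u x * η x) := by
  -- Small multiples of bumps exhausting the space are used as obstacles, to ensure positivity.
  have hb : ∀ k : ℕ, ∃ ζ : E N → ℝ, IsTest ζ ∧ (∀ x, 0 ≤ ζ x) ∧ (∀ x, ζ x ≤ 1) ∧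
      ∀ x ∈ Metric.closedBall (0 : E N) k, ζ x = 1 := fun k => by
    obtain ⟨ζ, h1, h2, h3, h4, -⟩ := exists_isTest_cutoff
      (isCompact_closedBall (0 : E N) k) isOpen_univ (subset_univ _)
    exact ⟨ζ, h1, h2, h3, h4⟩
  choose ζ hζ hζ0 hζ1 hζb using hb
  have hm : ∀ k, ∃ m : ℝ, 0 < m ∧ ∀ x, m * ζ k x ≤ w x := by
    intro k
    obtain ⟨m, hm0, hm⟩ : ∃ m : ℝ, 0 < m ∧ ∀ x ∈ tsupport (ζ k), m ≤ w x :=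
      (hζ k).2.isCompact.exists_forall_le' C.smooth.continuous.continuousOn
        (fun x _ => C.pos x)
    refine ⟨m, hm0, fun x => ?_⟩
    by_cases hx : x ∈ tsupport (ζ k)
    · exact (mul_le_of_le_one_right hm0.le (hζ1 k x)).trans (hm x hx)
    · rw [image_eq_zero_of_notMem_tsupport hx, mul_zero]
      exact (C.pos x).le
  choose m hm0 hmw using hm
  -- The multiples stay below `w`, and their lifts are summable.
  set c : ℕ → ℝ := fun k => min (m k) ((1 / 2) ^ k / (1 + ‖C.liftLp (hζ k)‖)) with hc
  have hc0 : ∀ k, 0 < c k := fun k => lt_min (hm0 k) (by positivity)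
  set o : ℕ → E N → ℝ := fun k => Nat.casesOn k χ (fun j x => c j * ζ j x) with hodef
  have ho : ∀ k, IsTest (o k) := by
    rintro (_ | j)
    · exact hχ
    · exact (hζ j).const_mul (c j)
  have ho0 : ∀ k x, 0 ≤ o k x := by
    rintro (_ | j) x
    · exact hχ0 x
    · exact mul_nonneg (hc0 j).le (hζ0 j x)
  have how : ∀ k x, o k x ≤ w x := by
    rintro (_ | j) x
    · exact hχw x
    · exact (mul_le_mul_of_nonneg_right (min_le_left _ _) (hζ0 j x)).trans (hmw j x)
  have hsum : Summable fun k => ‖C.liftLp (ho k)‖ := by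
    rw [← summable_nat_add_iff 1]
    refine Summable.of_nonneg_of_le (fun _ => norm_nonneg _) (fun j => ?_) summable_geometric_two
    have h1 : ‖C.liftLp (ho (j + 1))‖ = c j * ‖C.liftLp (hζ j)‖ :=
      C.norm_liftLp_const_mul (hζ j) (hc0 j).le
    rw [h1]
    calc c j * ‖C.liftLp (hζ j)‖
        ≤ (1 / 2) ^ j / (1 + ‖C.liftLp (hζ j)‖) * (1 + ‖C.liftLp (hζ j)‖) := by
          gcongr
          · exact min_le_right _ _
          · linarith
      _ = (1 / 2) ^ j := by field_simp
  obtain ⟨u, g, ⟨hwg, φ, hφ, hE⟩, hou, huw, hsup⟩ := C.exists_obstacle_solution ho ho0 how hsum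
  have hgood : ∀ᵐ x, (∀ k, o k x ≤ u x) ∧ u x ≤ w x := hou.and huw
  classical
  -- The values are modified on a null set, for the bounds to hold at every point.
  set u' : E N → ℝ := fun x => if (∀ k, o k x ≤ u x) ∧ u x ≤ w x then u x else w x with hu'
  have hae : u =ᵐ[volume] u' := by
    filter_upwards [hgood] with x hx
    rw [hu']; simp only [if_pos hx]
  refine ⟨u', g, ⟨hwg.congr hae (.refl _ _), φ, hφ, ?_⟩, fun x => ?_, fun x => ?_, fun x => ?_,
    fun η hη hη0 => ?_⟩
  · refine hE.congr fun n => lintegral_congr_ae ?_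
    filter_upwards [hae] with x hx
    rw [hx]
  · rw [hu']; simp only
    split_ifs with h
    · obtain ⟨k, hk⟩ := exists_nat_ge ‖x‖
      have h1 := h.1 (k + 1)
      refine lt_of_lt_of_le ?_ h1
      change 0 < c k * ζ k x
      rw [hζb k x (by simpa using hk), mul_one]
      exact hc0 k
    · exact C.pos x
  · rw [hu']; simp only
    split_ifs with h
    · exact h.1 0
    · exact hχw x
  · rw [hu']; simp only
    split_ifs with h
    · exact h.2
    · exact le_rfl
  · refine (hsup η hη hη0).trans (le_of_eq (integral_congr_ae ?_))
    filter_upwards [hae] with x hx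
    rw [hx]

end IsBarrier


/-! ### Approximation by mollification in `L²` -/

lemma aestronglyMeasurable_comp_sub {F : Type*} [NormedAddCommGroup F] {f : E N → F}
    (hf : AEStronglyMeasurable f volume) (x : E N) :
    AEStronglyMeasurable (fun t => f (x - t)) volume :=
  hf.comp_quasiMeasurePreserving (quasiMeasurePreserving_sub_left volume x)

/-- Translations are continuous in `L²`. -/
lemma tendsto_translate {F : Type*} [NormedAddCommGroup F] {f : E N → F}
    (hf : MemLp f 2 volume) :
    Tendsto (fun t => ∫⁻ x, ‖f (x - t) - f x‖ₑ ^ 2) (𝓝 0) (𝓝 0) := by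
  have : Fact ((2 : ℝ≥0∞) ≠ ⊤) := ⟨by simp⟩
  have hc : Continuous (fun t : E N => DomAddAct.mk (-t) +ᵥ hf.toLp f) := by
    have h1 : Continuous (fun t : E N => DomAddAct.mk (-t)) :=
      DomAddAct.continuous_mk.comp continuous_neg
    exact h1.vadd continuous_const
  have h0 := (hc.tendsto 0).sub_const (hf.toLp f)
  have h1 := (ENNReal.continuous_ofReal.tendsto _).comp (h0.norm)
  have h2 := ((ENNReal.continuous_pow 2).tendsto _).comp h1
  simp only [neg_zero, DomAddAct.mk_zero, zero_vadd, sub_self, norm_zero, ENNReal.ofReal_zero,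
    ne_eq, OfNat.ofNat_ne_zero, not_false_eq_true, zero_pow, Function.comp_def] at h2
  refine h2.congr fun t => ?_
  rw [ofReal_norm, ← eLpNorm_two_sq, Lp.enorm_def]
  congr 1
  refine eLpNorm_congr_ae ?_
  filter_upwards [Lp.coeFn_sub (DomAddAct.mk (-t) +ᵥ hf.toLp f) (hf.toLp f), hf.coeFn_toLp,
    DomAddAct.vadd_Lp_ae_eq (DomAddAct.mk (-t)) (hf.toLp f),
    (quasiMeasurePreserving_add_left volume (-t)).ae hf.coeFn_toLp] with x h1 h2 h3 h4
  rw [h1, Pi.sub_apply, h2, h3]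
  have : DomAddAct.mk.symm (DomAddAct.mk (-t)) +ᵥ x = -t + x := rfl
  rw [this, h4, neg_add_eq_sub]

section Mollify

variable {F : Type*} [NormedAddCommGroup F] [NormedSpace ℝ F]

lemma integrable_smul_comp_sub {ρ : E N → ℝ} (hρ : IsTest ρ) {f : E N → F}
    (hf : LocallyIntegrable f volume) (x : E N) :
    Integrable (fun t => ρ t • f (x - t)) volume := by
  have := (integrable_comp_sub_smul hρ hf x).comp_sub_left x
  simpa using this

/-- Jensen's inequality for the average `mollify ρ f`. -/
lemma enorm_mollify_sub_sq_le [CompleteSpace F] {ρ : E N → ℝ} (hρ : IsTest ρ) (hρ0 : ∀ x, 0 ≤ ρ x)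
    (hρ1 : ∫ x, ρ x = 1) {f : E N → F} (hf : LocallyIntegrable f volume) (x : E N) :
    ‖mollify ρ f x - f x‖ₑ ^ 2 ≤ ∫⁻ t, ENNReal.ofReal (ρ t) * ‖f (x - t) - f x‖ₑ ^ 2 := by
  have hρi : Integrable ρ volume := hρ.continuous.integrable_of_hasCompactSupport hρ.2
  have e1 : mollify ρ f x - f x = ∫ t, ρ t • (f (x - t) - f x) := by
    simp only [smul_sub]
    rw [integral_sub (integrable_smul_comp_sub hρ hf x) (hρi.smul_const _), integral_smul_const,
      hρ1, one_smul]
    rfl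
  have hm : AEMeasurable (fun t => ‖f (x - t) - f x‖ₑ) (wm ρ) :=
    (((aestronglyMeasurable_comp_sub hf.aestronglyMeasurable x).sub
      aestronglyMeasurable_const).mono_ac (withDensity_absolutelyContinuous _ _)).enorm
  have hmass : ∫⁻ _, 1 ^ 2 ∂(wm ρ) = 1 := by
    rw [lintegral_wm hρ.continuous.measurable]
    simp only [one_pow, mul_one]
    rw [← ofReal_integral_eq_lintegral_ofReal hρi (.of_forall hρ0), hρ1, ENNReal.ofReal_one]
  have h2 := lintegral_mul_le_of_sq (μ := wm ρ) (f := fun _ => 1) aemeasurable_const hm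
  rw [hmass, ENNReal.one_rpow, one_mul] at h2
  simp only [one_mul] at h2
  rw [lintegral_wm hρ.continuous.measurable, lintegral_wm hρ.continuous.measurable] at h2
  calc ‖mollify ρ f x - f x‖ₑ ^ 2
      ≤ (∫⁻ t, ENNReal.ofReal (ρ t) * ‖f (x - t) - f x‖ₑ) ^ 2 := by
        gcongr
        rw [e1]
        refine (enorm_integral_le_lintegral_enorm _).trans_eq (lintegral_congr fun t => ?_)
        rw [enorm_smul, Real.enorm_of_nonneg (hρ0 t)]
    _ ≤ ((∫⁻ t, ENNReal.ofReal (ρ t) * ‖f (x - t) - f x‖ₑ ^ 2) ^ (1 / 2 : ℝ)) ^ 2 := by gcongr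
    _ = _ := by
        rw [← ENNReal.rpow_natCast, ← ENNReal.rpow_mul]
        norm_num

/-- The distance in `L²` from `f` to its average `mollify ρ f` is at most the largest distance
from `f` to its translates by vectors of the support of `ρ`. -/
lemma lintegral_mollify_sub_sq_le [CompleteSpace F] {ρ : E N → ℝ} (hρ : IsTest ρ)
    (hρ0 : ∀ x, 0 ≤ ρ x) (hρ1 : ∫ x, ρ x = 1) {f : E N → F} (hf : LocallyIntegrable f volume)
    {η : ℝ≥0∞} (hη : ∀ t, ρ t ≠ 0 → ∫⁻ x, ‖f (x - t) - f x‖ₑ ^ 2 ≤ η) :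
    ∫⁻ x, ‖mollify ρ f x - f x‖ₑ ^ 2 ≤ η := by
  have hρi : Integrable ρ volume := hρ.continuous.integrable_of_hasCompactSupport hρ.2
  have hm : AEMeasurable (fun z : E N × E N =>
      ENNReal.ofReal (ρ z.2) * ‖f (z.1 - z.2) - f z.1‖ₑ ^ 2) (volume.prod volume) := by
    refine AEMeasurable.mul ?_ (AEMeasurable.pow_const (AEStronglyMeasurable.enorm
      (AEStronglyMeasurable.sub ?_ ?_)) 2)
    · exact (hρ.continuous.measurable.comp measurable_snd).ennreal_ofReal.aemeasurable
    · exact hf.aestronglyMeasurable.comp_quasiMeasurePreserving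
        (quasiMeasurePreserving_sub volume volume)
    · exact hf.aestronglyMeasurable.comp_quasiMeasurePreserving Measure.quasiMeasurePreserving_fst
  calc ∫⁻ x, ‖mollify ρ f x - f x‖ₑ ^ 2
      ≤ ∫⁻ x, ∫⁻ t, ENNReal.ofReal (ρ t) * ‖f (x - t) - f x‖ₑ ^ 2 :=
        lintegral_mono fun x => enorm_mollify_sub_sq_le hρ hρ0 hρ1 hf x
    _ = ∫⁻ t, ∫⁻ x, ENNReal.ofReal (ρ t) * ‖f (x - t) - f x‖ₑ ^ 2 := lintegral_lintegral_swap hm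
    _ ≤ ∫⁻ t, ENNReal.ofReal (ρ t) * η := by
        refine lintegral_mono fun t => ?_
        rw [lintegral_const_mul' _ _ ENNReal.ofReal_ne_top]
        by_cases ht : ρ t = 0
        · simp [ht]
        · gcongr; exact hη t ht
    _ = η := by
        rw [lintegral_mul_const _ hρ.continuous.measurable.ennreal_ofReal,
          ← ofReal_integral_eq_lintegral_ofReal hρi (.of_forall hρ0), hρ1]
        simp

lemma tendsto_mollify_sub [CompleteSpace F] {f : E N → F} (hf : MemLp f 2 volume) :
    Tendsto (fun j => ∫⁻ x, ‖mollify (mollifier N j) f x - f x‖ₑ ^ 2) atTop (𝓝 0) := by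
  rw [ENNReal.tendsto_nhds_zero]
  intro η hη
  have h1 := (ENNReal.tendsto_nhds_zero.1 (tendsto_translate hf)) η hη
  obtain ⟨r, hr, hball⟩ := Metric.eventually_nhds_iff.1 h1
  filter_upwards [(tendsto_two_div).eventually (gt_mem_nhds hr)] with j hj
  refine lintegral_mollify_sub_sq_le (isTest_mollifier j) (mollifier_nonneg j)
    (integral_mollifier j) (hf.locallyIntegrable (by norm_num)) fun t ht => hball ?_
  rw [dist_zero_right]
  by_contra h
  exact ht (mollifier_eq_zero (hj.le.trans (not_lt.1 h)))

end Mollify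

lemma integrable_inner_of_memLp {F : Type*} [NormedAddCommGroup F] [InnerProductSpace ℝ F]
    {g f : E N → F} (hg : MemLp g 2 volume) (hf : MemLp f 2 volume) :
    Integrable (fun x => inner ℝ (g x) (f x)) volume := by
  refine (L2.integrable_inner (𝕜 := ℝ) (hg.toLp g) (hf.toLp f)).congr ?_
  filter_upwards [hg.coeFn_toLp, hf.coeFn_toLp] with x h1 h2
  rw [h1, h2]

lemma tendsto_integral_inner {F : Type*} [NormedAddCommGroup F] [InnerProductSpace ℝ F]
    {g f : E N → F} {φ : ℕ → E N → F} (hg : MemLp g 2 volume) (hf : MemLp f 2 volume)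
    (hφ : ∀ n, MemLp (φ n) 2 volume)
    (h : Tendsto (fun n => ∫⁻ x, ‖φ n x - f x‖ₑ ^ 2) atTop (𝓝 0)) :
    Tendsto (fun n => ∫ x, inner ℝ (g x) (φ n x)) atTop (𝓝 (∫ x, inner ℝ (g x) (f x))) := by
  have h1 : Tendsto (fun n => eLpNorm (φ n - f) 2 volume) atTop (𝓝 0) := by
    have h2 := ((ENNReal.continuous_rpow_const (y := 1 / 2)).tendsto _).comp h
    simp only [Function.comp_def, one_div, ENNReal.zero_rpow_of_pos (show (0 : ℝ) < 2⁻¹ by norm_num)]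
      at h2
    refine h2.congr fun n => ?_
    change (∫⁻ x, ‖(φ n - f) x‖ₑ ^ 2) ^ (2⁻¹ : ℝ) = _
    rw [← eLpNorm_two_sq, ← ENNReal.rpow_natCast, ← ENNReal.rpow_mul]
    norm_num
  have h3 := (Lp.tendsto_Lp_iff_tendsto_eLpNorm'' φ hφ f hf).2 h1
  have h4 := (tendsto_const_nhds (x := hg.toLp g)).inner (𝕜 := ℝ) h3
  have key : ∀ {k : E N → F} (hk : MemLp k 2 volume),
      inner ℝ (hg.toLp g) (hk.toLp k) = ∫ x, inner ℝ (g x) (k x) := by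
    intro k hk
    rw [L2.inner_def]
    refine integral_congr_ae ?_
    filter_upwards [hg.coeFn_toLp, hk.coeFn_toLp] with x h1 h2
    rw [h1, h2]
  simpa only [key] using h4

lemma mollify_nonneg {ρ f : E N → ℝ} (hρ : ∀ x, 0 ≤ ρ x) (hf : ∀ x, 0 ≤ f x) (x : E N) :
    0 ≤ mollify ρ f x :=
  integral_nonneg fun t => mul_nonneg (hρ t) (hf _)

lemma mollify_mollifier_eq_zero {f : E N → ℝ} {R : ℝ} (hf : ∀ x, R < ‖x‖ → f x = 0) (j : ℕ)
    {x : E N} (hx : R + 2 < ‖x‖) : mollify (mollifier N j) f x = 0 := by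
  refine (integral_congr_ae (.of_forall fun t => ?_)).trans (integral_zero _ _)
  by_cases ht : 2 ≤ ‖t‖
  · have : mollifier N j t = 0 := mollifier_eq_zero (le_trans (by
      rw [div_le_iff₀ (by positivity)]; nlinarith [(Nat.cast_nonneg j : (0 : ℝ) ≤ j)]) ht)
    simp [this]
  · have : f (x - t) = 0 := hf _ (by have := norm_sub_norm_le x t; linarith)
    simp [this]

open Classical in
/-- A differential inequality that holds against nonnegative test functions holds against
nonnegative compactly supported functions of `H¹`. -/
lemma integral_nonneg_of_test {κ : ℝ} {g : E N → E N} {h b : E N → ℝ} (hg : MemLp g 2 volume)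
    (hh : AEStronglyMeasurable h volume) (hb : Continuous b) (hhb : ∀ x, |h x| ≤ b x)
    (H : ∀ η : E N → ℝ, IsTest η → (∀ x, 0 ≤ η x) →
      0 ≤ ∫ x, (κ * inner ℝ (g x) (gradient η x) + h x * η x))
    {φ : E N → ℝ} {ψ : E N → E N} (hφ : IsWeakGradient φ ψ) (hφ2 : MemLp φ 2 volume)
    (hψ2 : MemLp ψ 2 volume) (hφc : HasCompactSupport φ) (hφ0 : ∀ x, 0 ≤ φ x) :
    Integrable (fun x => inner ℝ (g x) (ψ x)) volume ∧ Integrable (fun x => h x * φ x) volume ∧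
      0 ≤ κ * (∫ x, inner ℝ (g x) (ψ x)) + ∫ x, h x * φ x := by
  obtain ⟨R, hR⟩ := hφc.isCompact.isBounded.subset_closedBall 0
  have hR0 : ∀ x, R < ‖x‖ → φ x = 0 := fun x hx => by
    by_contra h0
    have := hR (subset_tsupport _ h0)
    rw [mem_closedBall_zero_iff] at this
    linarith
  set k : E N → ℝ := (Metric.closedBall 0 (R + 2)).indicator h with hk
  have hkL : MemLp k 2 volume := by
    obtain ⟨M, hM⟩ := (isCompact_closedBall (0 : E N) (R + 2)).exists_bound_of_continuousOn
      hb.continuousOn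
    rw [hk, memLp_indicator_iff_restrict measurableSet_closedBall]
    have : IsFiniteMeasure (volume.restrict (Metric.closedBall (0 : E N) (R + 2))) :=
      ⟨by simpa using measure_closedBall_lt_top⟩
    refine MemLp.of_bound hh.restrict M ?_
    filter_upwards [ae_restrict_mem measurableSet_closedBall] with x hx
    exact (hhb x).trans ((le_abs_self _).trans (hM x hx))
  set φ' : ℕ → E N → ℝ := fun j => mollify (mollifier N j) φ with hφ'
  have ht : ∀ j, IsTest (φ' j) := fun j => isTest_mollify (isTest_mollifier j) hφ.1 hφc
  have hgr : ∀ j, gradient (φ' j) = mollify (mollifier N j) ψ := fun j =>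
    funext fun x => hφ.gradient_mollify (isTest_mollifier j) x
  have kφ : ∀ x, inner ℝ (k x) (φ x) = h x * φ x := fun x => by
    rw [inner_real_eq_mul, hk, indicator_apply]
    split_ifs with hx
    · rfl
    · rw [hR0 x (by rw [mem_closedBall_zero_iff, not_le] at hx; linarith)]; simp
  have kφ' : ∀ j x, inner ℝ (k x) (φ' j x) = h x * φ' j x := fun j x => by
    rw [inner_real_eq_mul, hk, indicator_apply]
    split_ifs with hx
    · rfl
    · rw [show φ' j x = 0 from mollify_mollifier_eq_zero hR0 j (by simpa using hx)]; simp
  have t1 := tendsto_integral_inner hg hψ2 (fun j => (ht j).memLp_gradient 2)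
    (by simp only [hgr]; exact tendsto_mollify_sub hψ2)
  have t2 := tendsto_integral_inner hkL hφ2 (fun j => (ht j).memLp 2) (tendsto_mollify_sub hφ2)
  have i1 : Integrable (fun x => inner ℝ (g x) (ψ x)) volume := integrable_inner_of_memLp hg hψ2
  have i2 : Integrable (fun x => inner ℝ (k x) (φ x)) volume := integrable_inner_of_memLp hkL hφ2
  refine ⟨i1, by simpa only [kφ] using i2, ?_⟩
  have t3 := (t1.const_mul κ).add t2
  simp only [kφ, kφ'] at t3
  refine ge_of_tendsto' t3 fun j => ?_
  have := H (φ' j) (ht j) (mollify_nonneg (mollifier_nonneg j) hφ0)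
  rwa [integral_add ((integrable_inner_of_memLp hg ((ht j).memLp_gradient 2)).const_mul κ)
    (by simpa only [kφ'] using integrable_inner_of_memLp hkL ((ht j).memLp 2)),
    integral_const_mul] at this


/-! ### Rellich's theorem -/

/-- Bounded sequences of a separable Hilbert space have weakly convergent subsequences. -/
lemma exists_subseq_tendsto_inner {H : Type*} [NormedAddCommGroup H] [InnerProductSpace ℝ H]
    [CompleteSpace H] [TopologicalSpace.SeparableSpace H] {f : ℕ → H} {M : ℝ}
    (hf : ∀ n, ‖f n‖ ≤ M) :
    ∃ σ : ℕ → ℕ, StrictMono σ ∧ ∃ f₀ : H, ∀ h : H,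
      Tendsto (fun n => inner ℝ (f (σ n)) h) atTop (𝓝 (inner ℝ f₀ h)) := by
  obtain ⟨a, -, σ, hσ, ha⟩ := WeakDual.isSeqCompact_closedBall ℝ H 0 M
    (x := fun n => StrongDual.toWeakDual (InnerProductSpace.toDual ℝ H (f n)))
    (fun n => by simpa using hf n)
  refine ⟨σ, hσ, (InnerProductSpace.toDual ℝ H).symm (WeakDual.toStrongDual a), fun h => ?_⟩
  have h1 := ((WeakDual.eval_continuous h).tendsto a).comp ha
  rw [InnerProductSpace.toDual_symm_apply]
  exact h1

lemma rpow_half_sq (a : ℝ≥0∞) : (a ^ (1 / 2 : ℝ)) ^ 2 = a := by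
  rw [← ENNReal.rpow_natCast, ← ENNReal.rpow_mul]
  norm_num

lemma IsTest.enorm_translate_sub_le {v : E N → ℝ} (hv : IsTest v) (t x : E N) :
    ‖v (x - t) - v x‖ₑ ^ 2
      ≤ ‖t‖ₑ ^ 2 * ∫⁻ s in Ioc (0 : ℝ) 1, ‖gradient v (x - s • t)‖ₑ ^ 2 := by
  have hc : Continuous (fun s : ℝ => gradient v (x - s • t)) :=
    hv.continuous_gradient.comp (by fun_prop)
  have hd : ∀ s : ℝ, HasDerivAt (fun s : ℝ => v (x - s • t)) (inner ℝ (gradient v (x - s • t)) (-t)) s := by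
    intro s
    have h1 := (hv.differentiable (x - s • t)).hasFDerivAt
    have h2 : HasDerivAt (fun s : ℝ => x - s • t) (-t) s := by
      simpa using ((hasDerivAt_id s).smul_const t).const_sub x
    rw [inner_gradient_left]
    exact h1.comp_hasDerivAt s h2
  have hci : Continuous (fun s : ℝ => inner ℝ (gradient v (x - s • t)) (-t)) :=
    hc.inner continuous_const
  have hftc := intervalIntegral.integral_eq_sub_of_hasDerivAt (a := 0) (b := 1)
    (fun s _ => hd s) (hci.intervalIntegrable 0 1)
  simp only [one_smul, zero_smul, sub_zero] at hftc
  have hle : ‖v (x - t) - v x‖ₑ ≤ ∫⁻ s in Ioc (0 : ℝ) 1, ‖t‖ₑ * ‖gradient v (x - s • t)‖ₑ := by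
    rw [← hftc, intervalIntegral.integral_of_le zero_le_one]
    refine (enorm_integral_le_lintegral_enorm _).trans (lintegral_mono fun s => ?_)
    rw [← ofReal_norm, ← ofReal_norm, ← ofReal_norm, ← ENNReal.ofReal_mul (norm_nonneg _)]
    refine ENNReal.ofReal_le_ofReal ((norm_inner_le_norm _ _).trans_eq ?_)
    rw [norm_neg, mul_comm]
  have hcs := lintegral_mul_le_of_sq (μ := volume.restrict (Ioc (0 : ℝ) 1)) (f := fun _ => ‖t‖ₑ)
    aemeasurable_const (hc.enorm.measurable.aemeasurable)
  calc ‖v (x - t) - v x‖ₑ ^ 2 ≤ ((∫⁻ s in Ioc (0 : ℝ) 1, ‖t‖ₑ ^ 2) ^ (1 / 2 : ℝ) *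
        (∫⁻ s in Ioc (0 : ℝ) 1, ‖gradient v (x - s • t)‖ₑ ^ 2) ^ (1 / 2 : ℝ)) ^ 2 := by
        gcongr; exact hle.trans hcs
    _ = _ := by
        rw [mul_pow, rpow_half_sq, rpow_half_sq]
        simp

/-- Translations move a test function in `L²` by at most the length of the translation times the
norm of the gradient. -/
lemma IsTest.lintegral_translate_sub_le {v : E N → ℝ} (hv : IsTest v) (t : E N) :
    ∫⁻ x, ‖v (x - t) - v x‖ₑ ^ 2 ≤ ‖t‖ₑ ^ 2 * ∫⁻ x, ‖gradient v x‖ₑ ^ 2 := by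
  have hm : AEMeasurable (fun z : E N × ℝ => ‖gradient v (z.1 - z.2 • t)‖ₑ ^ 2)
      (volume.prod (volume.restrict (Ioc (0 : ℝ) 1))) :=
    ((hv.continuous_gradient.comp (by fun_prop)).enorm.measurable.pow_const 2).aemeasurable
  calc ∫⁻ x, ‖v (x - t) - v x‖ₑ ^ 2
      ≤ ∫⁻ x, ‖t‖ₑ ^ 2 * ∫⁻ s in Ioc (0 : ℝ) 1, ‖gradient v (x - s • t)‖ₑ ^ 2 :=
        lintegral_mono fun x => hv.enorm_translate_sub_le t x
    _ = ‖t‖ₑ ^ 2 * ∫⁻ s in Ioc (0 : ℝ) 1, ∫⁻ x, ‖gradient v (x - s • t)‖ₑ ^ 2 := by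
        rw [lintegral_const_mul' _ _ (by simp), lintegral_lintegral_swap hm]
    _ = ‖t‖ₑ ^ 2 * ∫⁻ s in Ioc (0 : ℝ) 1, ∫⁻ x, ‖gradient v x‖ₑ ^ 2 := by
        congr 1
        refine lintegral_congr fun s => ?_
        exact lintegral_sub_right_eq_self (fun x => ‖gradient v x‖ₑ ^ 2) (s • t)
    _ = _ := by simp

lemma IsTest.lintegral_mollify_sub_le {v : E N → ℝ} (hv : IsTest v) (j : ℕ) :
    ∫⁻ x, ‖mollify (mollifier N j) v x - v x‖ₑ ^ 2
      ≤ ENNReal.ofReal (2 / ((j : ℝ) + 1)) ^ 2 * ∫⁻ x, ‖gradient v x‖ₑ ^ 2 := by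
  refine lintegral_mollify_sub_sq_le (isTest_mollifier j) (mollifier_nonneg j)
    (integral_mollifier j) hv.continuous.locallyIntegrable fun t ht =>
    (hv.lintegral_translate_sub_le t).trans ?_
  gcongr
  rw [← ofReal_norm]
  refine ENNReal.ofReal_le_ofReal (not_lt.1 fun h => ht (mollifier_eq_zero h.le))


lemma enorm_sub_sq_le_three (a b a' b' : ℝ) :
    ‖a - b‖ₑ ^ 2 ≤ 3 * (‖a' - a‖ₑ ^ 2 + ‖a' - b'‖ₑ ^ 2 + ‖b' - b‖ₑ ^ 2) := by
  simp only [enorm_sq_eq_ofReal, Real.norm_eq_abs, sq_abs]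
  rw [← ENNReal.ofReal_add (by positivity) (by positivity),
    ← ENNReal.ofReal_add (by positivity) (by positivity),
    show (3 : ℝ≥0∞) = ENNReal.ofReal 3 by simp, ← ENNReal.ofReal_mul (by norm_num)]
  refine ENNReal.ofReal_le_ofReal ?_
  nlinarith [sq_nonneg ((a' - a) + (a' - b')), sq_nonneg ((a' - a) + (b' - b)),
    sq_nonneg ((a' - b') - (b' - b))]

lemma eLpNorm_sqrt_mul {q φ : E N → ℝ} (hq : Continuous q) (hq0 : ∀ x, 0 < q x) :
    eLpNorm (fun x => √(q x) * φ x) 2 volume = eLpNorm φ 2 (wm q) := by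
  refine (ENNReal.pow_right_strictMono two_ne_zero).injective ?_
  beta_reduce
  rw [eLpNorm_two_sq, eLpNorm_wm_sq hq.measurable]
  refine lintegral_congr fun x => ?_
  rw [enorm_mul, mul_pow, Real.enorm_of_nonneg (Real.sqrt_nonneg _),
    ← ENNReal.ofReal_pow (Real.sqrt_nonneg _), Real.sq_sqrt (hq0 x).le]

/-- Localized functions have gradients controlled by the gradient and the weighted norm. -/
lemma IsTest.exists_lintegral_gradient_mul_le {θ q : E N → ℝ} (hθ : IsTest θ) (hq : Continuous q)
    (hq0 : ∀ x, 0 < q x) :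
    ∃ A : ℝ, ∀ φ, IsTest φ → ∫⁻ x, ‖gradient (fun x => θ x * φ x) x‖ₑ ^ 2
      ≤ ENNReal.ofReal A * (eLpNorm (gradient φ) 2 volume ^ 2 + eLpNorm φ 2 (wm q) ^ 2) := by
  have hc1 : Continuous (fun x => 2 * θ x ^ 2) := by have := hθ.continuous; fun_prop
  have hc2 : Continuous (fun x => 2 * (‖gradient θ x‖ ^ 2 / q x)) :=
    continuous_const.mul ((hθ.continuous_gradient.norm.pow 2).div hq fun x => (hq0 x).ne')
  have hs1 : HasCompactSupport (fun x => 2 * θ x ^ 2) :=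
    hθ.2.mono fun x hx h0 => hx (by simp [h0])
  have hs2 : HasCompactSupport (fun x => 2 * (‖gradient θ x‖ ^ 2 / q x)) :=
    hθ.hasCompactSupport_gradient.mono fun x hx h0 => hx (by simp [h0])
  obtain ⟨A1, hA1⟩ := hs1.exists_bound_of_continuous hc1
  obtain ⟨A2, hA2⟩ := hs2.exists_bound_of_continuous hc2
  refine ⟨max A1 A2, fun φ hφ => ?_⟩
  rw [eLpNorm_two_sq, eLpNorm_wm_sq hq.measurable, ← lintegral_add_left
    (hφ.continuous_gradient.enorm.measurable.pow_const 2), ← lintegral_const_mul' _ _ (by simp)]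
  refine lintegral_mono fun x => ?_
  have hA0 : 0 ≤ max A1 A2 := (norm_nonneg _).trans ((hA1 x).trans (le_max_left _ _))
  simp only [enorm_sq_eq_ofReal]
  rw [← ENNReal.ofReal_mul (hq0 x).le, ← ENNReal.ofReal_add (by positivity)
    (mul_nonneg (hq0 x).le (by positivity)), ← ENNReal.ofReal_mul hA0]
  refine ENNReal.ofReal_le_ofReal ?_
  rw [gradient_fun_mul (hθ.differentiable x) (hφ.differentiable x)]
  have h1 := (le_abs_self _).trans ((hA1 x).trans (le_max_left A1 A2))
  have h2 := (le_abs_self _).trans ((hA2 x).trans (le_max_right A1 A2))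
  have h3 : 2 * ‖gradient θ x‖ ^ 2 ≤ max A1 A2 * q x := by
    have := mul_le_mul_of_nonneg_right h2 (hq0 x).le
    rwa [mul_assoc, div_mul_cancel₀ _ (hq0 x).ne'] at this
  have h4 : ‖θ x • gradient φ x + φ x • gradient θ x‖
      ≤ |θ x| * ‖gradient φ x‖ + |φ x| * ‖gradient θ x‖ := by
    refine (norm_add_le _ _).trans_eq ?_
    rw [norm_smul, norm_smul, Real.norm_eq_abs, Real.norm_eq_abs]
  have h5 := pow_le_pow_left₀ (norm_nonneg _) h4 2
  have h6 := mul_le_mul_of_nonneg_right h1 (sq_nonneg ‖gradient φ x‖)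
  have h7 := mul_le_mul_of_nonneg_right h3 (sq_nonneg (φ x))
  rw [Real.norm_eq_abs, sq_abs]
  have e1 : (|θ x| * ‖gradient φ x‖) ^ 2 = θ x ^ 2 * ‖gradient φ x‖ ^ 2 := by rw [mul_pow, sq_abs]
  have e2 : (|φ x| * ‖gradient θ x‖) ^ 2 = φ x ^ 2 * ‖gradient θ x‖ ^ 2 := by rw [mul_pow, sq_abs]
  nlinarith [sq_nonneg (|θ x| * ‖gradient φ x‖ - |φ x| * ‖gradient θ x‖)]

/-- The averages at a fixed scale of a weakly convergent sequence converge strongly, locally. -/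
lemma tendsto_lintegral_mollify_sub {q : E N → ℝ} (hq : Continuous q) (hq0 : ∀ x, 0 < q x)
    {φ : ℕ → E N → ℝ} (hφ : ∀ n, IsTest (φ n)) {M : ℝ≥0∞} (hM : M ≠ ⊤)
    (hφM : ∀ n, eLpNorm (φ n) 2 (wm q) ≤ M)
    (hw : ∀ h : E N → ℝ, IsTest h → ∃ l, Tendsto (fun n => ∫ x, √(q x) * φ n x * ((√(q x))⁻¹ * h x))
      atTop (𝓝 l)) {θ : E N → ℝ} (hθ : IsTest θ) (j : ℕ) :
    Tendsto (fun p : ℕ × ℕ => ∫⁻ x, ‖mollify (mollifier N j) (fun y => θ y * φ p.1 y) x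
      - mollify (mollifier N j) (fun y => θ y * φ p.2 y) x‖ₑ ^ 2) (atTop ×ˢ atTop) (𝓝 0) := by
  set ρ := mollifier N j with hρdef
  have hρ : IsTest ρ := isTest_mollifier j
  set v : ℕ → E N → ℝ := fun n y => θ y * φ n y with hv
  have hvt : ∀ n, IsTest (v n) := fun n => (hφ n).mul_left hθ.1
  obtain ⟨R, hR⟩ := hθ.2.isCompact.isBounded.subset_closedBall 0
  have hR0 : ∀ n x, R < ‖x‖ → v n x = 0 := fun n x hx => by
    have : θ x = 0 := by
      by_contra h0
      have := hR (subset_tsupport _ h0)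
      rw [mem_closedBall_zero_iff] at this
      linarith
    simp [hv, this]
  obtain ⟨B, hB⟩ := hρ.2.exists_bound_of_continuous hρ.continuous
  set D : ℝ≥0∞ := ENNReal.ofReal B * (M * (∫⁻ x, ‖(q x)⁻¹ * θ x ^ 2‖ₑ) ^ (1 / 2 : ℝ)) with hD
  have hDtop : D < ⊤ := ENNReal.mul_lt_top ENNReal.ofReal_lt_top
    (ENNReal.mul_lt_top hM.lt_top (lintegral_inv_mul_sq_lt_top hq hq0 hθ.continuous hθ.2))
  have hbd : ∀ n x, ‖mollify ρ (v n) x‖ₑ ≤ D := by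
    intro n x
    rw [mollify_eq_swap]
    refine (enorm_integral_le_lintegral_enorm _).trans ?_
    calc ∫⁻ y, ‖ρ (x - y) • v n y‖ₑ
        ≤ ∫⁻ y, ENNReal.ofReal B * (‖φ n y‖ₑ * ‖θ y‖ₑ) := by
          refine lintegral_mono fun y => ?_
          rw [enorm_smul, hv]
          simp only [enorm_mul]
          rw [mul_comm ‖θ y‖ₑ]
          gcongr
          rw [← ofReal_norm]
          exact ENNReal.ofReal_le_ofReal (hB _)
      _ ≤ D := by
          rw [lintegral_const_mul' _ _ (by simp), hD]
          gcongr
          refine (lintegral_mul_le_eLpNorm_wm hq hq0 (hφ n).continuous.aestronglyMeasurable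
            hθ.continuous).trans ?_
          gcongr
          exact hφM n
  have hsupp : ∀ n x, x ∉ Metric.closedBall (0 : E N) (R + 2) → mollify ρ (v n) x = 0 :=
    fun n x hx => mollify_mollifier_eq_zero (hR0 n) j (by simpa using hx)
  have hpt : ∀ x, ∃ l, Tendsto (fun n => mollify ρ (v n) x) atTop (𝓝 l) := by
    intro x
    obtain ⟨l, hl⟩ := hw (fun y => ρ (x - y) * θ y) (hθ.mul_left (hρ.comp_sub_left x).1)
    refine ⟨l, hl.congr fun n => ?_⟩
    rw [mollify_eq_swap]
    refine integral_congr_ae (.of_forall fun y => ?_)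
    have := (Real.sqrt_pos.2 (hq0 y)).ne'
    simp only [hv, smul_eq_mul]
    field_simp
  have hz : (0 : ℝ≥0∞) = ∫⁻ _ : E N, 0 := by simp
  rw [hz]
  refine tendsto_lintegral_filter_of_dominated_convergence
    ((Metric.closedBall (0 : E N) (R + 2)).indicator fun _ => (D + D) ^ 2) ?_ ?_ ?_ ?_
  · refine .of_forall fun p => ?_
    have c1 := (isTest_mollify hρ (hvt p.1).continuous.locallyIntegrable (hvt p.1).2).continuous
    have c2 := (isTest_mollify hρ (hvt p.2).continuous.locallyIntegrable (hvt p.2).2).continuous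
    exact ((c1.sub c2).enorm.measurable).pow_const 2
  · refine .of_forall fun p => .of_forall fun x => ?_
    by_cases hx : x ∈ Metric.closedBall (0 : E N) (R + 2)
    · rw [indicator_of_mem hx]
      gcongr
      exact (enorm_sub_le).trans (add_le_add (hbd _ x) (hbd _ x))
    · rw [hsupp _ x hx, hsupp _ x hx]; simp
  · rw [lintegral_indicator measurableSet_closedBall, setLIntegral_const]
    exact (ENNReal.mul_lt_top (by finiteness) measure_closedBall_lt_top).ne
  · refine .of_forall fun x => ?_
    obtain ⟨l, hl⟩ := hpt x
    have h1 : Tendsto (fun p : ℕ × ℕ => mollify ρ (v p.1) x - mollify ρ (v p.2) x)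
        (atTop ×ˢ atTop) (𝓝 (l - l)) := (hl.comp tendsto_fst).sub (hl.comp tendsto_snd)
    have h2 := ((ENNReal.continuous_pow 2).tendsto _).comp ((continuous_enorm.tendsto _).comp h1)
    simpa [Function.comp_def] using h2

/-- Rellich's theorem: sequences bounded in `H¹`, locally, have subsequences that are Cauchy in
`L²`, locally. -/
lemma exists_subseq_tendsto_local {q : E N → ℝ} (hq : Continuous q) (hq0 : ∀ x, 0 < q x)
    {φ : ℕ → E N → ℝ} (hφ : ∀ n, IsTest (φ n)) {M : ℝ≥0∞} (hM : M ≠ ⊤)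
    (hφM : ∀ n, eLpNorm (φ n) 2 (wm q) ≤ M) (hgM : ∀ n, eLpNorm (gradient (φ n)) 2 volume ≤ M) :
    ∃ σ : ℕ → ℕ, StrictMono σ ∧ ∀ θ, IsTest θ →
      Tendsto (fun p : ℕ × ℕ => ∫⁻ x, ‖θ x * φ (σ p.1) x - θ x * φ (σ p.2) x‖ₑ ^ 2)
        (atTop ×ˢ atTop) (𝓝 0) := by
  have hf : ∀ n, MemLp (fun x => √(q x) * φ n x) 2 volume := fun n =>
    ((hq.sqrt).mul (hφ n).continuous).memLp_of_hasCompactSupport (hφ n).2.mul_left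
  have hfM : ∀ n, ‖(hf n).toLp‖ ≤ M.toReal := fun n => by
    rw [Lp.norm_toLp, eLpNorm_sqrt_mul hq hq0]
    exact ENNReal.toReal_mono hM (hφM n)
  have : Fact ((2 : ℝ≥0∞) ≠ ⊤) := ⟨by simp⟩
  obtain ⟨σ, hσ, f₀, hf₀⟩ := exists_subseq_tendsto_inner hfM
  refine ⟨σ, hσ, fun θ hθ => ?_⟩
  obtain ⟨A, hA⟩ := hθ.exists_lintegral_gradient_mul_le hq hq0
  set D : ℝ≥0∞ := ENNReal.ofReal A * (M ^ 2 + M ^ 2) with hD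
  have hDtop : D ≠ ⊤ := by rw [hD]; finiteness
  have hvD : ∀ n, ∫⁻ x, ‖gradient (fun x => θ x * φ n x) x‖ₑ ^ 2 ≤ D := fun n =>
    (hA _ (hφ n)).trans (by rw [hD]; gcongr; exacts [hgM n, hφM n])
  have hw : ∀ h : E N → ℝ, IsTest h → ∃ l, Tendsto
      (fun n => ∫ x, √(q x) * φ (σ n) x * ((√(q x))⁻¹ * h x)) atTop (𝓝 l) := by
    intro h hh
    have hL : MemLp (fun x => (√(q x))⁻¹ * h x) 2 volume :=
      ((hq.sqrt.inv₀ fun x => (Real.sqrt_pos.2 (hq0 x)).ne').mul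
        hh.continuous).memLp_of_hasCompactSupport hh.2.mul_left
    refine ⟨_, (hf₀ hL.toLp).congr fun n => ?_⟩
    rw [L2.inner_def]
    refine integral_congr_ae ?_
    filter_upwards [hL.coeFn_toLp, (hf (σ n)).coeFn_toLp] with x h1 h2
    rw [h1, h2, inner_real_eq_mul]
  have hmol := fun j => tendsto_lintegral_mollify_sub hq hq0 (fun n => hφ (σ n)) hM
    (fun n => hφM (σ n)) hw hθ j
  have hr : Tendsto (fun j : ℕ => 6 * (ENNReal.ofReal (2 / ((j : ℝ) + 1)) ^ 2 * D)) atTop (𝓝 0) := by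
    have h1 := ((ENNReal.continuous_pow 2).tendsto _).comp
      ((ENNReal.continuous_ofReal.tendsto _).comp tendsto_two_div)
    have h2 := ENNReal.Tendsto.const_mul (a := 6) (ENNReal.Tendsto.mul_const h1 (.inr hDtop))
      (.inr (by norm_num))
    simpa using h2
  rw [ENNReal.tendsto_nhds_zero]
  intro η hη
  obtain ⟨j, hj⟩ := ((ENNReal.tendsto_nhds_zero.1 hr) (η / 2) (ENNReal.half_pos hη.ne')).exists
  have h3 := ENNReal.Tendsto.const_mul (a := 3) (hmol j) (.inr (by norm_num))
  rw [mul_zero] at h3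
  filter_upwards [(ENNReal.tendsto_nhds_zero.1 h3) (η / 2) (ENNReal.half_pos hη.ne')] with p hp
  set v : ℕ → E N → ℝ := fun n y => θ y * φ (σ n) y with hv
  have hvt : ∀ n, IsTest (v n) := fun n => (hφ _).mul_left hθ.1
  set m : ℕ → E N → ℝ := fun n => mollify (mollifier N j) (v n) with hm
  have hmt : ∀ n, IsTest (m n) := fun n => isTest_mollify (isTest_mollifier j)
    (hvt n).continuous.locallyIntegrable (hvt n).2
  have mm : ∀ {a b : E N → ℝ}, IsTest a → IsTest b → Measurable (fun x => ‖a x - b x‖ₑ ^ 2) :=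
    fun ha hb => ((ha.continuous.sub hb.continuous).enorm.measurable).pow_const 2
  have hvm : ∀ n, ∫⁻ x, ‖m n x - v n x‖ₑ ^ 2 ≤ ENNReal.ofReal (2 / ((j : ℝ) + 1)) ^ 2 * D :=
    fun n => ((hvt n).lintegral_mollify_sub_le j).trans (by gcongr; exact hvD _)
  calc ∫⁻ x, ‖v p.1 x - v p.2 x‖ₑ ^ 2
      ≤ ∫⁻ x, 3 * (‖m p.1 x - v p.1 x‖ₑ ^ 2 + ‖m p.1 x - m p.2 x‖ₑ ^ 2
          + ‖m p.2 x - v p.2 x‖ₑ ^ 2) := lintegral_mono fun x => enorm_sub_sq_le_three _ _ _ _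
    _ = 3 * (∫⁻ x, ‖m p.1 x - v p.1 x‖ₑ ^ 2) + 3 * (∫⁻ x, ‖m p.1 x - m p.2 x‖ₑ ^ 2)
          + 3 * ∫⁻ x, ‖m p.2 x - v p.2 x‖ₑ ^ 2 := by
        rw [lintegral_const_mul' _ _ (by norm_num), lintegral_add_right _ (mm (hmt _) (hvt _)),
          lintegral_add_right _ (mm (hmt _) (hmt _))]
        ring
    _ ≤ 3 * (ENNReal.ofReal (2 / ((j : ℝ) + 1)) ^ 2 * D) + η / 2
          + 3 * (ENNReal.ofReal (2 / ((j : ℝ) + 1)) ^ 2 * D) := by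
        gcongr
        exacts [hvm _, hvm _]
    _ = 6 * (ENNReal.ofReal (2 / ((j : ℝ) + 1)) ^ 2 * D) + η / 2 := by ring
    _ ≤ η / 2 + η / 2 := by gcongr
    _ = η := ENNReal.add_halves η


/-! ### Compact embedding into weighted `L²` spaces -/

/-- Local compactness upgrades to compactness in `L²(W dx)` for weights `W` that are negligible
with respect to `q` at infinity. -/
lemma exists_subseq_tendsto_wm {q W : E N → ℝ} (hq : Continuous q) (hq0 : ∀ x, 0 < q x)
    {K : ℝ} (hK : ∀ x, W x ≤ K * q x)
    (htail : ∀ η : ℝ, 0 < η → ∃ R : ℝ, ∀ x, R < ‖x‖ → W x ≤ η * q x)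
    {φ : ℕ → E N → ℝ} (hφ : ∀ n, IsTest (φ n)) {M : ℝ≥0∞} (hM : M ≠ ⊤)
    (hφM : ∀ n, eLpNorm (φ n) 2 (wm q) ≤ M) (hgM : ∀ n, eLpNorm (gradient (φ n)) 2 volume ≤ M) :
    ∃ σ : ℕ → ℕ, StrictMono σ ∧
      Tendsto (fun p : ℕ × ℕ => ∫⁻ x, ENNReal.ofReal (W x) * ‖φ (σ p.1) x - φ (σ p.2) x‖ₑ ^ 2)
        (atTop ×ˢ atTop) (𝓝 0) := by
  obtain ⟨σ, hσ, hloc⟩ := exists_subseq_tendsto_local hq hq0 hφ hM hφM hgM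
  refine ⟨σ, hσ, ?_⟩
  rw [ENNReal.tendsto_nhds_zero]
  intro η hη
  have hMM : (M + M) ^ 2 ≠ ⊤ := by finiteness
  obtain ⟨t, ht0, ht⟩ : ∃ t : ℝ, 0 < t ∧ ENNReal.ofReal t * (M + M) ^ 2 ≤ η / 2 := by
    have h1 : Tendsto (fun t : ℝ => ENNReal.ofReal t * (M + M) ^ 2) (𝓝[>] 0) (𝓝 0) := by
      have := ENNReal.Tendsto.mul_const (b := (M + M) ^ 2)
        ((ENNReal.continuous_ofReal.tendsto 0).mono_left nhdsWithin_le_nhds) (.inr hMM)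
        (f := 𝓝[>] (0 : ℝ))
      simpa using this
    obtain ⟨t, h2, h3⟩ := (((ENNReal.tendsto_nhds_zero.1 h1) (η / 2)
      (ENNReal.half_pos hη.ne')).and self_mem_nhdsWithin).exists
    exact ⟨t, h3, h2⟩
  obtain ⟨R, hR⟩ := htail t ht0
  obtain ⟨θ, hθ, -, -, hθ1, -⟩ := exists_isTest_cutoff (isCompact_closedBall (0 : E N) R)
    isOpen_univ (subset_univ _)
  obtain ⟨Q, hQ⟩ := (isCompact_closedBall (0 : E N) R).exists_bound_of_continuousOn hq.continuousOn
  have h3 := ENNReal.Tendsto.const_mul (a := ENNReal.ofReal (|K| * Q)) (hloc θ hθ)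
    (.inr ENNReal.ofReal_ne_top)
  rw [mul_zero] at h3
  filter_upwards [(ENNReal.tendsto_nhds_zero.1 h3) (η / 2) (ENNReal.half_pos hη.ne')] with p hp
  have hsub : ∫⁻ x, ENNReal.ofReal (q x) * ‖φ (σ p.1) x - φ (σ p.2) x‖ₑ ^ 2 ≤ (M + M) ^ 2 := by
    rw [← eLpNorm_wm_sq hq.measurable (fun x => φ (σ p.1) x - φ (σ p.2) x)]
    gcongr
    exact (eLpNorm_sub_le (hφ _).continuous.aestronglyMeasurable
      (hφ _).continuous.aestronglyMeasurable (by norm_num)).trans (add_le_add (hφM _) (hφM _))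
  calc ∫⁻ x, ENNReal.ofReal (W x) * ‖φ (σ p.1) x - φ (σ p.2) x‖ₑ ^ 2
      ≤ ∫⁻ x, (ENNReal.ofReal t * (ENNReal.ofReal (q x) * ‖φ (σ p.1) x - φ (σ p.2) x‖ₑ ^ 2)
          + ENNReal.ofReal (|K| * Q) * ‖θ x * φ (σ p.1) x - θ x * φ (σ p.2) x‖ₑ ^ 2) := by
        refine lintegral_mono fun x => ?_
        rcases lt_or_ge R ‖x‖ with hx | hx
        · refine le_add_right ?_
          rw [← mul_assoc, ← ENNReal.ofReal_mul ht0.le]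
          gcongr
          exact hR x hx
        · refine le_add_left ?_
          have hx' : x ∈ Metric.closedBall (0 : E N) R := by simpa using hx
          rw [hθ1 x hx', one_mul, one_mul]
          gcongr
          refine (hK x).trans (mul_le_mul (le_abs_self K) ((le_abs_self _).trans (hQ x hx'))
            (hq0 x).le (abs_nonneg K))
    _ = ENNReal.ofReal t * (∫⁻ x, ENNReal.ofReal (q x) * ‖φ (σ p.1) x - φ (σ p.2) x‖ₑ ^ 2)
          + ENNReal.ofReal (|K| * Q) * ∫⁻ x, ‖θ x * φ (σ p.1) x - θ x * φ (σ p.2) x‖ₑ ^ 2 := by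
        rw [lintegral_add_right, lintegral_const_mul' _ _ ENNReal.ofReal_ne_top,
          lintegral_const_mul' _ _ ENNReal.ofReal_ne_top]
        have hc : Continuous (fun x => θ x * φ (σ p.1) x - θ x * φ (σ p.2) x) :=
          (hθ.continuous.mul (hφ _).continuous).sub (hθ.continuous.mul (hφ _).continuous)
        exact (hc.enorm.measurable.pow_const 2).const_mul _
    _ ≤ η / 2 + η / 2 := by
        gcongr
        refine le_trans ?_ ht
        gcongr
    _ = η := ENNReal.add_halves η

lemma eLpNorm_wm_le_of_le {q W : E N → ℝ} (hq : Continuous q) (hW : Continuous W) {K : ℝ}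
    (hK0 : 0 ≤ K) (hK : ∀ x, W x ≤ K * q x) (u : E N → ℝ) :
    eLpNorm u 2 (wm W) ^ 2 ≤ ENNReal.ofReal K * eLpNorm u 2 (wm q) ^ 2 := by
  rw [eLpNorm_wm_sq hW.measurable, eLpNorm_wm_sq hq.measurable,
    ← lintegral_const_mul' _ _ (by simp)]
  refine lintegral_mono fun x => ?_
  rw [← mul_assoc, ← ENNReal.ofReal_mul hK0]
  gcongr
  exact hK x

lemma energy_sqrt_le {V u : E N → ℝ} {g : E N → E N} {κ : ℝ} (hκ : 0 ≤ κ) (hV0 : ∀ x, 0 ≤ V x) :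
    energy (√κ) V u g ≤ ENNReal.ofReal (max κ 1) * energy 1 V u g := by
  rw [energy, energy, ← lintegral_const_mul' _ _ (by simp)]
  refine lintegral_mono fun x => ?_
  rw [← ENNReal.ofReal_mul (by positivity), Real.sq_sqrt hκ]
  refine ENNReal.ofReal_le_ofReal ?_
  have h1 := mul_le_mul_of_nonneg_right (le_max_left κ 1) (sq_nonneg ‖g x‖)
  have h2 := mul_le_mul_of_nonneg_right (le_max_right κ 1) (mul_nonneg (hV0 x) (sq_nonneg (u x)))
  linarith

lemma MemH1V.energy_lt_top {V u : E N → ℝ} {g : E N → E N} (h : MemH1V V u g) (hV : Continuous V)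
    (hV0 : ∀ x, 0 ≤ V x) : energy 1 V u g < ⊤ := by
  obtain ⟨⟨hu, hg, -⟩, φ, hφ, hE⟩ := h
  have hum := hu.aestronglyMeasurable
  have hgm := hg.aestronglyMeasurable
  obtain ⟨hA, hB⟩ := (tendsto_energy_zero_iff (u := fun n x => φ n x - u x) one_pos hV
    hV0 fun n => (hφ n).continuous.aestronglyMeasurable.sub hum).1 hE
  obtain ⟨n, hn1, hn2⟩ := ((hA.eventually_lt_const ENNReal.zero_lt_top).and
    (hB.eventually_lt_const ENNReal.zero_lt_top)).exists
  have e1 : eLpNorm g 2 volume < ⊤ := by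
    have := ((hφ n).memLp_gradient 2).sub
      (⟨(hφ n).continuous_gradient.aestronglyMeasurable.sub hgm, hn1⟩ :
        MemLp (fun x => gradient (φ n) x - g x) 2 volume)
    simpa [Pi.sub_def] using this.2
  have e2 : eLpNorm u 2 (wm V) < ⊤ := by
    have hm : MemLp (φ n) 2 (wm V) := by
      refine ⟨(hφ n).continuous.aestronglyMeasurable, ?_⟩
      have := (hφ n).eLpNorm_wm_sq_eq_ofReal hV hV0
      by_contra hcon
      rw [not_lt, top_le_iff] at hcon
      simp [hcon] at this
    have := hm.sub (⟨((hφ n).continuous.aestronglyMeasurable.sub hum).mono_ac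
      (withDensity_absolutelyContinuous _ _), hn2⟩ : MemLp (fun x => φ n x - u x) 2 (wm V))
    simpa [Pi.sub_def] using this.2
  rw [energy_eq hV hV0 hum]
  finiteness

lemma MemH1V.memLp_grad {V u : E N → ℝ} {g : E N → E N} (h : MemH1V V u g) (hV : Continuous V)
    (hV0 : ∀ x, 0 ≤ V x) : MemLp g 2 volume := by
  refine ⟨h.1.2.1.aestronglyMeasurable, ?_⟩
  have h1 := h.energy_lt_top hV hV0
  by_contra hcon
  rw [not_lt, top_le_iff] at hcon
  rw [energy_eq hV hV0 h.1.1.aestronglyMeasurable, hcon] at h1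
  simp at h1

namespace IsBarrier

variable {V q w : E N → ℝ} {d κ : ℝ}

lemma hardy_le_energy (C : IsBarrier V d κ q w) {u : E N → ℝ} {g : E N → E N}
    (h : MemH1V V u g) :
    eLpNorm u 2 (wm q) ^ 2 ≤ ENNReal.ofReal (max κ 1) * energy 1 V u g :=
  (le_mul_of_one_le_left zero_le (by norm_num)).trans
    ((C.hardy h).trans (energy_sqrt_le C.κ_pos.le C.V_nonneg))

/-- Test functions close to an element of `H¹_V` in all the norms in use. -/
lemma exists_test_near (C : IsBarrier V d κ q w) {u : E N → ℝ} {g : E N → E N}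
    (h : MemH1V V u g) {η : ℝ≥0∞} (hη : 0 < η) :
    ∃ φ, IsTest φ ∧ eLpNorm (fun x => φ x - u x) 2 (wm q) ≤ η ∧
      eLpNorm (fun x => gradient φ x - g x) 2 volume ≤ η := by
  obtain ⟨hu, φ, hφ, hE⟩ := h
  obtain ⟨hA, -⟩ := (tendsto_energy_zero_iff (u := fun n x => φ n x - u x) one_pos C.V_cont
    C.V_nonneg fun n => (hφ n).continuous.aestronglyMeasurable.sub hu.1.aestronglyMeasurable).1 hE
  obtain ⟨n, h1, h2⟩ := ((ENNReal.tendsto_nhds_zero.1 (C.tendsto_wm hu hφ hE) η hη).and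
    (ENNReal.tendsto_nhds_zero.1 hA η hη)).exists
  exact ⟨φ n, hφ n, h1, h2⟩

/-- Condition `(H₁)` holds when the weight `H² |x|^α + χ_Λ` is bounded by a continuous function
that is negligible with respect to `q` at infinity. -/
lemma conditionH1 (C : IsBarrier V d κ q w) {W : E N → ℝ} (hW : Continuous W) {K : ℝ}
    (hK0 : 0 ≤ K) (hK : ∀ x, W x ≤ K * q x)
    (htail : ∀ η : ℝ, 0 < η → ∃ R : ℝ, ∀ x, R < ‖x‖ → W x ≤ η * q x) {α : ℝ} {Λ : Set (E N)}
    {H : E N → ℝ} (hH : ∀ x, H x ^ 2 * ‖x‖ ^ α + Λ.indicator (fun _ => (1 : ℝ)) x ≤ W x) :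
    ConditionH1 α V Λ H := by
  have hle : penaltyMeasure α Λ H ≤ wm W :=
    withDensity_mono (.of_forall fun x => ENNReal.ofReal_le_ofReal (hH x))
  have hacq : ∀ ϖ : E N → ℝ, wm ϖ ≪ volume := fun _ => withDensity_absolutelyContinuous _ _
  have hW2 : ∀ u : E N → ℝ, eLpNorm u 2 (wm W) ^ 2 ≤ ENNReal.ofReal K * eLpNorm u 2 (wm q) ^ 2 :=
    eLpNorm_wm_le_of_le C.q_cont hW hK0 hK
  have hsqrt : ∀ u : E N → ℝ, eLpNorm u 2 (wm W) ≤ ENNReal.ofReal (√K) * eLpNorm u 2 (wm q) := by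
    intro u
    rw [← ENNReal.pow_le_pow_left_iff two_ne_zero, mul_pow,
      ← ENNReal.ofReal_pow (Real.sqrt_nonneg _), Real.sq_sqrt hK0]
    exact hW2 u
  refine ⟨⟨K * max κ 1, by positivity, fun u g h => ?_⟩, fun u g h hbd => ?_⟩
  · have h1 : eLpNorm u 2 (penaltyMeasure α Λ H) ^ 2
        ≤ ENNReal.ofReal (K * max κ 1) * energy 1 V u g := by
      calc eLpNorm u 2 (penaltyMeasure α Λ H) ^ 2 ≤ eLpNorm u 2 (wm W) ^ 2 := by
            gcongr
        _ ≤ ENNReal.ofReal K * (ENNReal.ofReal (max κ 1) * energy 1 V u g) :=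
            (hW2 u).trans (by gcongr; exact C.hardy_le_energy h)
        _ = _ := by rw [← mul_assoc, ← ENNReal.ofReal_mul hK0]
    refine ⟨⟨h.1.1.aestronglyMeasurable.mono_ac
      ((Measure.absolutelyContinuous_of_le hle).trans (hacq W)), ?_⟩, h1⟩
    have hfin := h.energy_lt_top C.V_cont C.V_nonneg
    by_contra hcon
    rw [not_lt, top_le_iff] at hcon
    rw [hcon, ENNReal.top_pow two_ne_zero] at h1
    exact absurd h1 (not_le.2 (ENNReal.mul_lt_top ENNReal.ofReal_lt_top hfin))
  · obtain ⟨M, hM⟩ := hbd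
    set r : ℕ → ℝ≥0∞ := fun n => ENNReal.ofReal (1 / ((n : ℝ) + 1)) with hr
    have hr0 : ∀ n, 0 < r n := fun n => ENNReal.ofReal_pos.2 (by positivity)
    have hr1 : ∀ n, r n ≤ 1 := fun n => by
      rw [hr, ← ENNReal.ofReal_one]
      refine ENNReal.ofReal_le_ofReal ((div_le_one (by positivity)).2 ?_)
      linarith [(Nat.cast_nonneg n : (0 : ℝ) ≤ n)]
    have hrt : Tendsto r atTop (𝓝 0) := by
      have := (ENNReal.continuous_ofReal.tendsto 0).comp
        (tendsto_one_div_add_atTop_nhds_zero_nat (𝕜 := ℝ))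
      rwa [ENNReal.ofReal_zero] at this
    choose φ hφ hφq hφg using fun n => C.exists_test_near (h n) (hr0 n)
    have hum : ∀ n, AEStronglyMeasurable (u n) volume := fun n => (h n).1.1.aestronglyMeasurable
    have hgm : ∀ n, AEStronglyMeasurable (g n) volume := fun n => (h n).1.2.1.aestronglyMeasurable
    set B : ℝ≥0∞ := ENNReal.ofReal (max κ 1) * ENNReal.ofReal M with hB
    have b1 : ∀ a : ℝ≥0∞, a ^ 2 ≤ B → a ≤ B ^ (1 / 2 : ℝ) := fun a ha => by
      rwa [← ENNReal.pow_le_pow_left_iff two_ne_zero, rpow_half_sq]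
    have uq : ∀ n, eLpNorm (u n) 2 (wm q) ≤ B ^ (1 / 2 : ℝ) := fun n =>
      b1 _ ((C.hardy_le_energy (h n)).trans (by rw [hB]; gcongr; exact hM n))
    have gq : ∀ n, eLpNorm (g n) 2 volume ≤ B ^ (1 / 2 : ℝ) := fun n => by
      refine b1 _ (le_trans ?_ (le_trans (hM n) ?_))
      · rw [energy_eq C.V_cont C.V_nonneg (hum n)]
        simp
      · rw [hB]
        exact le_mul_of_one_le_left zero_le (by simp)
    set D : ℝ≥0∞ := B ^ (1 / 2 : ℝ) + 1 with hD
    have hDt : D ≠ ⊤ := by rw [hD, hB]; finiteness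
    have φq : ∀ n, eLpNorm (φ n) 2 (wm q) ≤ D := fun n => by
      have := eLpNorm_add_le ((hum n).mono_ac (hacq q))
        ((((hφ n).continuous.aestronglyMeasurable).sub (hum n)).mono_ac (hacq q))
        (by norm_num : (1 : ℝ≥0∞) ≤ 2)
      rw [add_sub_cancel] at this
      exact this.trans (add_le_add (uq n) ((hφq n).trans (hr1 n)))
    have φg : ∀ n, eLpNorm (gradient (φ n)) 2 volume ≤ D := fun n => by
      have := eLpNorm_add_le (hgm n) (((hφ n).continuous_gradient.aestronglyMeasurable).sub (hgm n))
        (by norm_num : (1 : ℝ≥0∞) ≤ 2)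
      rw [add_sub_cancel] at this
      exact this.trans (add_le_add (gq n) ((hφg n).trans (hr1 n)))
    obtain ⟨σ, hσ, hc⟩ := exists_subseq_tendsto_wm C.q_cont C.q_pos hK htail hφ hDt φq φg
    have hc' : Tendsto (fun p : ℕ × ℕ => eLpNorm (fun x => φ (σ p.1) x - φ (σ p.2) x) 2 (wm W))
        (atTop ×ˢ atTop) (𝓝 0) := by
      rw [← tendsto_pow_two_zero_iff]
      simpa only [eLpNorm_wm_sq hW.measurable] using hc
    have hmem : ∀ n, MemLp (φ (σ n)) 2 (wm W) := fun n =>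
      ⟨(hφ _).continuous.aestronglyMeasurable, (hsqrt _).trans_lt
        (ENNReal.mul_lt_top ENNReal.ofReal_lt_top ((φq _).trans_lt hDt.lt_top))⟩
    obtain ⟨v, hv, hlim⟩ := exists_tendsto_eLpNorm hmem (by
      intro η hη
      have := hc'.eventually_lt_const hη
      rw [prod_atTop_atTop_eq, eventually_atTop] at this
      obtain ⟨⟨a, b⟩, hab⟩ := this
      exact ⟨max a b, fun m hm n hn => hab (m, n)
        ⟨(le_max_left _ _).trans hm, (le_max_right _ _).trans hn⟩⟩)
    refine ⟨σ, v, hσ, hv.mono_measure hle, ?_⟩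
    have hsum := (ENNReal.Tendsto.const_mul (a := ENNReal.ofReal (√K)) (hrt.comp hσ.tendsto_atTop)
      (.inr (by simp))).add hlim
    rw [mul_zero, add_zero] at hsum
    refine tendsto_of_tendsto_of_tendsto_of_le_of_le tendsto_const_nhds hsum (fun _ => zero_le)
      fun n => (eLpNorm_mono_measure _ hle).trans ?_
    have h1 := eLpNorm_sub_le (μ := wm W) ((hφ (σ n)).continuous.aestronglyMeasurable.sub hv.1)
      ((((hφ (σ n)).continuous.aestronglyMeasurable).sub (hum (σ n))).mono_ac (hacq W))
      (by norm_num : (1 : ℝ≥0∞) ≤ 2)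
    have e : (fun x => u (σ n) x - v x) = (φ (σ n) - v) - (φ (σ n) - u (σ n)) := by
      ext x; simp
    rw [e]
    refine h1.trans ?_
    rw [add_comm]
    exact add_le_add ((hsqrt _).trans (by gcongr; exact hφq _)) le_rfl

end IsBarrier

/-! ### Decay of Riesz potentials -/

/-- The constant of the Riesz kernel: `I_α(x) = rieszConst N α * |x|^{-(N - α)}`. -/
noncomputable def rieszConst (N : ℕ) (α : ℝ) : ℝ :=
  Real.Gamma (((N : ℝ) - α) / 2) / (Real.Gamma (α / 2) * Real.pi ^ ((N : ℝ) / 2) * 2 ^ α)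

lemma rieszConst_pos {α : ℝ} (hα : 0 < α) (hαN : α < N) : 0 < rieszConst N α := by
  have h1 := Real.Gamma_pos_of_pos (show 0 < ((N : ℝ) - α) / 2 by linarith)
  have h2 := Real.Gamma_pos_of_pos (show 0 < α / 2 by linarith)
  unfold rieszConst
  positivity

lemma rieszKernel_eq (α : ℝ) (x : E N) :
    rieszKernel α x = rieszConst N α * ‖x‖ ^ (-((N : ℝ) - α)) := by
  rw [rieszKernel, rieszConst, Real.rpow_neg (norm_nonneg x), ← div_eq_mul_inv, div_div]

lemma lintegral_ball_rpow {α : ℝ} (hα : 0 < α) (hαN : α < N) :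
    ∃ B : ℝ, 0 ≤ B ∧ ∀ r : ℝ, 0 < r →
      ∫⁻ x in Metric.ball (0 : E N) r, ENNReal.ofReal (‖x‖ ^ (-((N : ℝ) - α)))
        = ENNReal.ofReal (B * r ^ α) := by
  have hN : 1 ≤ N := by
    rcases Nat.eq_zero_or_pos N with h | h
    · subst h; simp at hαN; linarith
    · exact h
  have hint : ∀ r : ℝ, IntegrableOn (fun x : E N => ‖x‖ ^ (-((N : ℝ) - α)))
      (Metric.ball (0 : E N) r) volume := fun r => by
    refine integrableOn_ball_of_norm_le_rpow (C := 1) (α := (N : ℝ) - α) (by simpa using hN)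
      (by simpa using hα) (.of_forall fun x => ?_)
      (Measurable.aestronglyMeasurable (by fun_prop))
    rw [one_mul, Real.norm_of_nonneg (by positivity)]
  refine ⟨∫ x in Metric.ball (0 : E N) 1, ‖x‖ ^ (-((N : ℝ) - α)),
    integral_nonneg fun x => by positivity, fun r hr => ?_⟩
  rw [← ofReal_integral_eq_lintegral_ofReal (hint r) (.of_forall fun x => by positivity)]
  congr 1
  have h1 := Measure.setIntegral_comp_smul_of_pos (volume : Measure (E N))
    (fun x : E N => ‖x‖ ^ (-((N : ℝ) - α))) (Metric.ball 0 1) hr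
  rw [smul_unitBall_of_pos hr] at h1
  simp only [norm_smul, Real.norm_of_nonneg hr.le, Real.mul_rpow hr.le (norm_nonneg _),
    finrank_euclideanSpace, Fintype.card_fin, smul_eq_mul] at h1
  rw [integral_const_mul] at h1
  have h2 : r ^ N ≠ 0 := by positivity
  rw [eq_inv_mul_iff_mul_eq₀ h2] at h1
  rw [← h1, ← mul_assoc, ← Real.rpow_natCast, ← Real.rpow_add hr, mul_comm]
  congr 2
  ring

/-- The Riesz potential of a function decaying like `|y|^{-s}` decays like `|x|^{-γ}` for every
`γ < s - α`, `γ ≤ N - α`: far from `x` the kernel is split between the decay in `x` and the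
integrability in `y`, and near `x` the function is as small as it is at `x`. -/
lemma exists_rieszPotential_le {α s γ : ℝ} (hα : 0 < α) (hαN : α < N) (hγ0 : 0 ≤ γ)
    (hγN : γ ≤ N - α) (hγs : γ < s - α) :
    ∃ C : ℝ, 0 ≤ C ∧ ∀ x : E N, rieszPotential α (fun y => (1 + ‖y‖) ^ (-s)) x
      ≤ ENNReal.ofReal (C * (1 + ‖x‖) ^ (-γ)) := by
  obtain ⟨B, hB0, hB⟩ := lintegral_ball_rpow (N := N) hα hαN
  set A := rieszConst N α with hA
  have hA0 : 0 < A := rieszConst_pos hα hαN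
  set k : ℝ := (N : ℝ) - α with hk
  have hs : 0 < s := by linarith
  have hint : Integrable (fun y : E N => (1 + ‖y‖) ^ (-(k - γ + s))) volume :=
    integrable_one_add_norm (by rw [finrank_euclideanSpace, Fintype.card_fin]; linarith)
  set I := ∫ y : E N, (1 + ‖y‖) ^ (-(k - γ + s)) with hI
  have hI0 : 0 ≤ I := integral_nonneg fun y => by positivity
  set C1 : ℝ := A * (4 ^ γ * 5 ^ (k - γ)) with hC1
  set C2 : ℝ := A * 4 ^ s with hC2
  refine ⟨C1 * I + C2 * B, by positivity, fun x => ?_⟩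
  set t := 1 + ‖x‖ with ht
  have ht1 : 1 ≤ t := by rw [ht]; linarith [norm_nonneg x]
  have ht0 : 0 < t := by linarith
  have hfar : ∀ y : E N, t / 4 ≤ ‖x - y‖ →
      rieszKernel α (x - y) * (1 + ‖y‖) ^ (-s) ≤ C1 * t ^ (-γ) * (1 + ‖y‖) ^ (-(k - γ + s)) := by
    intro y hy
    have hD : 0 < ‖x - y‖ := by linarith
    have h5 : (1 + ‖y‖) / 5 ≤ ‖x - y‖ := by
      have := norm_sub_norm_le y x
      rw [norm_sub_rev] at this
      rw [div_le_iff₀ (by norm_num)]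
      linarith
    have hy0 : 0 < 1 + ‖y‖ := by positivity
    have e1 : ‖x - y‖ ^ (-k) ≤ (t / 4) ^ (-γ) * ((1 + ‖y‖) / 5) ^ (-(k - γ)) := by
      rw [show -k = -γ + -(k - γ) by ring, Real.rpow_add hD]
      exact mul_le_mul (Real.rpow_le_rpow_of_nonpos (by positivity) hy (by linarith))
        (Real.rpow_le_rpow_of_nonpos (by positivity) h5 (by linarith)) (by positivity)
        (by positivity)
    rw [Real.div_rpow ht0.le (by norm_num), Real.div_rpow hy0.le (by norm_num),
      Real.rpow_neg (by norm_num : (0 : ℝ) ≤ 4), Real.rpow_neg (by norm_num : (0 : ℝ) ≤ 5),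
      div_inv_eq_mul, div_inv_eq_mul] at e1
    rw [rieszKernel_eq, neg_add, Real.rpow_add hy0, ← hA]
    calc A * ‖x - y‖ ^ (-k) * (1 + ‖y‖) ^ (-s)
        ≤ A * (t ^ (-γ) * 4 ^ γ * ((1 + ‖y‖) ^ (-(k - γ)) * 5 ^ (k - γ))) * (1 + ‖y‖) ^ (-s) := by
          gcongr
      _ = _ := by rw [hC1]; ring
  have hnear : ∀ y : E N, ‖x - y‖ < t / 4 →
      rieszKernel α (x - y) * (1 + ‖y‖) ^ (-s) ≤ C2 * t ^ (-s) * ‖x - y‖ ^ (-k) := by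
    intro y hy
    have h4 : t / 4 ≤ 1 + ‖y‖ := by
      have := norm_sub_norm_le x y
      linarith
    have e1 : (1 + ‖y‖) ^ (-s) ≤ t ^ (-s) * 4 ^ s := by
      have := Real.rpow_le_rpow_of_nonpos (by positivity) h4 (show -s ≤ 0 by linarith)
      rwa [Real.div_rpow ht0.le (by norm_num), Real.rpow_neg (by norm_num : (0 : ℝ) ≤ 4),
        div_inv_eq_mul] at this
    rw [rieszKernel_eq, ← hA]
    calc A * ‖x - y‖ ^ (-k) * (1 + ‖y‖) ^ (-s) ≤ A * ‖x - y‖ ^ (-k) * (t ^ (-s) * 4 ^ s) := by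
          gcongr
      _ = _ := by rw [hC2]; ring
  have hkn : ∀ z : E N, 0 ≤ rieszKernel α z := fun z => by rw [rieszKernel_eq, ← hA]; positivity
  have hmeas : Measurable (fun y : E N => ENNReal.ofReal (C1 * t ^ (-γ) * (1 + ‖y‖) ^ (-(k - γ + s)))) := by
    fun_prop
  have hball : ∫⁻ y, (Metric.ball (0 : E N) (t / 4)).indicator
      (fun z => ENNReal.ofReal (‖z‖ ^ (-k))) (x - y) = ENNReal.ofReal (B * (t / 4) ^ α) := by
    rw [lintegral_sub_left_eq_self (fun z => (Metric.ball (0 : E N) (t / 4)).indicator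
      (fun z => ENNReal.ofReal (‖z‖ ^ (-k))) z) x, lintegral_indicator measurableSet_ball, ← hB _ (by positivity)]
  calc rieszPotential α (fun y => (1 + ‖y‖) ^ (-s)) x
      ≤ ∫⁻ y, (ENNReal.ofReal (C1 * t ^ (-γ) * (1 + ‖y‖) ^ (-(k - γ + s)))
          + ENNReal.ofReal (C2 * t ^ (-s)) * (Metric.ball (0 : E N) (t / 4)).indicator
            (fun z => ENNReal.ofReal (‖z‖ ^ (-k))) (x - y)) := by
        refine lintegral_mono fun y => ?_
        rw [← ENNReal.ofReal_mul (hkn _)]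
        rcases le_or_gt (t / 4) ‖x - y‖ with hy | hy
        · exact le_add_right (ENNReal.ofReal_le_ofReal (hfar y hy))
        · refine le_add_left ?_
          rw [indicator_of_mem (by simpa using hy), ← ENNReal.ofReal_mul (by positivity)]
          exact ENNReal.ofReal_le_ofReal (hnear y hy)
    _ = ENNReal.ofReal (C1 * t ^ (-γ) * I) + ENNReal.ofReal (C2 * t ^ (-s) * (B * (t / 4) ^ α)) := by
        rw [lintegral_add_left hmeas, lintegral_const_mul' _ _ ENNReal.ofReal_ne_top, hball,
          ← ENNReal.ofReal_mul (by positivity), ← ofReal_integral_eq_lintegral_ofReal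
          (hint.const_mul _) (.of_forall fun y => by positivity), integral_const_mul]
    _ ≤ ENNReal.ofReal ((C1 * I + C2 * B) * t ^ (-γ)) := by
        rw [← ENNReal.ofReal_add (by positivity) (by positivity)]
        refine ENNReal.ofReal_le_ofReal ?_
        have e2 : t ^ (-s) * (t / 4) ^ α ≤ t ^ (-γ) := by
          calc t ^ (-s) * (t / 4) ^ α ≤ t ^ (-s) * t ^ α := by
                gcongr; linarith
            _ = t ^ (-s + α) := (Real.rpow_add ht0 _ _).symm
            _ ≤ t ^ (-γ) := Real.rpow_le_rpow_of_exponent_le ht1 (by linarith)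
        have := mul_le_mul_of_nonneg_left e2 (show 0 ≤ C2 * B by positivity)
        linarith

/-- Away from the origin, the Riesz kernel decays like `|x|^{-γ}` for every `γ ≤ N - α`. -/
lemma exists_rieszKernel_le {α γ r : ℝ} (hα : 0 < α) (hαN : α < N)
    (hγN : γ ≤ N - α) (hr : 0 < r) :
    ∃ C : ℝ, 0 ≤ C ∧ ∀ x : E N, r ≤ ‖x‖ → rieszKernel α x ≤ C * (1 + ‖x‖) ^ (-γ) := by
  set A := rieszConst N α with hA
  have hA0 : 0 < A := rieszConst_pos hα hαN
  set k : ℝ := (N : ℝ) - α with hk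
  refine ⟨A * (1 / r + 1) ^ k, by positivity, fun x hx => ?_⟩
  have hx0 : 0 < ‖x‖ := hr.trans_le hx
  have h1 : (1 + ‖x‖) / (1 / r + 1) ≤ ‖x‖ := by
    rw [div_le_iff₀ (by positivity)]
    have : 1 ≤ ‖x‖ * (1 / r) := by rw [mul_one_div, one_le_div hr]; exact hx
    linarith
  have h2 := Real.rpow_le_rpow_of_nonpos (by positivity) h1 (show -k ≤ 0 by rw [hk]; linarith)
  rw [Real.div_rpow (by positivity) (by positivity), Real.rpow_neg (by positivity : 0 ≤ 1 / r + 1),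
    div_inv_eq_mul] at h2
  have h3 : (1 + ‖x‖) ^ (-k) ≤ (1 + ‖x‖) ^ (-γ) :=
    Real.rpow_le_rpow_of_exponent_le (by linarith) (by linarith)
  rw [rieszKernel_eq, ← hA]
  calc A * ‖x‖ ^ (-k) ≤ A * ((1 + ‖x‖) ^ (-γ) * (1 / r + 1) ^ k) := by
        gcongr; exact h2.trans (by gcongr)
    _ = _ := by ring


/-! ### Power profiles -/

/-- The profile `(a + |x|²)^{-b}`. -/
noncomputable def powerProfile (a b : ℝ) (x : E N) : ℝ := (a + ‖x‖ ^ 2) ^ (-b)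

section powerProfile

variable {a b : ℝ}

lemma powerProfile_pos (ha : 1 ≤ a) (x : E N) : 0 < powerProfile a b x := by
  unfold powerProfile; positivity

lemma powerProfile_le_one (ha : 1 ≤ a) (hb : 0 ≤ b) (x : E N) : powerProfile a b x ≤ 1 :=
  Real.rpow_le_one_of_one_le_of_nonpos (by nlinarith [sq_nonneg ‖x‖]) (by linarith)

lemma contDiff_powerProfile (ha : 1 ≤ a) : ContDiff ℝ ∞ (powerProfile a b : E N → ℝ) :=
  (contDiff_const.add (contDiff_norm_sq ℝ)).rpow_const_of_ne fun x => by positivity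

lemma one_add_norm_sq_le (ha : 1 ≤ a) (x : E N) : (1 + ‖x‖) ^ 2 ≤ 2 * (a + ‖x‖ ^ 2) := by
  nlinarith [sq_nonneg (1 - ‖x‖)]

lemma powerProfile_le (ha : 1 ≤ a) (hb : 0 ≤ b) (x : E N) :
    powerProfile a b x ≤ 2 ^ b * (1 + ‖x‖) ^ (-(2 * b)) := by
  have h1 : (1 + ‖x‖) ^ 2 / 2 ≤ a + ‖x‖ ^ 2 := by have := one_add_norm_sq_le ha x; linarith
  have h2 := Real.rpow_le_rpow_of_nonpos (by positivity) h1 (show -b ≤ 0 by linarith)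
  rw [Real.div_rpow (by positivity) (by norm_num), Real.rpow_neg (by norm_num : (0 : ℝ) ≤ 2),
    div_inv_eq_mul] at h2
  have h3 : ((1 + ‖x‖) ^ 2) ^ (-b) = (1 + ‖x‖) ^ (-(2 * b)) := by
    rw [← Real.rpow_natCast, ← Real.rpow_mul (by positivity)]
    congr 1
    push_cast
    ring
  rw [h3] at h2
  rw [mul_comm]
  exact h2

lemma hasFDerivAt_add_norm_sq_rpow (ha : 1 ≤ a) (s : ℝ) (x : E N) :
    HasFDerivAt (fun y : E N => (a + ‖y‖ ^ 2) ^ s)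
      ((2 * s * (a + ‖x‖ ^ 2) ^ (s - 1)) • innerSL ℝ x) x := by
  have h1 : HasFDerivAt (fun y : E N => a + ‖y‖ ^ 2) (2 • innerSL ℝ x) x :=
    ((hasStrictFDerivAt_norm_sq x).hasFDerivAt).const_add a
  refine (h1.rpow_const (p := s) (.inl (by positivity))).congr_fderiv ?_
  ext v
  simp
  ring

lemma lap_powerProfile (ha : 1 ≤ a) (x : E N) :
    lap (powerProfile a b) x = - (2 * b * powerProfile a b x * ((a + ‖x‖ ^ 2) ^ 2)⁻¹
      * (N * a + (N - 2 - 2 * b) * ‖x‖ ^ 2)) := by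
  have h1 : ∀ i : Fin N, (fun y : E N => fderiv ℝ (powerProfile a b) y (stdVec i))
      = fun y => (-(2 * b)) * ((a + ‖y‖ ^ 2) ^ (-b - 1) * inner ℝ y (stdVec i)) := by
    intro i
    ext y
    have := (hasFDerivAt_add_norm_sq_rpow ha (-b) y).fderiv
    change fderiv ℝ (fun y : E N => (a + ‖y‖ ^ 2) ^ (-b)) y (stdVec i) = _
    rw [this]
    simp only [FunLike.coe_smul, Pi.smul_apply, innerSL_apply_apply, smul_eq_mul]
    ring
  have h2 : ∀ i : Fin N, fderiv ℝ (fun y : E N => fderiv ℝ (powerProfile a b) y (stdVec i)) x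
      (stdVec i) = (-(2 * b)) * ((a + ‖x‖ ^ 2) ^ (-b - 1)
        + 2 * (-b - 1) * (a + ‖x‖ ^ 2) ^ (-b - 1 - 1) * (x i) ^ 2) := by
    intro i
    rw [h1 i]
    have e1 := hasFDerivAt_add_norm_sq_rpow ha (-b - 1) x
    have e2 : HasFDerivAt (fun y : E N => inner ℝ y (stdVec i)) (innerSL ℝ (stdVec i)) x := by
      have := (innerSL ℝ (stdVec i : E N)).hasFDerivAt (x := x)
      refine this.congr_of_eventuallyEq (.of_forall fun y => ?_)
      simp only [innerSL_apply_apply]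
      exact real_inner_comm _ _
    rw [((e1.fun_mul e2).const_mul (-(2 * b))).fderiv]
    have h3 : inner ℝ (stdVec i : E N) (stdVec i) = 1 := by simp [stdVec]
    simp only [FunLike.coe_smul, add_apply, Pi.smul_apply, innerSL_apply_apply, smul_eq_mul, h3]
    rw [inner_stdVec]
    ring
  have hpos : 0 < a + ‖x‖ ^ 2 := by positivity
  unfold lap
  simp only [h2]
  have r1 : (a + ‖x‖ ^ 2) ^ (-b - 1) = (a + ‖x‖ ^ 2) ^ (-b) / (a + ‖x‖ ^ 2) :=
    Real.rpow_sub_one hpos.ne' _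
  have r2 : (a + ‖x‖ ^ 2) ^ (-b - 1 - 1) = (a + ‖x‖ ^ 2) ^ (-b) / (a + ‖x‖ ^ 2) / (a + ‖x‖ ^ 2) := by
    rw [Real.rpow_sub_one hpos.ne', r1]
  rw [← Finset.mul_sum, Finset.sum_add_distrib, ← Finset.mul_sum, Finset.sum_const,
    Finset.card_univ, Fintype.card_fin, nsmul_eq_mul, ← EuclideanSpace.real_norm_sq_eq,
    powerProfile, r2, r1]
  generalize (a + ‖x‖ ^ 2) ^ (-b) = u
  field_simp
  ring

lemma neg_lap_powerProfile_ge (hb : 0 ≤ b) (ha : 1 ≤ a) (x : E N) :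
    -(8 * b * (b + 1)) * ((1 + ‖x‖) ^ 2)⁻¹ * powerProfile a b x ≤ - lap (powerProfile a b) x := by
  rw [lap_powerProfile ha, neg_neg]
  have hpos : 0 < a + ‖x‖ ^ 2 := by positivity
  have h1 : -(2 * (b + 1)) * (a + ‖x‖ ^ 2) ≤ N * a + (N - 2 - 2 * b) * ‖x‖ ^ 2 := by
    have : (0 : ℝ) ≤ N := N.cast_nonneg
    nlinarith [mul_nonneg this (sq_nonneg ‖x‖), mul_nonneg this (by linarith : 0 ≤ a)]
  have h2 : (a + ‖x‖ ^ 2)⁻¹ ≤ 2 * ((1 + ‖x‖) ^ 2)⁻¹ := by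
    rw [inv_le_iff_one_le_mul₀ hpos, mul_assoc, mul_comm _ (a + ‖x‖ ^ 2), ← mul_assoc,
      ← div_eq_mul_inv, one_le_div (by positivity)]
    exact one_add_norm_sq_le ha x
  have hρ := powerProfile_pos (b := b) ha x
  set ρ := powerProfile a b x
  have h3 : 2 * b * ρ * ((a + ‖x‖ ^ 2) ^ 2)⁻¹ * (-(2 * (b + 1)) * (a + ‖x‖ ^ 2))
      = -(4 * b * (b + 1) * ρ * (a + ‖x‖ ^ 2)⁻¹) := by field_simp; ring
  have h4 := mul_le_mul_of_nonneg_left h1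
    (show 0 ≤ 2 * b * ρ * ((a + ‖x‖ ^ 2) ^ 2)⁻¹ by positivity)
  have h5 := mul_le_mul_of_nonneg_left h2 (show 0 ≤ 4 * b * (b + 1) * ρ by positivity)
  rw [h3] at h4
  linarith

end powerProfile

lemma lap_congr {f g : E N → ℝ} {x : E N} (h : f =ᶠ[𝓝 x] g) : lap f x = lap g x := by
  unfold lap
  refine Finset.sum_congr rfl fun i _ => ?_
  have : (fun y => fderiv ℝ f y (stdVec i)) =ᶠ[𝓝 x] fun y => fderiv ℝ g y (stdVec i) := by
    filter_upwards [h.fderiv (𝕜 := ℝ)] with y hy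
    rw [hy]
  rw [this.fderiv_eq]

lemma rpow_neg_two_one_add (x : E N) : (1 + ‖x‖) ^ (-2 : ℝ) = ((1 + ‖x‖) ^ 2)⁻¹ := by
  rw [Real.rpow_neg (by positivity)]
  norm_cast

/-- If the power profile is a strict supersolution, its modification into a function equal to one
on `closure Λ` is a barrier. -/
lemma exists_isBarrier_of_powerProfile {V : E N → ℝ} (hV : Continuous V) (hV0 : ∀ x, 0 ≤ V x)
    {Λ : Set (E N)} (hΛb : Bornology.IsBounded Λ) (hΛ0 : (0 : E N) ∈ Λ)
    (hΛ : 0 < sInf (V '' Λ)) {d : ℝ} (hd : 0 < d) (hd1 : d ≤ 1) {a b σ κ₀ c₀ : ℝ} (ha : 1 ≤ a)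
    (hb : 0 ≤ b) (hσ : 0 ≤ σ) (hκ₀ : 0 < κ₀) (hc₀ : 0 < c₀)
    (hρ : ∀ x : E N, 2 * (c₀ * (1 + ‖x‖) ^ (-σ)) * powerProfile a b x
      ≤ d * V x * powerProfile a b x - κ₀ * lap (powerProfile a b) x) :
    ∃ (κ c A : ℝ) (χ w : E N → ℝ), 0 < c ∧ 0 ≤ A ∧
      IsBarrier V d κ (fun x => c * (1 + ‖x‖) ^ (-σ)) w ∧ IsTest χ ∧
      (∀ x, 0 ≤ χ x) ∧ (∀ x, χ x ≤ w x) ∧ (∀ x ∈ closure Λ, χ x = 1) ∧ (∀ x, w x ≤ 1) ∧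
      ∀ x, w x ≤ A * (1 + ‖x‖) ^ (-(2 * b)) := by
  set m := sInf (V '' Λ) with hm
  have hmΛ : ∀ x ∈ closure Λ, m ≤ V x := by
    intro x hx
    refine closure_minimal (fun y hy => ?_) (isClosed_le continuous_const hV) hx
    exact csInf_le ⟨0, by rintro _ ⟨z, -, rfl⟩; exact hV0 z⟩ (mem_image_of_mem V hy)
  obtain ⟨χ, hχ, hχ0, hχ1, hχΛ, hχs⟩ := exists_isTest_cutoff hΛb.isCompact_closure
    (isOpen_lt (continuous_const (y := m / 2)) hV)
    (fun x hx => show m / 2 < V x by have := hmΛ x hx; linarith)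
  set ρ : E N → ℝ := powerProfile a b with hρdef
  have hρs : ContDiff ℝ ∞ ρ := contDiff_powerProfile ha
  have hρ0 : ∀ x, 0 < ρ x := powerProfile_pos ha
  have hρ1 : ∀ x, ρ x ≤ 1 := powerProfile_le_one ha hb
  set w : E N → ℝ := fun x => χ x + (1 - χ x) * ρ x with hw
  have hws : ContDiff ℝ ∞ w := hχ.1.add ((contDiff_const.sub hχ.1).mul hρs)
  have hwρ : ∀ x, ρ x ≤ w x := fun x => by
    have := mul_nonneg (hχ0 x) (sub_nonneg.2 (hρ1 x))
    simp only [hw]; linarith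
  have hw1 : ∀ x, w x ≤ 1 := fun x => by
    have := mul_nonneg (sub_nonneg.2 (hχ1 x)) (sub_nonneg.2 (hρ1 x))
    simp only [hw]; linarith
  have hK : IsCompact (tsupport χ) := hχ.2
  have h0K : (0 : E N) ∈ tsupport χ := subset_tsupport _ (by
    rw [Function.mem_support, hχΛ 0 (subset_closure hΛ0)]; norm_num)
  obtain ⟨B, hB⟩ := hK.exists_bound_of_continuousOn (continuous_lap hws).continuousOn
  obtain ⟨x₀, -, hx₀⟩ := hK.exists_isMinOn ⟨0, h0K⟩ hρs.continuous.continuousOn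
  have hB0 : 0 ≤ B := (norm_nonneg _).trans (hB 0 h0K)
  obtain ⟨R, hR⟩ := hK.isBounded.exists_norm_le
  -- On the support of `χ` the potential is at least `m / 2`, while `|Δw| ≤ B` and `w ≥ ρ x₀`: for
  -- this `κ` the potential dominates the Laplacian there. Elsewhere `w` is the power profile.
  set κ : ℝ := min κ₀ (d * m * ρ x₀ / (4 * (B + 1))) with hκ
  have hκ0 : 0 < κ := lt_min hκ₀ (by have := hρ0 x₀; positivity)
  set c : ℝ := min (κ / κ₀ * c₀) (d * m / 8) with hc
  have hc0 : 0 < c := lt_min (by positivity) (by positivity)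
  have hR0 : 0 ≤ R := (norm_nonneg _).trans (hR 0 h0K)
  refine ⟨κ, c, 2 ^ b + (1 + R) ^ (2 * b), χ, w, hc0, by positivity,
    ⟨hV, hV0, ⟨0, hΛ.trans_le (hmΛ 0 (subset_closure hΛ0))⟩, hd, hd1, hκ0, ?_, ?_, hws,
      fun x => (hρ0 x).trans_le (hwρ x), fun x => ?_⟩, hχ, hχ0, fun x => ?_, hχΛ, hw1, fun x => ?_⟩
  · have h1 : Continuous fun x : E N => 1 + ‖x‖ := by fun_prop
    have h2 : ∀ x : E N, 1 + ‖x‖ ≠ 0 := fun x => by positivity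
    exact continuous_const.mul (h1.rpow_const fun x => .inl (h2 x))
  · intro x; positivity
  · by_cases hx : x ∈ tsupport χ
    · have hwx := hwρ x
      have h1 : ρ x₀ ≤ ρ x := hx₀ hx
      have h2 : κ * lap w x ≤ d * m / 4 * w x := by
        have h3 : lap w x ≤ B := (le_abs_self _).trans (hB x hx)
        have h4 : κ * (4 * (B + 1)) ≤ d * m * ρ x₀ :=
          (le_div_iff₀ (by positivity)).1 (min_le_right _ _)
        have h5 : d * m * ρ x₀ ≤ d * m * w x := by gcongr; linarith
        have h6 := mul_le_mul_of_nonneg_left h3 hκ0.le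
        nlinarith
      have h7 : m / 2 ≤ V x := (hχs hx : m / 2 < V x).le
      have h8 : (1 + ‖x‖) ^ (-σ) ≤ 1 :=
        Real.rpow_le_one_of_one_le_of_nonpos (by linarith [norm_nonneg x]) (by linarith)
      have h9 : c * (1 + ‖x‖) ^ (-σ) ≤ d * m / 8 :=
        (mul_le_of_le_one_right hc0.le h8).trans (min_le_right _ _)
      have hw0 : 0 < w x := (hρ0 x).trans_le hwx
      have h10 := mul_le_mul_of_nonneg_right h9 hw0.le
      have h11 := mul_le_mul_of_nonneg_right (mul_le_mul_of_nonneg_left h7 hd.le) hw0.le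
      linarith
    · have he : w =ᶠ[𝓝 x] ρ := by
        filter_upwards [(isClosed_tsupport χ).isOpen_compl.mem_nhds hx] with y hy
        simp [hw, image_eq_zero_of_notMem_tsupport hy]
      rw [lap_congr he, he.eq_of_nhds]
      have h1 := mul_le_mul_of_nonneg_left (hρ x) (show 0 ≤ κ / κ₀ by positivity)
      have h2 : κ / κ₀ ≤ 1 := (div_le_one hκ₀).2 (min_le_left _ _)
      have h3 := mul_le_mul_of_nonneg_right h2
        (mul_nonneg (mul_nonneg hd.le (hV0 x)) (hρ0 x).le)
      have h4 : κ / κ₀ * (d * V x * ρ x - κ₀ * lap ρ x)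
          = κ / κ₀ * (d * V x * ρ x) - κ * lap ρ x := by field_simp
      have h5 : c ≤ κ / κ₀ * c₀ := min_le_left _ _
      have h6 := mul_le_mul_of_nonneg_right h5
        (show 0 ≤ 2 * (1 + ‖x‖) ^ (-σ) * ρ x by have := hρ0 x; positivity)
      rw [h4] at h1
      linarith
  · have := mul_nonneg (sub_nonneg.2 (hχ1 x)) (hρ0 x).le
    simp only [hw]; linarith
  · by_cases hx : x ∈ tsupport χ
    · refine (hw1 x).trans ?_
      have h1 : (1 : ℝ) ≤ (1 + R) ^ (2 * b) * (1 + ‖x‖) ^ (-(2 * b)) := by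
        rw [Real.rpow_neg (by positivity), ← div_eq_mul_inv, one_le_div (by positivity)]
        exact Real.rpow_le_rpow (by positivity) (by linarith [hR x hx]) (by linarith)
      have h2 : 0 ≤ (2 : ℝ) ^ b * (1 + ‖x‖) ^ (-(2 * b)) := by positivity
      linarith
    · have : w x = ρ x := by simp [hw, image_eq_zero_of_notMem_tsupport hx]
      rw [this]
      have h1 := powerProfile_le ha hb x
      have h2 : 0 ≤ (1 + R) ^ (2 * b) * (1 + ‖x‖) ^ (-(2 * b)) := by positivity
      have : ρ x ≤ 2 ^ b * (1 + ‖x‖) ^ (-(2 * b)) := h1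
      linarith


/-! ### Choice of the exponents -/

/-- The inequality `2 c₀ (1 + |x|)^{-σ} ρ ≤ d V ρ - κ₀ Δρ` for the profile `ρ = (a + |x|²)^{-b}`. -/
def IsPowerSuper (V : E N → ℝ) (d a b σ κ₀ c₀ : ℝ) : Prop :=
  ∀ x : E N, 2 * (c₀ * (1 + ‖x‖) ^ (-σ)) * powerProfile a b x
      ≤ d * V x * powerProfile a b x - κ₀ * lap (powerProfile a b) x

section

variable {V : E N → ℝ} {d : ℝ}

/-- Potentials bounded from below by `|x|^{-σ}`, `σ ≤ 2`, dominate the Laplacian of the profile. -/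
lemma exists_isPowerSuper_of_le (hd : 0 < d) {σ c b : ℝ} (hσ : σ ≤ 2) (hc : 0 < c)
    (hb : 0 < b) (hV : ∀ x : E N, c * (1 + ‖x‖) ^ (-σ) ≤ V x) :
    ∃ κ₀ c₀, 0 < κ₀ ∧ 0 < c₀ ∧ IsPowerSuper V d 1 b σ κ₀ c₀ := by
  refine ⟨d * c / (16 * b * (b + 1)), d * c / 4, by positivity, by positivity, fun x => ?_⟩
  have h1 := neg_lap_powerProfile_ge hb.le (le_refl (1 : ℝ)) x
  have hρ := powerProfile_pos (b := b) (le_refl (1 : ℝ)) x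
  set ρ := powerProfile 1 b x
  have h2 : ((1 + ‖x‖) ^ 2)⁻¹ ≤ (1 + ‖x‖) ^ (-σ) := by
    rw [← rpow_neg_two_one_add]
    exact Real.rpow_le_rpow_of_exponent_le (by linarith [norm_nonneg x]) (by linarith)
  set s := (1 + ‖x‖) ^ (-σ)
  have h3 := mul_le_mul_of_nonneg_left h1 (show 0 ≤ d * c / (16 * b * (b + 1)) by positivity)
  have h4 : d * c / (16 * b * (b + 1)) * (-(8 * b * (b + 1)) * ((1 + ‖x‖) ^ 2)⁻¹ * ρ)
      = -(d * c / 2 * ρ * ((1 + ‖x‖) ^ 2)⁻¹) := by field_simp; norm_num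
  have h5 := mul_le_mul_of_nonneg_left h2 (show 0 ≤ d * c / 2 * ρ by positivity)
  have h6 := mul_le_mul_of_nonneg_left (hV x) (show 0 ≤ d * ρ by positivity)
  linarith

/-- Below the decay of the fundamental solution, the profile is superharmonic. -/
lemma exists_isPowerSuper_of_lt (hd : 0 ≤ d) (hV0 : ∀ x, 0 ≤ V x) {b : ℝ} (hb : 0 < b)
    (hbN : 2 * b < N - 2) : ∃ κ₀ c₀, 0 < κ₀ ∧ 0 < c₀ ∧ IsPowerSuper V d 1 b 2 κ₀ c₀ := by
  set e : ℝ := N - 2 - 2 * b with he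
  have he0 : 0 < e := by linarith
  refine ⟨1, b * e, one_pos, by positivity, fun x => ?_⟩
  have hρ := powerProfile_pos (b := b) (le_refl (1 : ℝ)) x
  rw [lap_powerProfile le_rfl, rpow_neg_two_one_add]
  set ρ := powerProfile 1 b x
  have h1 : e * (1 + ‖x‖ ^ 2) ≤ N * 1 + e * ‖x‖ ^ 2 := by linarith
  have hp : 0 < 1 + ‖x‖ ^ 2 := by positivity
  have h2 := mul_le_mul_of_nonneg_left h1
    (show 0 ≤ 2 * b * ρ * ((1 + ‖x‖ ^ 2) ^ 2)⁻¹ by positivity)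
  have h3 : 2 * b * ρ * ((1 + ‖x‖ ^ 2) ^ 2)⁻¹ * (e * (1 + ‖x‖ ^ 2))
      = 2 * b * ρ * e * (1 + ‖x‖ ^ 2)⁻¹ := by field_simp
  have h4 : ((1 + ‖x‖) ^ 2)⁻¹ ≤ (1 + ‖x‖ ^ 2)⁻¹ :=
    inv_anti₀ hp (by nlinarith [norm_nonneg x])
  have h5 := mul_le_mul_of_nonneg_left h4 (show 0 ≤ 2 * b * ρ * e by positivity)
  have h6 : 0 ≤ d * V x * ρ := mul_nonneg (mul_nonneg hd (hV0 x)) hρ.le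
  linarith

/-- If `V` is at least of order `|x|^{-2}` at infinity, a profile with any decay works: there the
potential dominates, and the parameter `a` is chosen to make the profile superharmonic in the
remaining ball. -/
lemma exists_isPowerSuper_of_eventually (hN : 1 ≤ N) (hd : 0 < d) (hV0 : ∀ x, 0 ≤ V x)
    {b c R : ℝ} (hb : 0 < b) (hc : 0 < c)
    (hV : ∀ x : E N, R ≤ ‖x‖ → c * ((1 + ‖x‖) ^ 2)⁻¹ ≤ V x) :
    ∃ a κ₀ c₀, 1 ≤ a ∧ 0 < κ₀ ∧ 0 < c₀ ∧ IsPowerSuper V d a b 2 κ₀ c₀ := by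
  set a : ℝ := (2 * b + 1) * R ^ 2 + 1 with ha
  have ha1 : 1 ≤ a := by
    have : 0 ≤ (2 * b + 1) * R ^ 2 := by positivity
    linarith
  set κ := d * c / (16 * b * (b + 1)) with hκ
  have hκ0 : 0 < κ := by positivity
  set m := κ * (2 * b * ((a + R ^ 2) ^ 2)⁻¹) with hm
  have hm0 : 0 < m := by positivity
  refine ⟨a, κ, min (d * c / 4) (m / 2), ha1, hκ0, lt_min (by positivity) (by positivity),
    fun x => ?_⟩
  have hρ := powerProfile_pos (b := b) ha1 x
  have hs : 0 < ((1 + ‖x‖) ^ 2)⁻¹ := by positivity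
  rw [rpow_neg_two_one_add]
  rcases le_or_gt R ‖x‖ with hx | hx
  · have h1 := neg_lap_powerProfile_ge hb.le ha1 x
    set ρ := powerProfile a b x
    have h3 := mul_le_mul_of_nonneg_left h1 hκ0.le
    have h4 : κ * (-(8 * b * (b + 1)) * ((1 + ‖x‖) ^ 2)⁻¹ * ρ)
        = -(d * c / 2 * ρ * ((1 + ‖x‖) ^ 2)⁻¹) := by rw [hκ]; field_simp; norm_num
    have h6 := mul_le_mul_of_nonneg_left (hV x hx) (show 0 ≤ d * ρ by positivity)
    have h7 := mul_le_mul_of_nonneg_right (min_le_left (d * c / 4) (m / 2))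
      (show 0 ≤ ((1 + ‖x‖) ^ 2)⁻¹ * ρ by positivity)
    linarith
  · rw [lap_powerProfile ha1]
    set ρ := powerProfile a b x
    have hx2 : ‖x‖ ^ 2 ≤ R ^ 2 := pow_le_pow_left₀ (norm_nonneg x) hx.le 2
    have h1 : 1 ≤ N * a + (N - 2 - 2 * b) * ‖x‖ ^ 2 := by
      have hN' : (1 : ℝ) ≤ N := by exact_mod_cast hN
      have e1 : 1 * a ≤ N * a := by gcongr
      have e2 : (-(1 + 2 * b)) * ‖x‖ ^ 2 ≤ (N - 2 - 2 * b) * ‖x‖ ^ 2 := by gcongr; linarith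
      have e3 : (2 * b + 1) * ‖x‖ ^ 2 ≤ (2 * b + 1) * R ^ 2 := by gcongr
      linarith
    have h2 : ((a + R ^ 2) ^ 2)⁻¹ ≤ ((a + ‖x‖ ^ 2) ^ 2)⁻¹ := by gcongr
    have h3 : ((a + R ^ 2) ^ 2)⁻¹ * 1 ≤ ((a + ‖x‖ ^ 2) ^ 2)⁻¹ *
        (N * a + (N - 2 - 2 * b) * ‖x‖ ^ 2) := by gcongr
    have h4 := mul_le_mul_of_nonneg_left h3 (show 0 ≤ κ * (2 * b * ρ) by positivity)
    have h5 : ((1 + ‖x‖) ^ 2)⁻¹ ≤ 1 := inv_le_one_of_one_le₀ (by nlinarith [norm_nonneg x])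
    have h6 : 0 ≤ d * V x * ρ := mul_nonneg (mul_nonneg hd.le (hV0 x)) hρ.le
    have h7 : min (d * c / 4) (m / 2) * ((1 + ‖x‖) ^ 2)⁻¹ * ρ ≤ m / 2 * 1 * ρ := by
      gcongr
      exact min_le_right _ _
    have h8 : κ * (2 * b * ρ) * (((a + R ^ 2) ^ 2)⁻¹ * 1) = m * ρ := by rw [hm]; ring
    linarith

end

/-- A positive lower limit of `V |x|²` bounds `V` from below near infinity. -/
lemma exists_le_of_liminf_pos {V : E N → ℝ} (hV0 : ∀ x, 0 ≤ V x)
    (h : 0 < liminf (fun x : E N => ENNReal.ofReal (V x * ‖x‖ ^ 2)) (cocompact (E N))) :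
    ∃ c R : ℝ, 0 < c ∧ ∀ x : E N, R ≤ ‖x‖ → c * ((1 + ‖x‖) ^ 2)⁻¹ ≤ V x := by
  obtain ⟨c', hc'0, hc'⟩ := exists_between h
  have hc't : c' ≠ ⊤ := (hc'.trans_le le_top).ne
  have hev := eventually_lt_of_lt_liminf hc'
  rw [← Metric.cobounded_eq_cocompact, hasBasis_cobounded_norm.eventually_iff] at hev
  obtain ⟨R, -, hR⟩ := hev
  refine ⟨c'.toReal, R, ENNReal.toReal_pos hc'0.ne' hc't, fun x hx => ?_⟩
  have h1 : c'.toReal < V x * ‖x‖ ^ 2 := (ENNReal.lt_ofReal_iff_toReal_lt hc't).1 (hR hx)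
  rw [← div_eq_mul_inv, div_le_iff₀ (by positivity)]
  refine h1.le.trans (mul_le_mul_of_nonneg_left ?_ (hV0 x))
  gcongr
  linarith

/-- The choice of the exponents in each of the regimes for `p`, `α` and `V`: the supersolutions decay
like `|x|^{-2b}`, and the Hardy weight like `|x|^{-σ}`. The three inequalities on the exponents say
that the nonlinear right-hand side divided by the solution decays at least like the Hardy weight,
that `H² |x|^α` decays faster than the Hardy weight, and that the Riesz potential of `u^p`
converges. The alternative that follows says how the right-hand side is absorbed for small `ε`: it
is either exponentially small or of order `ε^{N-α}` with `N - α > 2`, hence negligible with respect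
to the Hardy weight times `ε²`, or else `V` itself is bounded from below by the weight. -/
lemma exists_exponents {α p : ℝ} (hα₀ : 0 < α) (hαN : α < N) (hp : 2 ≤ p)
    {V : E N → ℝ} (hV₀ : ∀ x, 0 ≤ V x)
    (h_linear : p = 2 → (N : ℝ) - 2 ≤ α → 0 < ⨅ x : E N, V x * (1 + ‖x‖ ^ ((N : ℝ) - α)))
    (h_decay : (2 < p ∨ α < (N : ℝ) - 2) →
      (N ≤ 2 ∨ p ≤ 1 + max α (1 + α / 2) / ((N : ℝ) - 2)) →
      0 < liminf (fun x : E N => ENNReal.ofReal (V x * ‖x‖ ^ 2)) (cocompact (E N)))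
    {d : ℝ} (hd : 0 < d) :
    ∃ a b σ κ₀ c₀ : ℝ, 1 ≤ a ∧ 0 < b ∧ 0 < σ ∧ 0 < κ₀ ∧ 0 < c₀ ∧
      σ - 2 * b * (p - 2) ≤ N - α ∧ α + σ < 2 * b * (2 * p - 2) ∧ α < 2 * b * p ∧
      ((2 < p ∨ α < (N : ℝ) - 2) ∨ ∃ c : ℝ, 0 < c ∧ ∀ x : E N, c * (1 + ‖x‖) ^ (-σ) ≤ V x) ∧
      IsPowerSuper V d a b σ κ₀ c₀ := by
  have hN : 1 ≤ N := by
    rcases Nat.eq_zero_or_pos N with h | h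
    · subst h; simp at hαN; linarith
    · exact h
  have hN' : (1 : ℝ) ≤ N := by exact_mod_cast hN
  by_cases hcase : 2 < p ∨ α < (N : ℝ) - 2
  · by_cases hcase' : N ≤ 2 ∨ p ≤ 1 + max α (1 + α / 2) / ((N : ℝ) - 2)
    · obtain ⟨c, R, hc, hR⟩ := exists_le_of_liminf_pos hV₀ (h_decay hcase hcase')
      have hq : 0 ≤ 2 / (p - 2) := by
        have : 0 ≤ p - 2 := by linarith
        positivity
      -- Any large decay rate is allowed. For `p = 2` the quotient is zero, by the convention on
      -- division, and the first condition on the exponents does not involve `b`.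
      set b : ℝ := (N + 2 + 2 / (p - 2)) / 2 with hb
      have hb2 : 2 * b = N + 2 + 2 / (p - 2) := by rw [hb]; ring
      have hb0 : 0 < b := by linarith
      obtain ⟨a, κ₀, c₀, ha, hκ₀, hc₀, hs⟩ :=
        exists_isPowerSuper_of_eventually hN hd hV₀ hb0 hc hR
      refine ⟨a, b, 2, κ₀, c₀, ha, hb0, two_pos, hκ₀, hc₀, ?_, ?_, ?_, .inl hcase, hs⟩
      · rcases hp.eq_or_lt with h2 | h2
        · rcases hcase with h | h
          · linarith
          · rw [← h2]; linarith
        · have h3 : 2 / (p - 2) * (p - 2) = 2 := div_mul_cancel₀ _ (by linarith)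
          have h4 : 0 ≤ ((N : ℝ) + 2) * (p - 2) := mul_nonneg (by linarith) (by linarith)
          rw [hb2]
          linarith
      · have h1 : 2 * b * 2 ≤ 2 * b * (2 * p - 2) := by gcongr; linarith
        linarith
      · have h1 : 2 * b * 2 ≤ 2 * b * p := by gcongr
        linarith
    · push Not at hcase'
      obtain ⟨hN2, hpN⟩ := hcase'
      have hN3 : (0 : ℝ) < N - 2 := by
        have : (2 : ℝ) < N := by exact_mod_cast hN2
        linarith
      have hm : max α (1 + α / 2) < (p - 1) * (N - 2) := by
        rw [← div_lt_iff₀ hN3]; linarith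
      obtain ⟨hm1, hm2⟩ := max_lt_iff.1 hm
      -- The constraints on the decay rate `β = 2 b` are open and hold at `β = N - 2`.
      have hev : ∀ᶠ β : ℝ in 𝓝[<] ((N : ℝ) - 2), 0 < β ∧ β < N - 2 ∧ 2 - β * (p - 2) < N - α ∧
          α + 2 < β * (2 * p - 2) ∧ α < β * p := by
        have c1 : Continuous fun β : ℝ => 2 - β * (p - 2) := by fun_prop
        have c2 : Continuous fun β : ℝ => β * (2 * p - 2) := by fun_prop
        have c3 : Continuous fun β : ℝ => β * p := by fun_prop
        filter_upwards [self_mem_nhdsWithin, nhdsWithin_le_nhds (lt_mem_nhds hN3),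
          nhdsWithin_le_nhds (c1.continuousAt.eventually_lt_const
            (show 2 - ((N : ℝ) - 2) * (p - 2) < N - α by linarith)),
          nhdsWithin_le_nhds (c2.continuousAt.eventually_const_lt
            (show α + 2 < ((N : ℝ) - 2) * (2 * p - 2) by linarith)),
          nhdsWithin_le_nhds (c3.continuousAt.eventually_const_lt
            (show α < ((N : ℝ) - 2) * p by linarith))] with β h1 h2 h3 h4 h5
        exact ⟨h2, h1, h3, h4, h5⟩
      obtain ⟨β, h1, h2, h3, h4, h5⟩ := hev.exists
      have hβ : 2 * (β / 2) = β := by ring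
      obtain ⟨κ₀, c₀, hκ₀, hc₀, hs⟩ := exists_isPowerSuper_of_lt hd.le hV₀ (half_pos h1)
        (by rw [hβ]; exact h2)
      exact ⟨1, β / 2, 2, κ₀, c₀, le_rfl, half_pos h1, two_pos, hκ₀, hc₀, by rw [hβ]; exact h3.le,
        by rw [hβ]; exact h4, by rw [hβ]; exact h5, .inl hcase, hs⟩
  · push Not at hcase
    have hp2 : p = 2 := le_antisymm hcase.1 hp
    have hlin := h_linear hp2 hcase.2
    set c := ⨅ x : E N, V x * (1 + ‖x‖ ^ ((N : ℝ) - α)) with hc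
    have hσ0 : 0 < (N : ℝ) - α := by linarith
    have hV : ∀ x : E N, c / 2 * (1 + ‖x‖) ^ (-((N : ℝ) - α)) ≤ V x := by
      intro x
      have h1 : c ≤ V x * (1 + ‖x‖ ^ ((N : ℝ) - α)) := ciInf_le ⟨0, by
        rintro _ ⟨y, rfl⟩
        exact mul_nonneg (hV₀ y) (by positivity)⟩ x
      have h2 : 1 + ‖x‖ ^ ((N : ℝ) - α) ≤ 2 * (1 + ‖x‖) ^ ((N : ℝ) - α) := by
        have e1 : (1 : ℝ) ≤ (1 + ‖x‖) ^ ((N : ℝ) - α) :=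
          Real.one_le_rpow (by linarith [norm_nonneg x]) hσ0.le
        have e2 : ‖x‖ ^ ((N : ℝ) - α) ≤ (1 + ‖x‖) ^ ((N : ℝ) - α) := by gcongr; linarith
        linarith
      have h3 := h1.trans (mul_le_mul_of_nonneg_left h2 (hV₀ x))
      rw [Real.rpow_neg (by positivity), ← div_eq_mul_inv, div_le_iff₀ (by positivity)]
      linarith
    have hb0 : 0 < (N : ℝ) / 2 := by linarith
    obtain ⟨κ₀, c₀, hκ₀, hc₀, hs⟩ := exists_isPowerSuper_of_le hd (by linarith [hcase.2])
      (half_pos hlin) hb0 hV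
    have hβ : 2 * ((N : ℝ) / 2) = N := by ring
    refine ⟨1, N / 2, N - α, κ₀, c₀, le_rfl, hb0, hσ0, hκ₀, hc₀, ?_, ?_, ?_,
      .inr ⟨c / 2, half_pos hlin, hV⟩, hs⟩
    · rw [hp2]; simp
    · rw [hβ, hp2]; linarith
    · rw [hβ, hp2]; linarith


/-! ### Smallness of the right-hand side -/

/-- Multiples of elements of `H¹_V` belong to `H¹_V`. -/
lemma MemH1V.const_mul {V u : E N → ℝ} {g : E N → E N} (h : MemH1V V u g) (s : ℝ) :
    MemH1V V (fun x => s * u x) (fun x => s • g x) := by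
  obtain ⟨hu, φ, hφ, hE⟩ := h
  refine ⟨⟨hu.1.smul s, hu.2.1.smul s, fun η hη v => ?_⟩,
    fun n x => s * φ n x, fun n => (hφ n).const_mul s, ?_⟩
  · simp only [mul_assoc, real_inner_smul_left]
    rw [integral_const_mul, integral_const_mul, hu.2.2 η hη v]
    ring
  · have h1 := ENNReal.Tendsto.const_mul (a := ENNReal.ofReal (s ^ 2)) hE
      (.inr ENNReal.ofReal_ne_top)
    rw [mul_zero] at h1
    refine h1.congr fun n => ?_
    rw [energy, energy, ← lintegral_const_mul' _ _ ENNReal.ofReal_ne_top]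
    refine lintegral_congr fun x => ?_
    rw [← ENNReal.ofReal_mul (sq_nonneg s), gradient_fun_const_mul ((hφ n).differentiable x),
      ← smul_sub, norm_smul, ← mul_sub, mul_pow, mul_pow, Real.norm_eq_abs, sq_abs]
    congr 1
    ring

lemma integrable_mul_of_abs_le {h b φ : E N → ℝ} (hh : AEStronglyMeasurable h volume)
    (hb : Continuous b) (hhb : ∀ x, |h x| ≤ b x) (hφ : LocallyIntegrable φ volume)
    (hφc : HasCompactSupport φ) : Integrable (fun x => h x * φ x) volume := by
  obtain ⟨M, hM⟩ := hφc.isCompact.exists_bound_of_continuousOn hb.continuousOn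
  have h1 : Integrable φ volume :=
    (integrableOn_iff_integrable_of_support_subset (subset_tsupport φ)).1
      (hφ.integrableOn_isCompact hφc.isCompact)
  refine (h1.norm.const_mul M).mono' (hh.mul h1.1) (.of_forall fun x => ?_)
  rw [norm_mul]
  by_cases hx : x ∈ tsupport φ
  · gcongr
    exact (hhb x).trans ((le_abs_self _).trans (hM x hx))
  · simp [image_eq_zero_of_notMem_tsupport hx]

lemma exp_rpow_eq (lam k ε : ℝ) : Real.exp (-lam / ε) ^ k = Real.exp (-(k * lam) * ε⁻¹) := by
  rw [← Real.exp_mul]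
  congr 1
  ring

/-- The exponential beats every power of `ε`. -/
lemma tendsto_rpow_mul_exp {lam k : ℝ} (hlam : 0 < lam) (hk : 0 < k) (s : ℝ) :
    Tendsto (fun ε : ℝ => ε ^ s * Real.exp (-lam / ε) ^ k) (𝓝[>] 0) (𝓝 0) := by
  have h1 := (tendsto_rpow_mul_exp_neg_mul_atTop_nhds_zero (-s) (k * lam) (by positivity)).comp
    (tendsto_inv_nhdsGT_zero (𝕜 := ℝ))
  refine h1.congr' ?_
  filter_upwards [self_mem_nhdsWithin] with ε hε
  have hε : 0 < ε := hε
  rw [Function.comp_apply, exp_rpow_eq, Real.inv_rpow hε.le, Real.rpow_neg hε.le, inv_inv]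

lemma tendsto_rpow_nhdsGT_zero {s : ℝ} (hs : 0 < s) :
    Tendsto (fun ε : ℝ => ε ^ s) (𝓝[>] 0) (𝓝 0) := by
  have h := (Real.continuousAt_rpow_const (0 : ℝ) s (.inr hs.le)).tendsto
  rw [Real.zero_rpow hs.ne'] at h
  exact h.mono_left nhdsWithin_le_nhds

/-- The size of the right-hand side, relative to `e^{-λ/ε}`. -/
noncomputable def rhsSize (N : ℕ) (α p ν lam ε : ℝ) : ℝ :=
  p * ε ^ (-α) * Real.exp (-lam / ε) ^ (2 * p - 2)
    + ν * ε ^ ((N : ℝ) - α) * Real.exp (-lam / ε) ^ (p - 2)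

lemma tendsto_rhsSize {α p ν lam : ℝ} (hαN : α < N) (hp : 2 ≤ p) (hlam : 0 < lam) :
    Tendsto (rhsSize N α p ν lam) (𝓝[>] 0) (𝓝 0) := by
  have h1 := (tendsto_rpow_mul_exp hlam (show 0 < 2 * p - 2 by linarith) (-α)).const_mul p
  have h2 : Tendsto (fun ε : ℝ => ε ^ ((N : ℝ) - α) * Real.exp (-lam / ε) ^ (p - 2))
      (𝓝[>] 0) (𝓝 0) := by
    rcases hp.eq_or_lt with h | h
    · rw [← h]
      simpa using tendsto_rpow_nhdsGT_zero (show 0 < (N : ℝ) - α by linarith)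
    · exact tendsto_rpow_mul_exp hlam (show 0 < p - 2 by linarith) _
  have h3 := h1.add (h2.const_mul ν)
  simp only [mul_zero, add_zero] at h3
  refine h3.congr fun ε => ?_
  rw [rhsSize]
  ring

lemma tendsto_rhsSize_div_sq {α p ν lam : ℝ} (hp : 2 ≤ p) (hlam : 0 < lam)
    (h : 2 < p ∨ α < (N : ℝ) - 2) :
    Tendsto (fun ε => rhsSize N α p ν lam ε / ε ^ 2) (𝓝[>] 0) (𝓝 0) := by
  have h1 := (tendsto_rpow_mul_exp hlam (show 0 < 2 * p - 2 by linarith) (-α - 2)).const_mul p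
  have h2 : Tendsto (fun ε : ℝ => ε ^ ((N : ℝ) - α - 2) * Real.exp (-lam / ε) ^ (p - 2))
      (𝓝[>] 0) (𝓝 0) := by
    rcases hp.eq_or_lt with h' | h'
    · have h0 : 0 < (N : ℝ) - α - 2 := by
        rcases h with h | h <;> linarith
      rw [← h']
      simpa using tendsto_rpow_nhdsGT_zero h0
    · exact tendsto_rpow_mul_exp hlam (show 0 < p - 2 by linarith) _
  have h3 := h1.add (h2.const_mul ν)
  simp only [mul_zero, add_zero] at h3
  refine h3.congr' ?_
  filter_upwards [self_mem_nhdsWithin] with ε hε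
  have hε : 0 < ε := hε
  rw [rhsSize, Real.rpow_sub hε, Real.rpow_sub hε _ 2, Real.rpow_two]
  ring

/-- For small `ε`, the right-hand side is absorbed by the Hardy weight or by the potential. -/
lemma eventually_rhsSize_le {α p ν lam : ℝ} (hαN : α < N) (hp : 2 ≤ p)
    (hlam : 0 < lam) {V : E N → ℝ} (hV₀ : ∀ x, 0 ≤ V x) {d κ c σ : ℝ} (hd : 0 < d) (hκ : 0 < κ)
    (hc : 0 < c) (K : ℝ)
    (h : (2 < p ∨ α < (N : ℝ) - 2) ∨ ∃ c : ℝ, 0 < c ∧ ∀ x : E N, c * (1 + ‖x‖) ^ (-σ) ≤ V x) :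
    ∀ᶠ ε in 𝓝[>] (0 : ℝ), ∀ x : E N, K * rhsSize N α p ν lam ε * (1 + ‖x‖) ^ (-σ)
      ≤ ε ^ 2 / κ * (c * (1 + ‖x‖) ^ (-σ)) + (1 - ε ^ 2 / κ) * (d * V x) := by
  have hsq : ∀ᶠ ε in 𝓝[>] (0 : ℝ), ε ^ 2 < κ / 2 := by
    have : Tendsto (fun ε : ℝ => ε ^ 2) (𝓝[>] 0) (𝓝 0) := by
      have := ((continuous_pow 2).tendsto (0 : ℝ)).mono_left
        (nhdsWithin_le_nhds (s := Ioi (0 : ℝ)))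
      simpa using this
    exact this.eventually_lt_const (half_pos hκ)
  by_cases h1 : 2 < p ∨ α < (N : ℝ) - 2
  · have h2 := (tendsto_rhsSize_div_sq (ν := ν) hp hlam h1).const_mul K
    rw [mul_zero] at h2
    filter_upwards [hsq, self_mem_nhdsWithin, h2.eventually_lt_const (show 0 < c / κ by positivity)]
      with ε e1 e2 e3 x
    have e2 : 0 < ε := e2
    have e4 : K * rhsSize N α p ν lam ε ≤ ε ^ 2 / κ * c := by
      rw [← mul_div_assoc, div_lt_iff₀ (by positivity)] at e3
      refine e3.le.trans_eq (by ring)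
    have e5 := mul_le_mul_of_nonneg_right e4 (show 0 ≤ (1 + ‖x‖) ^ (-σ) by positivity)
    have e6 : ε ^ 2 / κ ≤ 1 := (div_le_one hκ).2 (by linarith)
    have e7 := mul_nonneg (sub_nonneg.2 e6) (mul_nonneg hd.le (hV₀ x))
    linarith
  · obtain ⟨cV, hcV, hV⟩ := h.resolve_left h1
    have h2 := (tendsto_rhsSize (ν := ν) hαN hp hlam).const_mul K
    rw [mul_zero] at h2
    filter_upwards [hsq, h2.eventually_lt_const (show 0 < d * cV / 2 by positivity)]
      with ε e1 e3 x
    have e5 := mul_le_mul_of_nonneg_right e3.le (show 0 ≤ (1 + ‖x‖) ^ (-σ) by positivity)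
    have e6 : ε ^ 2 / κ ≤ 1 / 2 := (div_le_iff₀ hκ).2 (by linarith)
    have e7 := mul_le_mul_of_nonneg_right (show 1 / 2 ≤ 1 - ε ^ 2 / κ by linarith)
      (mul_nonneg hd.le (hV₀ x))
    have e8 := mul_le_mul_of_nonneg_left (hV x) hd.le
    have e9 : 0 ≤ ε ^ 2 / κ * (c * (1 + ‖x‖) ^ (-σ)) := by positivity
    linarith


/-! ### The nonlinear inequality and the penalization conditions -/

/-- Pointwise bound of the right-hand side for the multiple `e^{-λ/ε} U` of a function `U` with
polynomial decay. -/
lemma exists_choquardRHS_le {α p ν lam : ℝ} (hα : 0 < α) (hαN : α < N) (hp : 2 ≤ p) (hν : 0 ≤ ν)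
    {Λ : Set (E N)} (hΛ : IsOpen Λ) (hΛ0 : (0 : E N) ∈ Λ) {U : E N → ℝ} {A β σ : ℝ}
    (hU0 : ∀ x, 0 < U x) (hA : 0 ≤ A) (hUA : ∀ x, U x ≤ A * (1 + ‖x‖) ^ (-β))
    (h1 : σ - β * (p - 2) ≤ N - α) (h2 : α + σ < β * (2 * p - 2)) (h3 : α < β * p) :
    ∃ K : ℝ, ∀ ε : ℝ, 0 < ε → ∀ x : E N,
      choquardRHS α p ν ε Λ (fun y => Real.exp (-lam / ε) * U y) x
        ≤ ENNReal.ofReal (Real.exp (-lam / ε) *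
          (K * rhsSize N α p ν lam ε * (1 + ‖x‖) ^ (-σ) * U x)) := by
  -- The decay that the factor in front of `u^{p-1}` needs to have; the second entry is
  -- negative for large `β`.
  set γ : ℝ := max 0 (σ - β * (p - 2)) with hγ
  obtain ⟨C1, hC1, hpot⟩ := exists_rieszPotential_le (N := N) (s := β * p) (γ := γ) hα hαN
    (le_max_left _ _) (max_le (by linarith) h1) (max_lt (by linarith) (by linarith))
  obtain ⟨r, hr, hball⟩ := Metric.isOpen_iff.1 hΛ 0 hΛ0
  obtain ⟨C2, hC2, hker⟩ := exists_rieszKernel_le (N := N) (γ := γ) hα hαN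
    (max_le (by linarith) h1) hr
  refine ⟨A ^ (p - 2) * (A ^ p * C1 + C2), fun ε hε x => ?_⟩
  set S := Real.exp (-lam / ε) with hS
  have hS0 : 0 < S := Real.exp_pos _
  by_cases hx : x ∈ Λ
  · simp [choquardRHS, hx]
  have hxr : r ≤ ‖x‖ := by
    by_contra hlt
    exact hx (hball (by simpa using hlt))
  have ht1 : 1 ≤ 1 + ‖x‖ := by linarith [norm_nonneg x]
  set t := 1 + ‖x‖ with ht
  have ht0 : 0 < t := by linarith
  have hUp : ∀ y : E N, ∀ k : ℝ, 0 ≤ k → U y ^ k ≤ A ^ k * (1 + ‖y‖) ^ (-(β * k)) := fun y k hk => by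
    have := Real.rpow_le_rpow (hU0 y).le (hUA y) hk
    rwa [Real.mul_rpow hA (by positivity), ← Real.rpow_mul (by positivity), neg_mul] at this
  have b1 : rieszPotential α (Λᶜ.indicator fun y => (S * U y) ^ p) x
      ≤ ENNReal.ofReal (S ^ p * A ^ p * (C1 * t ^ (-γ))) := by
    calc rieszPotential α (Λᶜ.indicator fun y => (S * U y) ^ p) x
        ≤ ∫⁻ y, ENNReal.ofReal (S ^ p * A ^ p) * (ENNReal.ofReal (rieszKernel α (x - y)) *
            ENNReal.ofReal ((1 + ‖y‖) ^ (-(β * p)))) := by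
          refine lintegral_mono fun y => ?_
          have hSA : 0 ≤ S ^ p * A ^ p := by positivity
          rw [mul_left_comm, ← ENNReal.ofReal_mul hSA]
          refine mul_le_mul_right (ENNReal.ofReal_le_ofReal ?_) _
          refine (indicator_le_self' (fun y _ => ?_) y).trans ?_
          · exact Real.rpow_nonneg (mul_nonneg hS0.le (hU0 y).le) _
          · change (S * U y) ^ p ≤ _
            rw [Real.mul_rpow hS0.le (hU0 y).le, mul_assoc]
            gcongr
            exact hUp y p (by linarith)
      _ = ENNReal.ofReal (S ^ p * A ^ p) * rieszPotential α (fun y => (1 + ‖y‖) ^ (-(β * p))) x :=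
          lintegral_const_mul' _ _ ENNReal.ofReal_ne_top
      _ ≤ ENNReal.ofReal (S ^ p * A ^ p) * ENNReal.ofReal (C1 * t ^ (-γ)) := by
          gcongr; exact hpot x
      _ = _ := (ENNReal.ofReal_mul (by positivity)).symm
  have b2 := hker x hxr
  have b3 : (S * U x) ^ (p - 1) ≤ S ^ (p - 1) * (A ^ (p - 2) * t ^ (-(β * (p - 2))) * U x) := by
    rw [Real.mul_rpow hS0.le (hU0 x).le]
    gcongr
    have e1 : U x ^ (p - 1) = U x ^ (p - 2) * U x := by
      rw [← Real.rpow_add_one (hU0 x).ne']; congr 1; ring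
    rw [e1]
    have := (hU0 x).le
    gcongr
    exact hUp x (p - 2) (by linarith)
  have hUx := (hU0 x).le
  calc choquardRHS α p ν ε Λ (fun y => S * U y) x
      ≤ (ENNReal.ofReal (p * ε ^ (-α)) * ENNReal.ofReal (S ^ p * A ^ p * (C1 * t ^ (-γ)))
          + ENNReal.ofReal (ν * ε ^ ((N : ℝ) - α) * (C2 * t ^ (-γ))))
        * ENNReal.ofReal (S ^ (p - 1) * (A ^ (p - 2) * t ^ (-(β * (p - 2))) * U x)) := by
        unfold choquardRHS
        gcongr
        rw [indicator_of_mem (show x ∈ Λᶜ from hx)]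
        exact b3
    _ = ENNReal.ofReal ((p * ε ^ (-α) * (S ^ p * A ^ p * (C1 * t ^ (-γ)))
          + ν * ε ^ ((N : ℝ) - α) * (C2 * t ^ (-γ)))
            * (S ^ (p - 1) * (A ^ (p - 2) * t ^ (-(β * (p - 2))) * U x))) := by
        rw [← ENNReal.ofReal_mul (by positivity), ← ENNReal.ofReal_add (by positivity)
          (by positivity), ← ENNReal.ofReal_mul (by positivity)]
    _ ≤ _ := by
        refine ENNReal.ofReal_le_ofReal ?_
        have e1 : S ^ p * S ^ (p - 1) = S * S ^ (2 * p - 2) := by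
          rw [← Real.rpow_add hS0, ← Real.rpow_one_add' hS0.le (by linarith)]; congr 1; ring
        have e2 : S ^ (p - 1) = S * S ^ (p - 2) := by
          rw [← Real.rpow_one_add' hS0.le (by linarith)]; congr 1; ring
        have e3 : t ^ (-γ) * t ^ (-(β * (p - 2))) ≤ t ^ (-σ) := by
          rw [← Real.rpow_add ht0]
          refine Real.rpow_le_rpow_of_exponent_le ht1 ?_
          have := le_max_right 0 (σ - β * (p - 2))
          linarith
        have e4 : (p * ε ^ (-α) * (S ^ p * A ^ p * (C1 * t ^ (-γ)))
          + ν * ε ^ ((N : ℝ) - α) * (C2 * t ^ (-γ)))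
            * (S ^ (p - 1) * (A ^ (p - 2) * t ^ (-(β * (p - 2))) * U x))
            = (p * ε ^ (-α) * (S ^ p * S ^ (p - 1)) * (A ^ p * C1)
              + ν * ε ^ ((N : ℝ) - α) * S ^ (p - 1) * C2) * A ^ (p - 2) * U x
              * (t ^ (-γ) * t ^ (-(β * (p - 2)))) := by ring
        rw [e4, e1, e2]
        have e5 : p * ε ^ (-α) * (S * S ^ (2 * p - 2)) * (A ^ p * C1)
              + ν * ε ^ ((N : ℝ) - α) * (S * S ^ (p - 2)) * C2
            ≤ S * ((A ^ p * C1 + C2) * rhsSize N α p ν lam ε) := by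
          have f1 : 0 ≤ p * ε ^ (-α) * S ^ (2 * p - 2) * S * C2 := by positivity
          have f2 : 0 ≤ ν * ε ^ ((N : ℝ) - α) * S ^ (p - 2) * S * (A ^ p * C1) := by positivity
          rw [rhsSize, ← hS]
          linarith
        have e6 : 0 ≤ rhsSize N α p ν lam ε := by rw [rhsSize]; positivity
        calc _ ≤ (S * ((A ^ p * C1 + C2) * rhsSize N α p ν lam ε)) * A ^ (p - 2) * U x
              * t ^ (-σ) := by
              gcongr
          _ = _ := by ring

/-- The supersolution of the linear problem with the Hardy weight `q` is, after scaling, a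
supersolution of the penalized problem as soon as the right-hand side is at most
`ε² / κ * q + (1 - ε² / κ) (1 - δ) V` times the solution: the linear inequality is multiplied by
`ε² / κ`, and the remaining fraction of `V` is kept. -/
lemma isWeakSupersolution_of_le {V q U : E N → ℝ} {G : E N → E N} {κ δ ε S : ℝ}
    {f : E N → ℝ≥0∞} {k : E N → ℝ} (hV : Continuous V)
    (hδ : δ < 1) (hq : Continuous q) (hκ : 0 < κ) (hk : Continuous k) (hk0 : ∀ x, 0 ≤ k x)
    (hS : 0 ≤ S)
    (hU : AEStronglyMeasurable U volume) (hU0 : ∀ x, 0 ≤ U x) (hU1 : ∀ x, U x ≤ 1)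
    (hG : MemLp G 2 volume)
    (hsuper : ∀ η : E N → ℝ, IsTest η → (∀ x, 0 ≤ η x) →
      0 ≤ ∫ x, (κ * inner ℝ (G x) (gradient η x) + ((1 - δ) * V x - q x) * U x * η x))
    (hf : ∀ x, f x ≤ ENNReal.ofReal (S * (k x * U x)))
    (hle : ∀ x, k x ≤ ε ^ 2 / κ * q x + (1 - ε ^ 2 / κ) * ((1 - δ) * V x)) :
    IsWeakSupersolution ε δ V (fun x => S * U x) (fun x => S • G x) f := by
  intro φ ψ hφ hφ2 hψ2 hφc hφ0
  have hd : 0 < 1 - δ := by linarith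
  have habs : ∀ {c : ℝ} (x : E N), |c * U x| ≤ |c| := fun {c} x => by
    rw [abs_mul, abs_of_nonneg (hU0 x)]
    exact mul_le_of_le_one_right (abs_nonneg _) (hU1 x)
  have hmul : ∀ {c : E N → ℝ}, Continuous c → AEStronglyMeasurable (fun x => c x * U x) volume :=
    fun hc => hc.aestronglyMeasurable.mul hU
  have hcont : Continuous fun x => (1 - δ) * V x - q x := (continuous_const.mul hV).sub hq
  obtain ⟨i1, i2, hpos⟩ := integral_nonneg_of_test (b := fun x => |(1 - δ) * V x - q x|) hG
    (hmul hcont) hcont.abs (fun x => habs x) hsuper hφ hφ2 hψ2 hφc hφ0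
  have hint : ∀ {c : E N → ℝ}, Continuous c → Integrable (fun x => c x * U x * φ x) volume :=
    fun {c} hc => integrable_mul_of_abs_le (b := fun x => |c x|) (hmul hc) hc.abs
      (fun x => habs x) hφ.1 hφc
  have iV := hint hV
  have ik := hint hk
  have hI : (fun x => ε ^ 2 * inner ℝ (S • G x) (ψ x) + (1 - δ) * V x * (S * U x) * φ x)
      = fun x => (S * ε ^ 2) * inner ℝ (G x) (ψ x) + (S * (1 - δ)) * (V x * U x * φ x) := by
    ext x
    rw [real_inner_smul_left]
    ring
  have iI : Integrable (fun x => (S * ε ^ 2) * inner ℝ (G x) (ψ x)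
      + (S * (1 - δ)) * (V x * U x * φ x)) volume := (i1.const_mul _).add (iV.const_mul _)
  rw [hI]
  refine ⟨iI, ?_⟩
  have hkey : S * ∫ x, k x * U x * φ x ≤ ∫ x, ((S * ε ^ 2) * inner ℝ (G x) (ψ x)
      + (S * (1 - δ)) * (V x * U x * φ x)) := by
    rw [integral_add (i1.const_mul _) (iV.const_mul _), integral_const_mul, integral_const_mul]
    have e1 : ∫ x, k x * U x * φ x ≤ ∫ x, ((1 - δ) * (V x * U x * φ x)
        - ε ^ 2 / κ * (((1 - δ) * V x - q x) * U x * φ x)) := by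
      refine integral_mono ik ((iV.const_mul _).sub (i2.const_mul _)) fun x => ?_
      have := mul_le_mul_of_nonneg_right (mul_le_mul_of_nonneg_right (hle x) (hU0 x)) (hφ0 x)
      simp only
      linarith
    rw [integral_sub (iV.const_mul _) (i2.const_mul _), integral_const_mul, integral_const_mul] at e1
    have e2 := mul_nonneg (show 0 ≤ ε ^ 2 / κ by positivity) hpos
    have e3 : ε ^ 2 / κ * (κ * ∫ x, inner ℝ (G x) (ψ x)) = ε ^ 2 * ∫ x, inner ℝ (G x) (ψ x) := by
      field_simp
    have e4 := mul_le_mul_of_nonneg_left (show ∫ x, k x * U x * φ x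
      ≤ ε ^ 2 * (∫ x, inner ℝ (G x) (ψ x)) + (1 - δ) * ∫ x, V x * U x * φ x by linarith) hS
    linarith
  have h1 : ∫⁻ x, f x * ENNReal.ofReal (φ x) ≤ ENNReal.ofReal (S * ∫ x, k x * U x * φ x) := by
    rw [← integral_const_mul, ofReal_integral_eq_lintegral_ofReal (ik.const_mul S)
      (.of_forall fun x => mul_nonneg hS (mul_nonneg (mul_nonneg (hk0 x) (hU0 x)) (hφ0 x)))]
    refine lintegral_mono fun x => ?_
    refine (mul_le_mul_left (hf x) _).trans_eq ?_
    rw [← ENNReal.ofReal_mul (mul_nonneg hS (mul_nonneg (hk0 x) (hU0 x)))]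
    congr 1
    ring
  have h0 : 0 ≤ S * ∫ x, k x * U x * φ x :=
    mul_nonneg hS (integral_nonneg fun x => mul_nonneg (mul_nonneg (hk0 x) (hU0 x)) (hφ0 x))
  refine (EReal.coe_ennreal_le_coe_ennreal_iff.2 h1).trans ?_
  rw [EReal.coe_ennreal_ofReal, max_eq_left h0]
  exact EReal.coe_le_coe_iff.2 hkey

/-- The penalization potential `χ_{ℝ^N ∖ Λ} (S U)^{p-1}` inherits the decay of `U`. -/
lemma penalizationOf_sq_mul_le {p α A β S : ℝ} (hα : 0 ≤ α) (hp : 1 ≤ p) {Λ : Set (E N)}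
    {U : E N → ℝ} (hU0 : ∀ x, 0 ≤ U x) (hA : 0 ≤ A) (hS : 0 ≤ S)
    (hUA : ∀ x, U x ≤ A * (1 + ‖x‖) ^ (-β)) (x : E N) :
    penalizationOf p Λ (fun y => S * U y) x ^ 2 * ‖x‖ ^ α
      ≤ S ^ (2 * p - 2) * A ^ (2 * p - 2) * (1 + ‖x‖) ^ (-(β * (2 * p - 2) - α)) := by
  by_cases hx : x ∈ Λ
  · rw [penalizationOf, indicator_of_notMem (by simpa using hx), zero_pow two_ne_zero, zero_mul]
    positivity
  · rw [penalizationOf, indicator_of_mem (show x ∈ Λᶜ from hx)]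
    have h0 : 0 ≤ S * U x := mul_nonneg hS (hU0 x)
    have h1 : ((S * U x) ^ (p - 1)) ^ 2 = (S * U x) ^ (2 * p - 2) := by
      rw [← Real.rpow_natCast, ← Real.rpow_mul h0]
      congr 1
      push_cast
      ring
    have h2 : (S * U x) ^ (2 * p - 2)
        ≤ S ^ (2 * p - 2) * (A ^ (2 * p - 2) * (1 + ‖x‖) ^ (-(β * (2 * p - 2)))) := by
      rw [Real.mul_rpow hS (hU0 x)]
      gcongr
      have := Real.rpow_le_rpow (hU0 x) (hUA x) (show 0 ≤ 2 * p - 2 by linarith)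
      rwa [Real.mul_rpow hA (by positivity), ← Real.rpow_mul (by positivity), neg_mul] at this
    have h3 : ‖x‖ ^ α ≤ (1 + ‖x‖) ^ α := by
      gcongr; linarith
    have h4 : (1 + ‖x‖) ^ (-(β * (2 * p - 2) - α))
        = (1 + ‖x‖) ^ (-(β * (2 * p - 2))) * (1 + ‖x‖) ^ α := by
      rw [← Real.rpow_add (by positivity)]
      congr 1
      ring
    rw [h1, h4]
    calc (S * U x) ^ (2 * p - 2) * ‖x‖ ^ α
        ≤ S ^ (2 * p - 2) * (A ^ (2 * p - 2) * (1 + ‖x‖) ^ (-(β * (2 * p - 2))))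
          * (1 + ‖x‖) ^ α := by gcongr
      _ = _ := by ring

/-- Condition `(H₂)` for a potential controlled by the Hardy weight. -/
lemma IsBarrier.hardyBound {V q w H : E N → ℝ} {d κ : ℝ} (C : IsBarrier V d κ q w)
    {α M k ε : ℝ} (hε : 0 < ε) (hεκ : ε ^ 2 ≤ κ) (hM : 0 ≤ M)
    (hH : ∀ x, H x ^ 2 * ‖x‖ ^ α ≤ M * q x) (hk : ε ^ (-α) * M * (κ / ε ^ 2) ≤ k) :
    HardyBound α k ε V H := by
  intro φ g h
  have h1 : ∫⁻ x, ENNReal.ofReal (|H x * φ x| ^ 2 * ‖x‖ ^ α)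
      ≤ ENNReal.ofReal M * eLpNorm φ 2 (wm q) ^ 2 := by
    rw [eLpNorm_wm_sq C.q_cont.measurable, ← lintegral_const_mul' _ _ ENNReal.ofReal_ne_top]
    refine lintegral_mono fun x => ?_
    rw [enorm_sq_eq_ofReal, ← mul_assoc, ← ENNReal.ofReal_mul hM,
      ← ENNReal.ofReal_mul (mul_nonneg hM (C.q_pos x).le), Real.norm_eq_abs]
    refine ENNReal.ofReal_le_ofReal ?_
    rw [sq_abs, sq_abs, mul_pow, mul_right_comm]
    exact mul_le_mul_of_nonneg_right (hH x) (sq_nonneg _)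
  have h2 : eLpNorm φ 2 (wm q) ^ 2 ≤ energy (√κ) V φ g :=
    (le_mul_of_one_le_left zero_le (by norm_num)).trans (C.hardy h)
  have h3 : energy (√κ) V φ g ≤ ENNReal.ofReal (κ / ε ^ 2) * energy ε V φ g := by
    have hκ := C.κ_pos
    rw [energy, energy, ← lintegral_const_mul' _ _ ENNReal.ofReal_ne_top]
    refine lintegral_mono fun x => ?_
    rw [← ENNReal.ofReal_mul (by positivity), Real.sq_sqrt hκ.le]
    refine ENNReal.ofReal_le_ofReal ?_
    have e1 : 1 ≤ κ / ε ^ 2 := (one_le_div (by positivity)).2 hεκ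
    have e2 := mul_le_mul_of_nonneg_right e1 (mul_nonneg (C.V_nonneg x) (sq_nonneg (φ x)))
    have e3 : κ / ε ^ 2 * (ε ^ 2 * ‖g x‖ ^ 2) = κ * ‖g x‖ ^ 2 := by field_simp
    linarith
  calc ENNReal.ofReal (ε ^ (-α)) * ∫⁻ x, ENNReal.ofReal (|H x * φ x| ^ 2 * ‖x‖ ^ α)
      ≤ ENNReal.ofReal (ε ^ (-α)) * (ENNReal.ofReal M *
          (ENNReal.ofReal (κ / ε ^ 2) * energy ε V φ g)) := by
        gcongr
        exact h1.trans (by gcongr; exact h2.trans h3)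
    _ = ENNReal.ofReal (ε ^ (-α) * M * (κ / ε ^ 2)) * energy ε V φ g := by
        rw [ENNReal.ofReal_mul (by positivity), ENNReal.ofReal_mul (by positivity)]
        ring
    _ ≤ _ := by gcongr

/-- Condition `(H₁)` for a potential whose square decays faster than the Hardy weight. -/
lemma IsBarrier.conditionH1_of_decay {V w H χ : E N → ℝ} {d κ c σ : ℝ}
    (C : IsBarrier V d κ (fun x => c * (1 + ‖x‖) ^ (-σ)) w) (hc : 0 < c) (hχ : IsTest χ)
    (hχ0 : ∀ x, 0 ≤ χ x) {Λ : Set (E N)} (hχΛ : ∀ x ∈ closure Λ, χ x = 1) {α M τ : ℝ}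
    (hM : 0 ≤ M) (hτ : σ < τ) (hH : ∀ x, H x ^ 2 * ‖x‖ ^ α ≤ M * (1 + ‖x‖) ^ (-τ)) :
    ConditionH1 α V Λ H := by
  have ht : ∀ x : E N, 0 < 1 + ‖x‖ := fun x => by positivity
  have hcont : ∀ s : ℝ, Continuous fun x : E N => (1 + ‖x‖) ^ s := fun s => by
    have h1 : Continuous fun x : E N => 1 + ‖x‖ := by fun_prop
    exact h1.rpow_const fun x => .inl (ht x).ne'
  have hq0 : ∀ x : E N, 0 < c * (1 + ‖x‖) ^ (-σ) := C.q_pos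
  have hratio : HasCompactSupport fun x => χ x / (c * (1 + ‖x‖) ^ (-σ)) :=
    hχ.2.mono fun x hx h0 => hx (by simp [h0])
  obtain ⟨B, hB⟩ := hratio.exists_bound_of_continuous
    (hχ.continuous.div (continuous_const.mul (hcont _)) fun x => (hq0 x).ne')
  have hB0 : 0 ≤ B := (norm_nonneg _).trans (hB 0)
  have hle : ∀ x : E N, (1 + ‖x‖) ^ (-τ) ≤ (1 + ‖x‖) ^ (-σ) := fun x =>
    Real.rpow_le_rpow_of_exponent_le (by linarith [norm_nonneg x]) (by linarith)
  refine C.conditionH1 (W := fun x => M * (1 + ‖x‖) ^ (-τ) + χ x) (K := M / c + B)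
    ((continuous_const.mul (hcont _)).add hχ.continuous) (by positivity) (fun x => ?_)
    (fun η hη => ?_) fun x => ?_
  · have h1 : χ x ≤ B * (c * (1 + ‖x‖) ^ (-σ)) :=
      (div_le_iff₀ (hq0 x)).1 ((le_abs_self _).trans (hB x))
    have h2 : M / c * (c * (1 + ‖x‖) ^ (-σ)) = M * (1 + ‖x‖) ^ (-σ) := by field_simp
    have h3 := mul_le_mul_of_nonneg_left (hle x) hM
    linarith
  · obtain ⟨R, hR⟩ := hχ.2.isCompact.isBounded.exists_norm_le
    obtain ⟨T, hT⟩ := ((tendsto_rpow_atTop (show 0 < τ - σ by linarith)).eventually_ge_atTop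
      (M / (η * c))).exists_forall_of_atTop
    refine ⟨max R T, fun x hx => ?_⟩
    have h1 : χ x = 0 := by
      by_contra h0
      have := hR x (subset_tsupport _ h0)
      have := (le_max_left R T).trans_lt hx
      linarith
    have h2 := hT (1 + ‖x‖) (by have := (le_max_right R T).trans_lt hx; linarith)
    rw [div_le_iff₀ (by positivity)] at h2
    have h3 : (1 + ‖x‖) ^ (-τ) * (1 + ‖x‖) ^ (τ - σ) = (1 + ‖x‖) ^ (-σ) := by
      rw [← Real.rpow_add (ht x)]; congr 1; ring
    have h4 := mul_le_mul_of_nonneg_left h2 (show 0 ≤ (1 + ‖x‖) ^ (-τ) by positivity)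
    rw [h1, add_zero, ← h3]
    linarith
  · have h1 : Λ.indicator (fun _ => (1 : ℝ)) x ≤ χ x := by
      refine indicator_le' (fun y hy => (hχΛ y (subset_closure hy)).ge) (fun y _ => hχ0 y) x
    exact add_le_add (hH x) h1

/-- The potentials `χ_{ℝ^N ∖ Λ} (e^{-λ/ε} U)^{p-1}` converge uniformly to zero. -/
lemma isPenalization_of_le_one {p lam : ℝ} (hp : 1 < p) (hlam : 0 < lam) {Λ : Set (E N)}
    (hΛ : MeasurableSet Λ) {U : E N → ℝ} (hU : AEStronglyMeasurable U volume)
    (hU0 : ∀ x, 0 ≤ U x) (hU1 : ∀ x, U x ≤ 1) (ε₀ : ℝ) :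
    IsPenalization Λ ε₀ fun ε => penalizationOf p Λ fun x => Real.exp (-lam / ε) * U x := by
  have h0 : ∀ ε x, 0 ≤ penalizationOf p Λ (fun x => Real.exp (-lam / ε) * U x) x := fun ε x =>
    indicator_nonneg (fun y _ => Real.rpow_nonneg (mul_nonneg (Real.exp_pos _).le (hU0 y)) _) x
  have h1 : ∀ ε x, penalizationOf p Λ (fun x => Real.exp (-lam / ε) * U x) x
      ≤ Real.exp (-lam / ε) ^ (p - 1) := fun ε x => by
    refine (indicator_le_self' (fun y _ => Real.rpow_nonneg
      (mul_nonneg (Real.exp_pos _).le (hU0 y)) _) x).trans ?_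
    exact Real.rpow_le_rpow (mul_nonneg (Real.exp_pos _).le (hU0 x))
      (mul_le_of_le_one_right (Real.exp_pos _).le (hU1 x)) (by linarith)
  refine ⟨fun ε _ => ?_, fun ε _ => h0 ε, fun ε _ => ⟨_, h1 ε⟩, fun ε _ x hx => ?_, ?_⟩
  · exact ((((hU.aemeasurable.const_mul _).pow_const _)).indicator hΛ.compl).aestronglyMeasurable
  · exact indicator_of_notMem (by simpa using hx) _
  · rw [Metric.tendstoUniformly_iff]
    intro r hr
    have h2 := (tendsto_rpow_mul_exp hlam (show 0 < p - 1 by linarith) 0).eventually_lt_const hr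
    filter_upwards [h2] with ε h3 x
    rw [Real.rpow_zero, one_mul] at h3
    rw [dist_comm, Real.dist_eq, sub_zero, abs_of_nonneg (h0 ε x)]
    exact (h1 ε x).trans_lt h3

lemma weightedHLSConstant_nonneg (N : ℕ) (α : ℝ) : 0 ≤ weightedHLSConstant N α := by
  unfold weightedHLSConstant
  positivity

end Choquard

/-! ### Construction of the penalization -/

theorem mainTheorem7 (N : ℕ) (α p : ℝ) (hα₀ : 0 < α) (hαN : α < N) (hp : 2 ≤ p)
    (V : Choquard.E N → ℝ) (hV : Continuous V) (hV₀ : ∀ x, 0 ≤ V x)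
    (Λ : Set (Choquard.E N)) (hΛ_open : IsOpen Λ) (hΛ_bdd : Bornology.IsBounded Λ)
    (hΛ_zero : (0 : Choquard.E N) ∈ Λ)
    (hΛ_pos : 0 < sInf (V '' Λ)) (hΛ_well : sInf (V '' Λ) < sInf (V '' frontier Λ))
    (h_linear : p = 2 → (N : ℝ) - 2 ≤ α →
      0 < ⨅ x : Choquard.E N, V x * (1 + ‖x‖ ^ ((N : ℝ) - α)))
    (h_decay : (2 < p ∨ α < (N : ℝ) - 2) →
      (N ≤ 2 ∨ p ≤ 1 + max α (1 + α / 2) / ((N : ℝ) - 2)) →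
      0 < liminf (fun x : Choquard.E N => ENNReal.ofReal (V x * ‖x‖ ^ 2))
        (cocompact (Choquard.E N)))
    (ν lam δ : ℝ) (hν : 0 < ν) (hlam : 0 < lam) (hδ₀ : 0 < δ) (hδ₁ : δ < 1) :
    ∃ ε₀ : ℝ, 0 < ε₀ ∧ ∃ u : ℝ → Choquard.E N → ℝ,
      (∀ ε ∈ Ioo 0 ε₀,
        (∀ x, 0 < u ε x) ∧
        (∀ x ∈ closure Λ, u ε x = Real.exp (-lam / ε)) ∧
        ∃ g : Choquard.E N → Choquard.E N,
          Choquard.MemH1V V (u ε) g ∧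
          Choquard.IsWeakSupersolution ε δ V (u ε) g (Choquard.choquardRHS α p ν ε Λ (u ε))) ∧
      Choquard.IsPenalization Λ ε₀ (fun ε => Choquard.penalizationOf p Λ (u ε)) ∧
      (∀ ε ∈ Ioo 0 ε₀,
        Choquard.ConditionH1 α V Λ (Choquard.penalizationOf p Λ (u ε))) ∧
      ∃ κ : ℝ, 0 < κ ∧ Choquard.weightedHLSConstant N α * p * κ < 1 ∧
        ∀ ε ∈ Ioo 0 ε₀,
          Choquard.HardyBound α κ ε V (Choquard.penalizationOf p Λ (u ε)) := by
  have hd : 0 < 1 - δ := by linarith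
  obtain ⟨a, b, σ, κ₀, c₀, ha, hb, hσ, hκ₀, hc₀, hi, hii, hiii, hcase, hρ⟩ :=
    Choquard.exists_exponents hα₀ hαN hp hV₀ h_linear h_decay hd
  obtain ⟨κ, c, A, χ, w, hc, hA, C, hχ, hχ0, hχw, hχΛ, hw1, hwA⟩ :=
    Choquard.exists_isBarrier_of_powerProfile hV hV₀ hΛ_bdd hΛ_zero hΛ_pos hd (by linarith) ha
      hb.le hσ.le hκ₀ hc₀ hρ
  obtain ⟨U, G, hUG, hU0, hχU, hUw, hsuper⟩ := C.exists_supersolution hχ hχ0 hχw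
  have hκ := C.κ_pos
  have hU1 : ∀ x, U x ≤ 1 := fun x => (hUw x).trans (hw1 x)
  have hUA : ∀ x, U x ≤ A * (1 + ‖x‖) ^ (-(2 * b)) := fun x => (hUw x).trans (hwA x)
  have hUm := hUG.1.1.aestronglyMeasurable
  have hG := hUG.memLp_grad hV hV₀
  have hq_cont := C.q_cont
  obtain ⟨K, hK⟩ := Choquard.exists_choquardRHS_le (lam := lam) hα₀ hαN hp hν.le hΛ_open hΛ_zero
    hU0 hA hUA hi hii hiii
  -- A nonnegative bound, as the comparison function on the right-hand side has to be nonnegative.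
  set K' : ℝ := max K 0 with hK'
  have hC0 := Choquard.weightedHLSConstant_nonneg N α
  -- The constant of the Hardy bound, small enough for `C_α p k₀ < 1`.
  set k₀ : ℝ := 1 / (2 * (Choquard.weightedHLSConstant N α * p + 1)) with hk₀
  have hp0 : 0 < p := by linarith
  have hCp : 0 ≤ Choquard.weightedHLSConstant N α * p := mul_nonneg hC0 hp0.le
  have hk₀0 : 0 < k₀ := by positivity
  -- Three conditions of smallness on `ε`: `ε² < κ` for the comparison of the energies, the absorption
  -- of the right-hand side, and the smallness of `H_ε` relative to the Hardy weight.
  have hsq : ∀ᶠ ε in 𝓝[>] (0 : ℝ), ε ^ 2 < κ := by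
    have h1 : Tendsto (fun ε : ℝ => ε ^ 2) (𝓝[>] 0) (𝓝 0) := by
      have := ((continuous_pow 2).tendsto (0 : ℝ)).mono_left
        (nhdsWithin_le_nhds (s := Ioi (0 : ℝ)))
      simpa using this
    exact h1.eventually_lt_const hκ
  have hrhs := Choquard.eventually_rhsSize_le (ν := ν) hαN hp hlam hV₀ hd hκ hc K' hcase
  have hhardy := ((Choquard.tendsto_rpow_mul_exp hlam (show 0 < 2 * p - 2 by linarith)
    (-α - 2)).const_mul (A ^ (2 * p - 2) / c * κ))
  rw [mul_zero] at hhardy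
  obtain ⟨ε₀, hε₀, hsmall⟩ := mem_nhdsGT_iff_exists_Ioo_subset.1
    (hsq.and (hrhs.and (hhardy.eventually_lt_const hk₀0)))
  have hε₀ : 0 < ε₀ := hε₀
  have hS : ∀ ε : ℝ, 0 < Real.exp (-lam / ε) := fun ε => Real.exp_pos _
  have hHle : ∀ ε x, Choquard.penalizationOf p Λ (fun y => Real.exp (-lam / ε) * U y) x ^ 2 * ‖x‖ ^ α
      ≤ Real.exp (-lam / ε) ^ (2 * p - 2) * A ^ (2 * p - 2)
        * (1 + ‖x‖) ^ (-(2 * b * (2 * p - 2) - α)) := fun ε =>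
    Choquard.penalizationOf_sq_mul_le hα₀.le (by linarith) (fun x => (hU0 x).le) hA (hS ε).le hUA
  refine ⟨ε₀, hε₀, fun ε x => Real.exp (-lam / ε) * U x, fun ε hε => ⟨fun x =>
    mul_pos (hS ε) (hU0 x), fun x hx => ?_, fun x => Real.exp (-lam / ε) • G x,
    hUG.const_mul _, ?_⟩,
    Choquard.isPenalization_of_le_one (by linarith) hlam hΛ_open.measurableSet hUm
      (fun x => (hU0 x).le) hU1 ε₀, fun ε hε => ?_, k₀, hk₀0, ?_, fun ε hε => ?_⟩
  · -- On `closure Λ` the two obstacles `χ` and `w` both equal one.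
    have h1 : 1 ≤ U x := (hχΛ x hx).ge.trans (hχU x)
    change Real.exp (-lam / ε) * U x = _
    rw [le_antisymm (hU1 x) h1, mul_one]
  · obtain ⟨h1, h2, -⟩ := hsmall hε
    have hr : 0 ≤ Choquard.rhsSize N α p ν lam ε := by
      have := hε.1
      rw [Choquard.rhsSize]
      positivity
    have hK0 : 0 ≤ K' := le_max_right _ _
    have ht : Continuous fun x : Choquard.E N => (1 + ‖x‖) ^ (-σ) := by
      have e1 : Continuous fun x : Choquard.E N => 1 + ‖x‖ := by fun_prop
      have e2 : ∀ x : Choquard.E N, 1 + ‖x‖ ≠ 0 := fun x => by positivity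
      exact e1.rpow_const fun x => .inl (e2 x)
    refine Choquard.isWeakSupersolution_of_le (k := fun x => K' * Choquard.rhsSize N α p ν lam ε *
      (1 + ‖x‖) ^ (-σ)) hV hδ₁ hq_cont hκ (continuous_const.mul ht) (fun x => by positivity)
      (hS ε).le hUm (fun x => (hU0 x).le) hU1 hG hsuper (fun x => (hK ε hε.1 x).trans ?_) h2
    have := hU0 x
    gcongr
    exact le_max_left _ _
  · exact C.conditionH1_of_decay hc hχ hχ0 hχΛ (by have := hS ε; positivity) (by linarith)
      (hHle ε)
  · rw [hk₀, mul_one_div, div_lt_one (by positivity)]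
    linarith
  · obtain ⟨h1, -, h3⟩ := hsmall hε
    have hε0 := hε.1
    have hS := hS ε
    refine C.hardyBound (M := Real.exp (-lam / ε) ^ (2 * p - 2) * A ^ (2 * p - 2) / c) hε0 h1.le
      (by positivity) (fun x => (hHle ε x).trans ?_) ?_
    · have e1 : (1 + ‖x‖) ^ (-(2 * b * (2 * p - 2) - α)) ≤ (1 + ‖x‖) ^ (-σ) :=
        Real.rpow_le_rpow_of_exponent_le (by linarith [norm_nonneg x]) (by linarith)
      rw [← mul_assoc, div_mul_cancel₀ _ hc.ne']
      gcongr
    · refine le_of_eq_of_le ?_ h3.le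
      rw [Real.rpow_sub hε0, Real.rpow_two]
      ring
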